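/- An instance of the demand-robust shortest path problem consists of a finite undirected graph $G=(V,E)$ with positive edge lengths $w:E\to\mathbb R_{>0}$, a root $r\in V$, a nonempty set $T\subseteq V\setminus\{r\}$ of terminals, and a real inflation factor $\lambda>1$. A solution is any set $E_I\subseteq E$; its cost is $$\mathrm{cost}(E_I)=\sum_{e\in E_I}w(e)+\lambda\cdot\max_{t\in T}d_{E_I}(t),$$ where $d_{E_I}(t)$ is the length of a shortest $r$–$t$ path in $G$ after the lengths of all edges in $E_I$ have been set to $0$ ($d_{E_I}(t)=\infty$ if $G$ has no $r$–$t$ path). There is an algorithm that, given any such instance, outputs a set $E_I\subseteq E$ with $$\mathrm{cost}(E_I)\le 4\cdot\min_{F\subseteq E}\mathrm{cost}(F),$$ and that runs in time $$O\bigl(\min(\lambda,|T|)\,(|E|+|V|\log|V|)\bigr)$$ with an absolute implied constant. Here an algorithm is a single program for a unit-cost random access machine, independent of the instance. The machine stores integers (which it can copy, increment, decrement, compare and use as addresses) and real numbers (which it can copy, add and compare). The input is the list of edges with their lengths, the list of terminals, $r$, $\lambda$, $|V|$, $|E|$ and $|T|$, and the time is the number of elementary instructions and tests that are executed. -/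

import Mathlib

open scoped ENNReal

/-! ### The machine model

A unit-cost random access machine with two sorts of data, natural numbers (counters, indices,
vertex and edge names) and real numbers (lengths), programmed in a structured language.  Integers
can be copied, incremented, decremented, compared and used as addresses; reals can be copied,
added and compared, and nothing else.  There is no conversion between the two sorts, and the
only constants in a program are natural numbers.  In `t` steps an integer can grow by at most `t`
(beyond the input and the constants of the program), so that unit cost is not abused. -/

namespace RAM

/-- A memory: integer and real registers, and integer and real arrays.  The first argument of
`natArr` and `realArr` is the name of the array, the second one is the index of the cell.  A program
mentions only finitely many registers and arrays. -/
structure State where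
  natReg : ℕ → ℕ
  realReg : ℕ → ℝ
  natArr : ℕ → ℕ → ℕ
  realArr : ℕ → ℕ → ℝ

/-- The elementary instructions. -/
inductive Instr where
  /-- integer register `x := c` -/
  | natConst (x c : ℕ)
  /-- integer registers `x := y` -/
  | natMove (x y : ℕ)
  /-- integer register `x := x + 1` -/
  | natSucc (x : ℕ)
  /-- integer register `x := x - 1` (and `0` stays `0`) -/
  | natPred (x : ℕ)
  /-- integer register `x := a[i]`, where the index is the content of integer register `i` -/
  | natLoad (x a i : ℕ)
  /-- integer array `a[i] := x` -/
  | natStore (a i x : ℕ)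
  /-- real register `x := c` -/
  | realConst (x c : ℕ)
  /-- real registers `x := y` -/
  | realMove (x y : ℕ)
  /-- real registers `x := y + z` -/
  | realAdd (x y z : ℕ)
  /-- real register `x := a[i]`, where the index is the content of integer register `i` -/
  | realLoad (x a i : ℕ)
  /-- real array `a[i] := x` -/
  | realStore (a i x : ℕ)

/-- The effect of an elementary instruction. -/
noncomputable def Instr.apply : Instr → State → State
  | .natConst x c, s => { s with natReg := Function.update s.natReg x c }
  | .natMove x y, s => { s with natReg := Function.update s.natReg x (s.natReg y) }
  | .natSucc x, s => { s with natReg := Function.update s.natReg x (s.natReg x + 1) }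
  | .natPred x, s => { s with natReg := Function.update s.natReg x (s.natReg x - 1) }
  | .natLoad x a i, s =>
      { s with natReg := Function.update s.natReg x (s.natArr a (s.natReg i)) }
  | .natStore a i x, s =>
      { s with
        natArr := Function.update s.natArr a
          (Function.update (s.natArr a) (s.natReg i) (s.natReg x)) }
  | .realConst x c, s => { s with realReg := Function.update s.realReg x (c : ℝ) }
  | .realMove x y, s => { s with realReg := Function.update s.realReg x (s.realReg y) }
  | .realAdd x y z, s =>
      { s with realReg := Function.update s.realReg x (s.realReg y + s.realReg z) }
  | .realLoad x a i, s =>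
      { s with realReg := Function.update s.realReg x (s.realArr a (s.natReg i)) }
  | .realStore a i x, s =>
      { s with
        realArr := Function.update s.realArr a
          (Function.update (s.realArr a) (s.natReg i) (s.realReg x)) }

/-- The tests: comparisons of two registers of the same sort. -/
inductive Test where
  | natEq (x y : ℕ)
  | natLT (x y : ℕ)
  | realLE (x y : ℕ)

/-- The truth value of a test. -/
def Test.Holds : Test → State → Prop
  | .natEq x y, s => s.natReg x = s.natReg y
  | .natLT x y, s => s.natReg x < s.natReg y
  | .realLE x y, s => s.realReg x ≤ s.realReg y

/-- Programs. -/
inductive Program where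
  | skip
  | instr (i : Instr)
  | seq (p q : Program)
  | ite (b : Test) (p q : Program)
  | while (b : Test) (p : Program)

/-- `Exec p s t s'`: the program `p`, started in `s`, halts in the state `s'` after exactly `t` steps.
Every instruction and every evaluation of a test is one step. -/
inductive Exec : Program → State → ℕ → State → Prop where
  | skip (s : State) : Exec .skip s 1 s
  | instr (i : Instr) (s : State) : Exec (.instr i) s 1 (i.apply s)
  | seq {p q : Program} {s s' s'' : State} {t t' : ℕ} :
      Exec p s t s' → Exec q s' t' s'' → Exec (.seq p q) s (t + t') s''
  | iteTrue {b : Test} {p q : Program} {s s' : State} {t : ℕ} :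
      b.Holds s → Exec p s t s' → Exec (.ite b p q) s (t + 1) s'
  | iteFalse {b : Test} {p q : Program} {s s' : State} {t : ℕ} :
      ¬ b.Holds s → Exec q s t s' → Exec (.ite b p q) s (t + 1) s'
  | whileFalse {b : Test} {p : Program} {s : State} :
      ¬ b.Holds s → Exec (.while b p) s 1 s
  | whileTrue {b : Test} {p : Program} {s s' s'' : State} {t t' : ℕ} :
      b.Holds s → Exec p s t s' → Exec (.while b p) s' t' s'' →
      Exec (.while b p) s (t + t' + 1) s''

end RAM

/-! ### Demand-robust shortest path -/

/-- An instance of demand-robust shortest path: an undirected graph with vertices `0, …, n - 1` and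
edges `0, …, m - 1` (parallel edges and loops are allowed, the graph need not be connected), positive
edge lengths, a root, a nonempty list of `k` distinct terminals different from the root, and an
inflation factor greater than `1`. -/
structure RobustSP where
  /-- `|V|` -/
  n : ℕ
  /-- `|E|` -/
  m : ℕ
  /-- `|T|` -/
  k : ℕ
  /-- the first endpoint of an edge (the orientation has no meaning) -/
  fst : Fin m → Fin n
  /-- the second endpoint of an edge -/
  snd : Fin m → Fin n
  len : Fin m → ℝ
  len_pos : ∀ e, 0 < len e
  root : Fin n
  term : Fin k → Fin n
  term_injective : Function.Injective term
  term_ne_root : ∀ i, term i ≠ root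
  k_pos : 0 < k
  infl : ℝ
  one_lt_infl : 1 < infl

namespace RobustSP

/-- The edge `e` joins `u` and `v`. -/
def Joins (I : RobustSP) (e : Fin I.m) (u v : Fin I.n) : Prop :=
  (I.fst e = u ∧ I.snd e = v) ∨ (I.fst e = v ∧ I.snd e = u)

/-- `I.IsWalk u v p`: the list of edges `p` is a walk from `u` to `v`. -/
inductive IsWalk (I : RobustSP) : Fin I.n → Fin I.n → List (Fin I.m) → Prop where
  | nil (u : Fin I.n) : IsWalk I u u []
  | cons {u v x : Fin I.n} {e : Fin I.m} {p : List (Fin I.m)} :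
      I.Joins e u v → IsWalk I v x p → IsWalk I u x (e :: p)

/-- The length of a walk when the lengths of the edges in `F` are set to `0`. -/
noncomputable def walkLen (I : RobustSP) (F : Finset (Fin I.m)) (p : List (Fin I.m)) : ℝ :=
  (p.map fun e => if e ∈ F then 0 else I.len e).sum

/-- The length of a shortest path from the root to `v` when the lengths of the edges in `F` are set to
`0`; it is `∞` if there is no path. -/
noncomputable def dist (I : RobustSP) (F : Finset (Fin I.m)) (v : Fin I.n) : ℝ≥0∞ :=
  ⨅ (p : List (Fin I.m)) (_ : I.IsWalk I.root v p), ENNReal.ofReal (I.walkLen F p)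

/-- The two-stage cost of buying the set `F` of edges in the first stage. -/
noncomputable def cost (I : RobustSP) (F : Finset (Fin I.m)) : ℝ≥0∞ :=
  ENNReal.ofReal (∑ e ∈ F, I.len e) +
    ENNReal.ofReal I.infl * ⨆ i : Fin I.k, I.dist F (I.term i)

/-- The optimal two-stage cost (a minimum: there are finitely many sets of edges). -/
noncomputable def opt (I : RobustSP) : ℝ≥0∞ :=
  ⨅ F : Finset (Fin I.m), I.cost F

/-- An array whose first `l` cells are given, and whose other cells are `0`. -/
def toArr {α : Type} [Zero α] {l : ℕ} (f : Fin l → α) (j : ℕ) : α :=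
  if h : j < l then f ⟨j, h⟩ else 0

/-- The memory that holds the instance as input: integer registers `0, 1, 2, 3` hold the numbers of
vertices, edges and terminals, and the root; integer arrays `0, 1, 2` hold the first endpoints and the
second endpoints of the edges, and the terminals; real register `0` holds the inflation factor and
real array `0` the edge lengths.  Everything else is `0`. -/
def input (I : RobustSP) : RAM.State where
  natReg
    | 0 => I.n
    | 1 => I.m
    | 2 => I.k
    | 3 => I.root
    | _ => 0
  realReg
    | 0 => I.infl
    | _ => 0
  natArr
    | 0 => toArr fun e => (I.fst e : ℕ)
    | 1 => toArr fun e => (I.snd e : ℕ)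
    | 2 => toArr fun i => (I.term i : ℕ)
    | _ => fun _ => 0
  realArr
    | 0 => toArr I.len
    | _ => fun _ => 0

/-- The set of edges that is read off the memory `s` as output: those marked in integer array `3`. -/
def output (I : RobustSP) (s : RAM.State) : Finset (Fin I.m) :=
  Finset.univ.filter fun e => s.natArr 3 e = 1

end RobustSP

/-! ### Reasoning about programs -/

/-! Let q be the minimum of |T| and the integer part of λ. The algorithm picks q terminals greedily,
each as far as possible from the root and the earlier picks. Then it buys edges that connect the
picks to the root, growing one component and always joining the pick that is nearest to it along a
shortest path. Every round of either phase is one run of Dijkstra's algorithm with several sources,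
so at most 2q ≤ 2·min(λ,|T|) runs are needed. If some terminal cannot be reached, the optimum is
infinite and every output will do (`opt_eq_top`).

The factor 4 is the sum of two factors 2 (`cost_le_aux`). Fix a solution F of total length w(F)
whose second-stage distances are at most D.

First stage: adding to F the remaining edges of walks to the q picks costs at most qD ≤ λD and joins
all picks to the root. Doubling the edges that are reached gives a closed walk (`exists_tour`). Cut
at the picks, it becomes a system of connections between picks and root of length at most 2(w(F) +
λD) (`attach_of_reached`). By the exchange argument of Prim's algorithm (`Attach.step`), the greedy
growth never pays more than any such system.

Second stage: let δ be the largest distance of a terminal from the set of root and picks. If δ > 0,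
then q < |T|, so λ < q + 1. The picks together with a worst-served terminal are then q + 1 points at
distance at least δ from each other and from the root. The balls of radius δ/2 around them share no
edge length (`sum_part_le`). In each ball F must contain length at least δ/2 − D, because the center
is within D of the root once F is free. Hence (q + 1)(δ/2 − D) ≤ w(F) (`card_mul_le`), which gives
λδ ≤ 2(w(F) + λD).

For the running time, Dijkstra's algorithm uses a Fibonacci heap stored in arrays. The children of a
vertex occupy consecutive cells, and a cut fills the gap with the last child. This is harmless,
since the structural condition only bounds the index of a child from above, by its rank plus its
mark. That condition yields Fibonacci-sized subtrees, hence logarithmic ranks (`Forest.rank_lt`),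
and a potential that counts stacked roots and marked children gives the amortised bounds. Programs
are verified with a Hoare-style calculus: loop invariants carry a clock, and what a program leaves
alone is read off its syntax (`Exec.keeps`). -/

namespace RAM

/-- `Runs p s Q`: started in `s`, the program `p` halts after some number `t` of steps in a state
`s'` such that `Q t s'`. -/
def Runs (p : Program) (s : State) (Q : ℕ → State → Prop) : Prop :=
  ∃ t s', Exec p s t s' ∧ Q t s'

theorem Runs.mono {p : Program} {s : State} {Q Q' : ℕ → State → Prop} (h : Runs p s Q)
    (hQ : ∀ t s', Q t s' → Q' t s') : Runs p s Q' := by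
  obtain ⟨t, s', h1, h2⟩ := h
  exact ⟨t, s', h1, hQ _ _ h2⟩

theorem Runs.seq {p q : Program} {s : State} {Q : ℕ → State → Prop}
    (h : Runs p s fun t s' => Runs q s' fun t' s'' => Q (t + t') s'') :
    Runs (.seq p q) s Q := by
  obtain ⟨t, s', h1, t', s'', h2, h3⟩ := h
  exact ⟨_, _, .seq h1 h2, h3⟩

theorem Runs.ite {b : Test} {p q : Program} {s : State} {Q : ℕ → State → Prop}
    (h1 : b.Holds s → Runs p s fun t s' => Q (t + 1) s')
    (h2 : ¬ b.Holds s → Runs q s fun t s' => Q (t + 1) s') : Runs (.ite b p q) s Q := by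
  by_cases hb : b.Holds s
  · obtain ⟨t, s', h, h'⟩ := h1 hb
    exact ⟨_, _, .iteTrue hb h, h'⟩
  · obtain ⟨t, s', h, h'⟩ := h2 hb
    exact ⟨_, _, .iteFalse hb h, h'⟩

/-- A straight-line program. -/
def block : List Instr → Program
  | [] => .skip
  | i :: l => .seq (.instr i) (block l)

/-- The effect of a straight-line program. -/
noncomputable def runList : List Instr → State → State
  | [], s => s
  | i :: l, s => runList l (i.apply s)

theorem exec_block (l : List Instr) (s : State) : Exec (block l) s (l.length + 1) (runList l s) := by
  induction l generalizing s with
  | nil => exact .skip s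
  | cons i l ih =>
    have := Exec.seq (.instr i s) (ih (i.apply s))
    rw [Nat.add_comm] at this
    exact this

theorem Runs.block {l : List Instr} {s : State} {Q : ℕ → State → Prop}
    (h : Q (l.length + 1) (runList l s)) : Runs (block l) s Q :=
  ⟨_, _, exec_block l s, h⟩

/-- The integer registers that an instruction writes. -/
def Instr.natRegs : Instr → List ℕ
  | .natConst x _ | .natMove x _ | .natSucc x | .natPred x | .natLoad x _ _ => [x]
  | _ => []

/-- The real registers that an instruction writes. -/
def Instr.realRegs : Instr → List ℕ
  | .realConst x _ | .realMove x _ | .realAdd x _ _ | .realLoad x _ _ => [x]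
  | _ => []

/-- The integer arrays that an instruction writes. -/
def Instr.natArrs : Instr → List ℕ
  | .natStore a _ _ => [a]
  | _ => []

/-- The real arrays that an instruction writes. -/
def Instr.realArrs : Instr → List ℕ
  | .realStore a _ _ => [a]
  | _ => []

/-- The union of `f i` over all instructions `i` of a program. -/
def Program.collect (f : Instr → List ℕ) : Program → List ℕ
  | .skip => []
  | .instr i => f i
  | .seq p q => p.collect f ++ q.collect f
  | .ite _ p q => p.collect f ++ q.collect f
  | .while _ p => p.collect f

/-- `s` and `s'` differ only in registers and arrays that `p` writes. -/
structure Keeps (p : Program) (s s' : State) : Prop where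
  natReg : ∀ x, x ∉ p.collect Instr.natRegs → s'.natReg x = s.natReg x
  realReg : ∀ x, x ∉ p.collect Instr.realRegs → s'.realReg x = s.realReg x
  natArr : ∀ x, x ∉ p.collect Instr.natArrs → s'.natArr x = s.natArr x
  realArr : ∀ x, x ∉ p.collect Instr.realArrs → s'.realArr x = s.realArr x

theorem Keeps.refl (p : Program) (s : State) : Keeps p s s :=
  ⟨fun _ _ => rfl, fun _ _ => rfl, fun _ _ => rfl, fun _ _ => rfl⟩

theorem Keeps.trans {p : Program} {s s' s'' : State} (h : Keeps p s s') (h' : Keeps p s' s'') :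
    Keeps p s s'' :=
  ⟨fun x hx => (h'.natReg x hx).trans (h.natReg x hx),
    fun x hx => (h'.realReg x hx).trans (h.realReg x hx),
    fun x hx => (h'.natArr x hx).trans (h.natArr x hx),
    fun x hx => (h'.realArr x hx).trans (h.realArr x hx)⟩

theorem Keeps.weaken {p q : Program} {s s' : State} (h : Keeps p s s')
    (hq : ∀ f x, x ∈ p.collect f → x ∈ q.collect f) : Keeps q s s' :=
  ⟨fun x hx => h.natReg x fun hx' => hx (hq _ _ hx'), fun x hx => h.realReg x fun hx' => hx (hq _ _ hx'),
    fun x hx => h.natArr x fun hx' => hx (hq _ _ hx'),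
    fun x hx => h.realArr x fun hx' => hx (hq _ _ hx')⟩

theorem keeps_instr (i : Instr) (s : State) : Keeps (.instr i) s (i.apply s) := by
  constructor <;> intro x hx <;> cases i <;>
    simp_all [Program.collect, Instr.natRegs, Instr.realRegs, Instr.natArrs, Instr.realArrs,
      Instr.apply, Function.update_of_ne]

/-- This is the frame rule. The written names are a list computed from the syntax, so later side
conditions of the form "this loop does not touch that register" are settled by `decide`. -/
theorem Exec.keeps {p : Program} {s s' : State} {t : ℕ} (h : Exec p s t s') : Keeps p s s' := by
  induction h with
  | skip s => exact .refl _ _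
  | instr i s => exact keeps_instr i s
  | seq _ _ ih1 ih2 =>
    exact (ih1.weaken fun f x hx => by simp [Program.collect, hx]).trans
      (ih2.weaken fun f x hx => by simp [Program.collect, hx])
  | iteTrue _ _ ih => exact ih.weaken fun f x hx => by simp [Program.collect, hx]
  | iteFalse _ _ ih => exact ih.weaken fun f x hx => by simp [Program.collect, hx]
  | whileFalse _ => exact .refl _ _
  | whileTrue _ _ _ ih1 ih2 => exact (ih1.weaken fun f x hx => by simpa [Program.collect] using hx).trans ih2

theorem Runs.keeps {p : Program} {s : State} {Q : ℕ → State → Prop} (h : Runs p s Q) :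
    Runs p s fun t s' => Q t s' ∧ Keeps p s s' := by
  obtain ⟨t, s', h1, h2⟩ := h
  exact ⟨t, s', h1, h2, h1.keeps⟩

/-- The rule for loops: an invariant that also knows the time used so far and bounds it. -/
theorem Runs.while {b : Test} {p : Program} {s₀ : State} {Q : ℕ → State → Prop}
    (J : ℕ → State → Prop) (B : ℕ) (hB : ∀ t s, J t s → t ≤ B) (h₀ : J 0 s₀)
    (step : ∀ t s, J t s → Keeps p s₀ s → b.Holds s →
      Runs p s fun t' s' => J (t + t' + 1) s')
    (done : ∀ t s, J t s → Keeps p s₀ s → ¬ b.Holds s → Q (t + 1) s) :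
    Runs (.while b p) s₀ Q := by
  -- Every iteration takes at least one step and the clock never exceeds `B`, so the remaining
  -- budget `N` is a termination measure. No separate variant is needed.
  suffices H : ∀ N t s, B < t + N → J t s → Keeps p s₀ s →
      Runs (.while b p) s fun t' s' => Q (t + t') s' by
    simpa using H (B + 1) 0 s₀ (by omega) h₀ (.refl _ _)
  intro N
  induction N with
  | zero =>
    intro t s hN hJ hk
    have := hB t s hJ
    omega
  | succ N ih =>
    intro t s hN hJ hk
    by_cases hb : b.Holds s
    · obtain ⟨t', s', h1, h2⟩ := step t s hJ hk hb
      obtain ⟨t'', s'', h4, h5⟩ := ih _ s' (by omega) h2 (hk.trans h1.keeps)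
      refine ⟨_, _, .whileTrue hb h1 h4, ?_⟩
      have : t + (t' + t'' + 1) = t + t' + 1 + t'' := by omega
      simpa only [this] using h5
    · exact ⟨_, _, .whileFalse hb, done t s hJ hk hb⟩

/-- The duration is supplied as a numeral and checked by `rfl`, which keeps the clock in a form that
linear arithmetic can use. -/
theorem Runs.blockSeq {l : List Instr} {q : Program} {s : State} {Q : ℕ → State → Prop} (T : ℕ)
    (h : Runs q (runList l s) fun t s' => Q (T + t) s') (hT : l.length + 1 = T := by rfl) :
    Runs (.seq (RAM.block l) q) s Q :=
  .seq (.block (by rw [hT]; exact h))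

theorem Runs.blockEnd {l : List Instr} {s : State} {Q : ℕ → State → Prop} (T : ℕ)
    (h : Q T (runList l s)) (hT : l.length + 1 = T := by rfl) : Runs (RAM.block l) s Q :=
  .block (by rw [hT]; exact h)

theorem Runs.skip {s : State} {Q : ℕ → State → Prop} (h : Q 1 s) : Runs .skip s Q :=
  ⟨_, _, .skip s, h⟩

end RAM

/-! ### Fibonacci heaps in arrays -/

/-- The arrays that represent a heap on vertices `v < n`.  The children of `v` are stored in the
cells `v * R, …, v * R + rank v - 1` of `slot`; `par v` is `0` for a root and the parent plus `1`
otherwise, and `pos v` is the cell in which `v` is stored as a child.  Roots are stored in the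
stack `stk 0, …, stk (ns - 1)` or, during a consolidation, by rank and increased by `1`, in `tab`. -/
structure Heap where
  par : ℕ → ℕ
  rank : ℕ → ℕ
  mark : ℕ → ℕ
  pos : ℕ → ℕ
  slot : ℕ → ℕ
  top : ℕ → ℕ
  stk : ℕ → ℕ
  tab : ℕ → ℕ
  ns : ℕ
  key : ℕ → ℝ

namespace Heap

open Function

theorem cell_inj {R p q i j : ℕ} (hi : i < R) (hj : j < R) (h : p * R + i = q * R + j) :
    p = q ∧ i = j := by
  have hR : 0 < R := by omega
  have h1 : (p * R + i) / R = p := by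
    rw [Nat.add_comm, Nat.add_mul_div_right _ _ hR, Nat.div_eq_of_lt hi, Nat.zero_add]
  have h2 : (q * R + j) / R = q := by
    rw [Nat.add_comm, Nat.add_mul_div_right _ _ hR, Nat.div_eq_of_lt hj, Nat.zero_add]
  have h3 : p = q := by rw [← h1, ← h2, h]
  subst h3
  exact ⟨rfl, by omega⟩

/-- The arrays describe a heap-ordered forest on the vertices in `A`.  The condition that bounds
the rank of a child from below is waived for vertices in `X`. -/
structure Forest (h : Heap) (n R : ℕ) (A X : Finset ℕ) : Prop where
  mem_lt : ∀ v ∈ A, v < n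
  top_eq : ∀ v < n, h.top v = v * R + h.rank v
  rank_out : ∀ v, v ∉ A → h.rank v = 0
  par_out : ∀ v, v ∉ A → h.par v = 0
  mark_le : ∀ v, h.mark v ≤ 1
  rank_le : ∀ v, h.rank v ≤ R
  par_mem : ∀ v p, h.par v = p + 1 → p ∈ A
  pos_eq : ∀ v p, h.par v = p + 1 →
    ∃ j < h.rank p, h.pos v = p * R + j ∧ (v ∉ X → j ≤ h.rank v + h.mark v)
  slot_pos : ∀ v p, h.par v = p + 1 → h.slot (h.pos v) = v
  par_slot : ∀ p, ∀ j < h.rank p, h.par (h.slot (p * R + j)) = p + 1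
  pos_slot : ∀ p, ∀ j < h.rank p, h.pos (h.slot (p * R + j)) = p * R + j
  acyc : ∃ ht : ℕ → ℕ, ∀ v p, h.par v = p + 1 → ht v < ht p
  order : ∀ v p, h.par v = p + 1 → h.key p ≤ h.key v

variable {h : Heap} {n R : ℕ} {A X : Finset ℕ}

theorem Forest.mem_of_par (F : h.Forest n R A X) {v p : ℕ} (hv : h.par v = p + 1) : v ∈ A := by
  by_contra hA
  rw [F.par_out v hA] at hv
  omega

theorem Forest.ne_of_par (F : h.Forest n R A X) {v p : ℕ} (hv : h.par v = p + 1) : v ≠ p := by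
  rintro rfl
  obtain ⟨ht, h1⟩ := F.acyc
  exact lt_irrefl _ (h1 _ _ hv)

/-- Make the vertex `x`, which is a child, a root: its cell is filled with the last child of its
parent, and the parent is marked. -/
def cut (h : Heap) (x : ℕ) : Heap :=
  { h with
    par := update h.par x 0
    rank := update h.rank (h.par x - 1) (h.rank (h.par x - 1) - 1)
    mark := update h.mark (h.par x - 1) 1
    pos := update h.pos (h.slot (h.top (h.par x - 1) - 1)) (h.pos x)
    slot := update h.slot (h.pos x) (h.slot (h.top (h.par x - 1) - 1))
    top := update h.top (h.par x - 1) (h.top (h.par x - 1) - 1)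
    stk := update h.stk h.ns x
    ns := h.ns + 1 }

/-- The last child `l` moves to the smaller index `j0`, so the lower bound on its rank only becomes
weaker. The parent `p` loses one from its rank and has mark 1 afterwards. Its own bound survives if
it was unmarked; otherwise `p` has to be put on the waiver list `X'` until it is cut as well. -/
theorem Forest.cut (F : h.Forest n R A X) {x p : ℕ} (hx : h.par x = p + 1) (hX : X ⊆ {x})
    {X' : Finset ℕ} (hX' : p ∉ X' → h.mark p = 0) : (h.cut x).Forest n R A X' := by
  have hpA := F.par_mem x p hx
  have hxp := F.ne_of_par hx
  obtain ⟨j0, hj0, hpx, -⟩ := F.pos_eq x p hx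
  have hsx := F.slot_pos x p hx
  obtain ⟨r, hr⟩ : ∃ r, h.rank p = r + 1 := ⟨h.rank p - 1, by omega⟩
  have hrR := F.rank_le p
  have htop : h.top p - 1 = p * R + r := by rw [F.top_eq p (F.mem_lt p hpA)]; omega
  obtain ⟨l, hl⟩ : ∃ l, l = h.slot (p * R + r) := ⟨_, rfl⟩
  have hlp : h.par l = p + 1 := hl ▸ F.par_slot p r (by omega)
  have hlpos : h.pos l = p * R + r := hl ▸ F.pos_slot p r (by omega)
  have hlX : l ≠ x → l ∉ X := fun h1 h2 => h1 (Finset.mem_singleton.1 (hX h2))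
  have hlne := F.ne_of_par hlp
  have hxl : x = l ↔ j0 = r := by
    constructor
    · rintro rfl
      omega
    · intro e
      rw [← hsx, hpx, e, hl]
  have key : h.cut x = { h with
      par := update h.par x 0, rank := update h.rank p r, mark := update h.mark p 1,
      pos := update h.pos l (p * R + j0), slot := update h.slot (p * R + j0) l,
      top := update h.top p (p * R + r), stk := update h.stk h.ns x, ns := h.ns + 1 } := by
    simp only [Heap.cut, hx, Nat.add_sub_cancel, htop, ← hl, hpx, hr]
  rw [key]
  have par' : ∀ v q, update h.par x 0 v = q + 1 → v ≠ x ∧ h.par v = q + 1 := by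
    intro v q hv
    rcases eq_or_ne v x with rfl | hne
    · simp at hv
    · rw [update_of_ne hne] at hv
      exact ⟨hne, hv⟩
  constructor <;> try dsimp only
  · exact F.mem_lt
  · intro v hv
    rcases eq_or_ne v p with rfl | hne
    · simp
    · simp [update_of_ne hne, F.top_eq v hv]
  · intro v hv
    have : v ≠ p := fun e => hv (e ▸ hpA)
    rw [update_of_ne this, F.rank_out v hv]
  · intro v hv
    rcases eq_or_ne v x with rfl | hne
    · simp
    · rw [update_of_ne hne, F.par_out v hv]
  · intro v
    rcases eq_or_ne v p with rfl | hne
    · simp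
    · rw [update_of_ne hne]; exact F.mark_le v
  · intro v
    rcases eq_or_ne v p with rfl | hne
    · simp; omega
    · rw [update_of_ne hne]; exact F.rank_le v
  · intro v q hv
    exact F.par_mem v q (par' v q hv).2
  · intro v q hv
    obtain ⟨hvx, hv⟩ := par' v q hv
    rcases eq_or_ne v l with rfl | hvl
    · obtain rfl : p = q := by omega
      have hj : j0 ≠ r := fun e => hvx (hxl.2 e).symm
      refine ⟨j0, by simp; omega, by simp, fun _ => ?_⟩
      obtain ⟨j, h1, h2, h3⟩ := F.pos_eq v p hv
      have := h3 (hlX hvx)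
      rw [update_of_ne hlne, update_of_ne hlne]
      omega
    · obtain ⟨j, h1, h2, h3⟩ := F.pos_eq v q hv
      have h3 := h3 fun hm => hvx (Finset.mem_singleton.1 (hX hm))
      refine ⟨j, ?_, by rw [update_of_ne hvl, h2], fun hvX => ?_⟩
      · rcases eq_or_ne q p with rfl | hqp
        · rw [update_self]
          have : j ≠ r := by
            rintro rfl
            apply hvl
            rw [hl, ← h2, F.slot_pos v q hv]
          omega
        · rwa [update_of_ne hqp]
      · rcases eq_or_ne v p with rfl | hvp
        · have := hX' hvX
          simp only [update_self]
          omega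
        · rwa [update_of_ne hvp, update_of_ne hvp]
  · intro v q hv
    obtain ⟨hvx, hv⟩ := par' v q hv
    rcases eq_or_ne v l with rfl | hvl
    · simp
    · rw [update_of_ne hvl, update_of_ne, F.slot_pos v q hv]
      intro e
      rw [← hpx] at e
      rw [← hsx, ← e, F.slot_pos v q hv] at hvx
      exact hvx rfl
  · intro q j hj
    have hjq : j < h.rank q := by
      rcases eq_or_ne q p with rfl | hqp
      · rw [update_self] at hj; omega
      · rwa [update_of_ne hqp] at hj
    have hqR := F.rank_le q
    rcases eq_or_ne (q * R + j) (p * R + j0) with e | hne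
    · obtain ⟨rfl, rfl⟩ := cell_inj (by omega) (by omega) e
      rw [update_self] at hj
      have : l ≠ x := fun e => by have := hxl.1 e.symm; omega
      rw [update_self, update_of_ne this, hlp]
    · rw [update_of_ne hne, update_of_ne, F.par_slot q j hjq]
      intro e
      apply hne
      rw [← F.pos_slot q j hjq, e, hpx]
  · intro q j hj
    have hjq : j < h.rank q := by
      rcases eq_or_ne q p with rfl | hqp
      · rw [update_self] at hj; omega
      · rwa [update_of_ne hqp] at hj
    have hqR := F.rank_le q
    rcases eq_or_ne (q * R + j) (p * R + j0) with e | hne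
    · rw [e]; simp
    · rw [update_of_ne hne, update_of_ne, F.pos_slot q j hjq]
      intro e
      have e' : q * R + j = p * R + r := by rw [← F.pos_slot q j hjq, e, hlpos]
      obtain ⟨rfl, rfl⟩ := cell_inj (by omega) (by omega) e'
      simp at hj
  · obtain ⟨ht, h1⟩ := F.acyc
    exact ⟨ht, fun v q hv => h1 v q (par' v q hv).2⟩
  · intro v q hv
    exact F.order v q (par' v q hv).2

/-- Make the root `y` the last child of the root `x`. -/
def link (h : Heap) (x y : ℕ) : Heap :=
  { h with
    par := update h.par y (x + 1)
    rank := update h.rank x (h.rank x + 1)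
    mark := update h.mark y 0
    pos := update h.pos y (h.top x)
    slot := update h.slot (h.top x) y
    top := update h.top x (h.top x + 1) }

/-- Equality of ranks is what the structural condition needs: the new child gets index `rank x`,
which equals `rank y`, so the bound holds with mark 0. -/
theorem Forest.link (F : h.Forest n R A ∅) {x y : ℕ} (hx : x ∈ A) (hy : y ∈ A) (hxy : x ≠ y)
    (hpx : h.par x = 0) (hpy : h.par y = 0) (hr : h.rank x = h.rank y) (hR : h.rank x < R)
    (hk : h.key x ≤ h.key y) : (h.link x y).Forest n R A ∅ := by
  have htop := F.top_eq x (F.mem_lt x hx)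
  have par' : ∀ v q, update h.par y (x + 1) v = q + 1 →
      (v = y ∧ q = x) ∨ (v ≠ y ∧ h.par v = q + 1) := by
    intro v q hv
    rcases eq_or_ne v y with rfl | hne
    · simp at hv; exact .inl ⟨rfl, by omega⟩
    · rw [update_of_ne hne] at hv
      exact .inr ⟨hne, hv⟩
  constructor <;> try dsimp only [Heap.link]
  · exact F.mem_lt
  · intro v hv
    rcases eq_or_ne v x with rfl | hne
    · simp [htop]; omega
    · simp [update_of_ne hne, F.top_eq v hv]
  · intro v hv
    have : v ≠ x := fun e => hv (e ▸ hx)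
    rw [update_of_ne this, F.rank_out v hv]
  · intro v hv
    have : v ≠ y := fun e => hv (e ▸ hy)
    rw [update_of_ne this, F.par_out v hv]
  · intro v
    rcases eq_or_ne v y with rfl | hne
    · simp
    · rw [update_of_ne hne]; exact F.mark_le v
  · intro v
    rcases eq_or_ne v x with rfl | hne
    · simp; omega
    · rw [update_of_ne hne]; exact F.rank_le v
  · intro v q hv
    rcases par' v q hv with ⟨rfl, rfl⟩ | ⟨_, hv⟩
    · exact hx
    · exact F.par_mem v q hv
  · intro v q hv
    rcases par' v q hv with ⟨rfl, rfl⟩ | ⟨hne, hv⟩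
    · refine ⟨h.rank q, by simp, by simp [htop], fun _ => ?_⟩
      rw [update_of_ne hxy.symm, hr]
      omega
    · obtain ⟨j, h1, h2, h3⟩ := F.pos_eq v q hv
      have hvx : v ≠ x := by rintro rfl; omega
      refine ⟨j, ?_, by rw [update_of_ne hne, h2], fun hm => ?_⟩
      · rcases eq_or_ne q x with rfl | hqx
        · simp; omega
        · rwa [update_of_ne hqx]
      · rw [update_of_ne hvx, update_of_ne hne]
        exact h3 hm
  · intro v q hv
    rcases par' v q hv with ⟨rfl, rfl⟩ | ⟨hne, hv⟩
    · simp
    · rw [update_of_ne hne, update_of_ne, F.slot_pos v q hv]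
      obtain ⟨j, h1, h2, -⟩ := F.pos_eq v q hv
      have := F.rank_le q
      intro e
      obtain ⟨rfl, rfl⟩ := cell_inj (by omega) hR (h2.symm.trans (e.trans htop))
      omega
  · intro q j hj
    rcases eq_or_ne (q * R + j) (h.top x) with e | hne
    · have hjR : j < R := by
        rcases eq_or_ne q x with rfl | hqx
        · rw [update_self] at hj; omega
        · rw [update_of_ne hqx] at hj; have := F.rank_le q; omega
      obtain ⟨rfl, rfl⟩ := cell_inj hjR hR (e.trans htop)
      simp [e]
    · have hjq : j < h.rank q := by
        rcases eq_or_ne q x with rfl | hqx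
        · rw [update_self] at hj
          have : j ≠ h.rank q := fun e => hne (by rw [htop, e])
          omega
        · rwa [update_of_ne hqx] at hj
      rw [update_of_ne hne, update_of_ne, F.par_slot q j hjq]
      intro e
      have := F.par_slot q j hjq
      rw [e, hpy] at this
      omega
  · intro q j hj
    rcases eq_or_ne (q * R + j) (h.top x) with e | hne
    · rw [e]; simp
    · have hjq : j < h.rank q := by
        rcases eq_or_ne q x with rfl | hqx
        · rw [update_self] at hj
          have : j ≠ h.rank q := fun e => hne (by rw [htop, e])
          omega
        · rwa [update_of_ne hqx] at hj
      rw [update_of_ne hne, update_of_ne, F.pos_slot q j hjq]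
      intro e
      have := F.par_slot q j hjq
      rw [e, hpy] at this
      omega
  · obtain ⟨ht, h1⟩ := F.acyc
    -- Since `x` is a root, raising its height disturbs no inequality in which it is the child.
    refine ⟨update ht x (max (ht x) (ht y + 1)), fun v q hv => ?_⟩
    rcases par' v q hv with ⟨rfl, rfl⟩ | ⟨hne, hv⟩
    · rw [update_of_ne hxy.symm, update_self]; omega
    · have hvx : v ≠ x := by rintro rfl; omega
      have := h1 v q hv
      rw [update_of_ne hvx]
      rcases eq_or_ne q x with rfl | hqx
      · rw [update_self]; omega
      · rwa [update_of_ne hqx]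
  · intro v q hv
    rcases par' v q hv with ⟨rfl, rfl⟩ | ⟨_, hv⟩
    · exact hk
    · exact F.order v q hv

/-- Every vertex lies below a root. -/
theorem Forest.exists_root (F : h.Forest n R A X) {v : ℕ} (hv : v ∈ A) :
    ∃ u ∈ A, h.par u = 0 ∧ h.key u ≤ h.key v := by
  obtain ⟨ht, h1⟩ := F.acyc
  -- A vertex of greatest height among those with key at most that of `v` is a root: its parent
  -- would be higher and have no larger key.
  obtain ⟨u, hu, hmax⟩ := (A.filter fun u => h.key u ≤ h.key v).exists_max_image ht
    ⟨v, by simp [hv]⟩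
  rw [Finset.mem_filter] at hu
  refine ⟨u, hu.1, ?_, hu.2⟩
  by_contra hne
  obtain ⟨p, hp⟩ := Nat.exists_eq_succ_of_ne_zero hne
  have := hmax p (Finset.mem_filter.2 ⟨F.par_mem u p hp, (F.order u p hp).trans hu.2⟩)
  have := h1 u p hp
  omega

open Classical in
/-- The vertices in the subtree of `v`. -/
noncomputable def desc (h : Heap) (A : Finset ℕ) (v : ℕ) : Finset ℕ :=
  A.filter fun w => Relation.ReflTransGen (fun a b => h.par a = b + 1) w v

/-- The child at index j satisfies j ≤ rank + mark ≤ rank + 1, so by induction its subtree has at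
least fib (j + 1) vertices. Subtrees of different children are disjoint because parents are unique
and heights increase. Together with the vertex itself the sum is 1 + ∑ fib (j + 1) over j below the
rank, which is fib (rank + 2). -/
theorem Forest.fib_le_card_desc (F : h.Forest n R A ∅) {v : ℕ} (hv : v ∈ A) :
    Nat.fib (h.rank v + 2) ≤ (h.desc A v).card := by
  classical
  obtain ⟨ht, h1⟩ := F.acyc
  have hmono : ∀ a b, Relation.ReflTransGen (fun a b => h.par a = b + 1) a b → ht a ≤ ht b := by
    intro a b hab
    induction hab with
    | refl => exact le_rfl
    | tail _ h2 ih => exact ih.trans (h1 _ _ h2).le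
  induction hN : ht v using Nat.strong_induction_on generalizing v with
  | _ N ih =>
    subst hN
    let c : ℕ → ℕ := fun j => h.slot (v * R + j)
    have hc : ∀ j < h.rank v, h.par (c j) = v + 1 := F.par_slot v
    have hsub : insert v ((Finset.range (h.rank v)).biUnion fun j => h.desc A (c j)) ⊆
        h.desc A v := by
      intro w hw
      rw [Finset.mem_insert, Finset.mem_biUnion] at hw
      rcases hw with rfl | ⟨j, hj, hw⟩
      · simp [desc, hv, Relation.ReflTransGen.refl]
      · simp only [desc, Finset.mem_filter] at hw ⊢
        exact ⟨hw.1, hw.2.tail (hc j (Finset.mem_range.1 hj))⟩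
    have hnot : v ∉ (Finset.range (h.rank v)).biUnion fun j => h.desc A (c j) := by
      intro hw
      obtain ⟨j, hj, hw⟩ := Finset.mem_biUnion.1 hw
      have h2 := hmono _ _ (Finset.mem_filter.1 hw).2
      have h3 := h1 _ _ (hc j (Finset.mem_range.1 hj))
      omega
    have hstep : ∀ a b, h.par a = v + 1 → h.par b = v + 1 →
        Relation.ReflTransGen (fun a b => h.par a = b + 1) a b → a = b := by
      intro a b ha hb hab
      rcases hab.cases_head with rfl | ⟨d, hd, hdb⟩
      · rfl
      · have : d = v := by simpa [ha] using hd.symm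
        subst this
        have h2 := hmono _ _ hdb
        have h3 := h1 _ _ hb
        omega
    have hdisj : ((Finset.range (h.rank v) : Finset ℕ) : Set ℕ).PairwiseDisjoint
        fun j => h.desc A (c j) := by
      intro i hi j hj hij
      have hi := Finset.mem_range.1 (Finset.mem_coe.1 hi)
      have hj := Finset.mem_range.1 (Finset.mem_coe.1 hj)
      refine Finset.disjoint_left.2 fun w hw hw' => hij ?_
      have e : c i = c j := by
        rcases Relation.ReflTransGen.total_of_right_unique
          (fun a b d hb hd => by omega) (Finset.mem_filter.1 hw).2
          (Finset.mem_filter.1 hw').2 with hab | hab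
        · exact hstep _ _ (hc i hi) (hc j hj) hab
        · exact (hstep _ _ (hc j hj) (hc i hi) hab).symm
      have h2 := F.pos_slot v i hi
      have h3 := F.pos_slot v j hj
      change h.pos (c i) = _ at h2
      change h.pos (c j) = _ at h3
      rw [e] at h2
      omega
    have hcard := Finset.card_le_card hsub
    rw [Finset.card_insert_of_notMem hnot, Finset.card_biUnion hdisj] at hcard
    have hterm : ∀ j ∈ Finset.range (h.rank v), Nat.fib (j + 1) ≤ (h.desc A (c j)).card := by
      intro j hj
      have hj := Finset.mem_range.1 hj
      refine le_trans ?_ (ih _ (h1 _ _ (hc j hj)) (F.mem_of_par (hc j hj)) rfl)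
      obtain ⟨i, h2, h3, h4⟩ := F.pos_eq _ _ (hc j hj)
      have h5 := F.pos_slot v j hj
      change h.pos (c j) = _ at h5
      have h6 := h4 (by simp)
      have h7 := F.mark_le (c j)
      exact Nat.fib_mono (by omega)
    have hsum := Finset.sum_le_sum hterm
    have hfib := Nat.fib_succ_eq_succ_sum (h.rank v + 1)
    rw [Finset.sum_range_succ'] at hfib
    simp only [Nat.fib_zero] at hfib
    change Nat.fib (h.rank v + 2) = _ at hfib
    omega

/-- Two steps of the Fibonacci sequence at least double it; this is why the capacity is twice a
binary logarithm. -/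
theorem two_pow_le_fib (L : ℕ) : 2 ^ L ≤ Nat.fib (2 * L + 2) := by
  induction L with
  | zero => simp
  | succ L ih =>
    have h1 : Nat.fib (2 * (L + 1) + 2) = Nat.fib (2 * L + 2) + Nat.fib (2 * L + 3) :=
      Nat.fib_add_two
    have h2 : Nat.fib (2 * L + 2) ≤ Nat.fib (2 * L + 3) := Nat.fib_le_fib_succ
    rw [pow_succ]
    omega

/-- The `R` cells reserved for the children of each vertex always leave room for one more: rank 2L
would force 2^L descendants, which is more than n. -/
theorem Forest.rank_lt (F : h.Forest n R A ∅) {L : ℕ} (hR : R = 2 * L) (hL : n < 2 ^ L)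
    (hL0 : 0 < L) (v : ℕ) :
    h.rank v < R := by
  classical
  by_cases hv : v ∈ A
  · have h1 := F.fib_le_card_desc hv
    have h2 : (h.desc A v).card ≤ n := by
      have : h.desc A v ⊆ Finset.range n := fun w hw =>
        Finset.mem_range.2 (F.mem_lt w (Finset.mem_filter.1 hw).1)
      simpa using Finset.card_le_card this
    by_contra hcon
    have h3 : Nat.fib (2 * L + 2) ≤ Nat.fib (h.rank v + 2) := Nat.fib_mono (by omega)
    have := two_pow_le_fib L
    omega
  · rw [F.rank_out v hv]
    omega

end Heap

/-! ### Whereabouts of the roots, and counting of marks and table entries -/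

namespace Heap

open Function

variable {h : Heap} {n R : ℕ} {A X H : Finset ℕ}

/-- Put the vertex `v` on the stack of roots. -/
def push (h : Heap) (v : ℕ) : Heap :=
  { h with stk := update h.stk h.ns v, ns := h.ns + 1 }

/-- Overwrite a cell of the table of roots. -/
def setTab (h : Heap) (r c : ℕ) : Heap :=
  { h with tab := update h.tab r c }

theorem Forest.push (F : h.Forest n R A X) (v : ℕ) : (h.push v).Forest n R A X :=
  ⟨F.1, F.2, F.3, F.4, F.5, F.6, F.7, F.8, F.9, F.10, F.11, F.12, F.13⟩

theorem Forest.setTab (F : h.Forest n R A X) (r c : ℕ) : (h.setTab r c).Forest n R A X :=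
  ⟨F.1, F.2, F.3, F.4, F.5, F.6, F.7, F.8, F.9, F.10, F.11, F.12, F.13⟩

theorem Forest.setNs (F : h.Forest n R A X) (m : ℕ) : { h with ns := m }.Forest n R A X :=
  ⟨F.1, F.2, F.3, F.4, F.5, F.6, F.7, F.8, F.9, F.10, F.11, F.12, F.13⟩

theorem Forest.insert (F : h.Forest n R A X) {v : ℕ} (hv : v < n) :
    h.Forest n R (insert v A) X where
  mem_lt w hw := by
    rcases Finset.mem_insert.1 hw with rfl | hw
    · exact hv
    · exact F.mem_lt w hw
  top_eq := F.top_eq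
  rank_out w hw := F.rank_out w fun h' => hw (Finset.mem_insert_of_mem h')
  par_out w hw := F.par_out w fun h' => hw (Finset.mem_insert_of_mem h')
  mark_le := F.mark_le
  rank_le := F.rank_le
  par_mem w p hw := Finset.mem_insert_of_mem (F.par_mem w p hw)
  pos_eq := F.pos_eq
  slot_pos := F.slot_pos
  par_slot := F.par_slot
  pos_slot := F.pos_slot
  acyc := F.acyc
  order := F.order

theorem Forest.erase (F : h.Forest n R A X) {u : ℕ} (hp : h.par u = 0) (hr : h.rank u = 0) :
    h.Forest n R (A.erase u) X where
  mem_lt w hw := F.mem_lt w (Finset.mem_of_mem_erase hw)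
  top_eq := F.top_eq
  rank_out w hw := by
    rcases eq_or_ne w u with rfl | hne
    · exact hr
    · exact F.rank_out w fun h' => hw (Finset.mem_erase.2 ⟨hne, h'⟩)
  par_out w hw := by
    rcases eq_or_ne w u with rfl | hne
    · exact hp
    · exact F.par_out w fun h' => hw (Finset.mem_erase.2 ⟨hne, h'⟩)
  mark_le := F.mark_le
  rank_le := F.rank_le
  par_mem w p hw := by
    refine Finset.mem_erase.2 ⟨?_, F.par_mem w p hw⟩
    rintro rfl
    obtain ⟨j, hj, -⟩ := F.pos_eq w p hw
    omega
  pos_eq := F.pos_eq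
  slot_pos := F.slot_pos
  par_slot := F.par_slot
  pos_slot := F.pos_slot
  acyc := F.acyc
  order := F.order

/-- The key of a root may be decreased, and that of a vertex outside the heap may be changed. -/
theorem Forest.setKey (F : h.Forest n R A X) {v : ℕ} {c : ℝ} (hp : h.par v = 0)
    (hc : v ∈ A → c ≤ h.key v) : { h with key := update h.key v c }.Forest n R A X where
  mem_lt := F.mem_lt
  top_eq := F.top_eq
  rank_out := F.rank_out
  par_out := F.par_out
  mark_le := F.mark_le
  rank_le := F.rank_le
  par_mem := F.par_mem
  pos_eq := F.pos_eq
  slot_pos := F.slot_pos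
  par_slot := F.par_slot
  pos_slot := F.pos_slot
  acyc := F.acyc
  order w p hw := by
    have hwv : w ≠ v := by
      rintro rfl
      rw [hp] at hw
      omega
    change update h.key v c p ≤ update h.key v c w
    rw [update_of_ne hwv]
    rcases eq_or_ne p v with rfl | hne
    · rw [update_self]
      exact (hc (F.par_mem w p hw)).trans (F.order w p hw)
    · rw [update_of_ne hne]
      exact F.order w p hw

/-- Every root is in exactly one place: in the set `H`, on the stack or in the table. -/
structure Located (h : Heap) (R : ℕ) (A H : Finset ℕ) : Prop where
  stk_mem : ∀ i < h.ns, h.stk i ∈ A ∧ h.par (h.stk i) = 0 ∧ h.stk i ∉ H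
  stk_inj : ∀ i < h.ns, ∀ j < h.ns, h.stk i = h.stk j → i = j
  tab_mem : ∀ r y, h.tab r = y + 1 →
    r < R ∧ y ∈ A ∧ h.par y = 0 ∧ h.rank y = r ∧ y ∉ H ∧ ∀ i < h.ns, h.stk i ≠ y
  hand_mem : ∀ x ∈ H, x ∈ A ∧ h.par x = 0
  complete : ∀ v ∈ A, h.par v = 0 →
    v ∈ H ∨ (∃ i < h.ns, h.stk i = v) ∨ ∃ r < R, h.tab r = v + 1

/-- Here `H` plays the role of the roots that a running operation holds in registers. The following
lemmas move a root between `H`, the stack and the table, so that none is lost or duplicated while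
the heap is being reorganised. -/
theorem Located.push (L : h.Located R A H) {v : ℕ} (hv : v ∈ H) :
    (h.push v).Located R A (H.erase v) where
  stk_mem i hi := by
    change i < h.ns + 1 at hi
    change update h.stk h.ns v i ∈ A ∧ h.par (update h.stk h.ns v i) = 0 ∧ update h.stk h.ns v i ∉ _
    rcases eq_or_ne i h.ns with rfl | hne
    · simp [L.hand_mem v hv]
    · rw [update_of_ne hne]
      obtain ⟨h1, h2, h3⟩ := L.stk_mem i (by omega)
      exact ⟨h1, h2, fun h4 => h3 (Finset.mem_of_mem_erase h4)⟩
  stk_inj i hi j hj e := by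
    change i < h.ns + 1 at hi
    change j < h.ns + 1 at hj
    change update h.stk h.ns v i = update h.stk h.ns v j at e
    rcases eq_or_ne i h.ns with rfl | hi' <;> rcases eq_or_ne j h.ns with rfl | hj'
    · rfl
    · rw [update_self, update_of_ne hj'] at e
      exact absurd (e ▸ hv) (L.stk_mem j (by omega)).2.2
    · rw [update_self, update_of_ne hi'] at e
      exact absurd (e ▸ hv) (L.stk_mem i (by omega)).2.2
    · rw [update_of_ne hi', update_of_ne hj'] at e
      exact L.stk_inj i (by omega) j (by omega) e
  tab_mem r y hy := by
    obtain ⟨h1, h2, h3, h4, h5, h6⟩ := L.tab_mem r y hy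
    refine ⟨h1, h2, h3, h4, fun h' => h5 (Finset.mem_of_mem_erase h'), fun i hi => ?_⟩
    change i < h.ns + 1 at hi
    change update h.stk h.ns v i ≠ y
    rcases eq_or_ne i h.ns with rfl | hne
    · rw [update_self]
      rintro rfl
      exact h5 hv
    · rw [update_of_ne hne]
      exact h6 i (by omega)
  hand_mem x hx := L.hand_mem x (Finset.mem_of_mem_erase hx)
  complete w hw hp := by
    rcases L.complete w hw hp with h1 | ⟨i, hi, h1⟩ | h1
    · rcases eq_or_ne w v with rfl | hne
      · exact .inr (.inl ⟨h.ns, Nat.lt_succ_self _, by simp [Heap.push]⟩)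
      · exact .inl (Finset.mem_erase.2 ⟨hne, h1⟩)
    · refine .inr (.inl ⟨i, Nat.lt_succ_of_lt hi, ?_⟩)
      simp [Heap.push, update_of_ne hi.ne, h1]
    · exact .inr (.inr h1)

theorem Located.pop (L : h.Located R A ∅) {m : ℕ} (hm : h.ns = m + 1) :
    { h with ns := m }.Located R A {h.stk m} where
  stk_mem i hi := by
    change i < m at hi
    obtain ⟨h1, h2, -⟩ := L.stk_mem i (by omega)
    refine ⟨h1, h2, fun h3 => ?_⟩
    have := L.stk_inj i (by omega) m (by omega) (Finset.mem_singleton.1 h3)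
    omega
  stk_inj i hi j hj e := by
    change i < m at hi
    change j < m at hj
    exact L.stk_inj i (by omega) j (by omega) e
  tab_mem r y hy := by
    obtain ⟨h1, h2, h3, h4, -, h6⟩ := L.tab_mem r y hy
    refine ⟨h1, h2, h3, h4, fun h' => h6 m (by omega) (Finset.mem_singleton.1 h').symm,
      fun i hi => ?_⟩
    change i < m at hi
    exact h6 i (by omega)
  hand_mem x hx := by
    rw [Finset.mem_singleton.1 hx]
    exact ⟨(L.stk_mem m (by omega)).1, (L.stk_mem m (by omega)).2.1⟩
  complete w hw hp := by
    rcases L.complete w hw hp with h1 | ⟨i, hi, h1⟩ | h1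
    · simp at h1
    · rcases eq_or_ne i m with rfl | hne
      · exact .inl (Finset.mem_singleton.2 h1.symm)
      · exact .inr (.inl ⟨i, by change i < m; omega, h1⟩)
    · exact .inr (.inr h1)

theorem Located.store (L : h.Located R A {x}) {r : ℕ} (hr : h.rank x = r) (hR : r < R)
    (ht : h.tab r = 0) : (h.setTab r (x + 1)).Located R A ∅ where
  stk_mem i hi := by
    obtain ⟨h1, h2, -⟩ := L.stk_mem i hi
    exact ⟨h1, h2, by simp⟩
  stk_inj := L.stk_inj
  tab_mem r' y hy := by
    change update h.tab r (x + 1) r' = y + 1 at hy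
    have hx := L.hand_mem x (by simp)
    rcases eq_or_ne r' r with rfl | hne
    · rw [update_self] at hy
      obtain rfl : x = y := by omega
      exact ⟨hR, hx.1, hx.2, hr, by simp, fun i hi e => (L.stk_mem i hi).2.2 (by
        change h.stk i = x at e; simp [e])⟩
    · rw [update_of_ne hne] at hy
      obtain ⟨h1, h2, h3, h4, -, h6⟩ := L.tab_mem r' y hy
      exact ⟨h1, h2, h3, h4, by simp, h6⟩
  hand_mem x hx := by simp at hx
  complete w hw hp := by
    rcases L.complete w hw hp with h1 | h1 | ⟨i, hi, h1⟩
    · rw [Finset.mem_singleton.1 h1]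
      exact .inr (.inr ⟨r, hR, by simp [Heap.setTab]⟩)
    · exact .inr (.inl h1)
    · refine .inr (.inr ⟨i, hi, ?_⟩)
      have : i ≠ r := by
        rintro rfl
        omega
      simp [Heap.setTab, update_of_ne this, h1]

theorem Located.take (L : h.Located R A H) {r y : ℕ} (ht : h.tab r = y + 1) :
    (h.setTab r 0).Located R A (insert y H) where
  stk_mem i hi := by
    obtain ⟨h1, h2, h3⟩ := L.stk_mem i hi
    refine ⟨h1, h2, fun h4 => ?_⟩
    rcases Finset.mem_insert.1 h4 with h4 | h4
    · exact (L.tab_mem r y ht).2.2.2.2.2 i hi h4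
    · exact h3 h4
  stk_inj := L.stk_inj
  tab_mem r' y' hy := by
    change update h.tab r 0 r' = y' + 1 at hy
    rcases eq_or_ne r' r with rfl | hne
    · simp at hy
    · rw [update_of_ne hne] at hy
      obtain ⟨h1, h2, h3, h4, h5, h6⟩ := L.tab_mem r' y' hy
      refine ⟨h1, h2, h3, h4, fun h' => ?_, h6⟩
      rcases Finset.mem_insert.1 h' with rfl | h'
      · have := (L.tab_mem r y' ht).2.2.2.1
        omega
      · exact h5 h'
  hand_mem x hx := by
    rcases Finset.mem_insert.1 hx with rfl | hx
    · exact ⟨(L.tab_mem r x ht).2.1, (L.tab_mem r x ht).2.2.1⟩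
    · exact L.hand_mem x hx
  complete w hw hp := by
    rcases L.complete w hw hp with h1 | h1 | ⟨i, hi, h1⟩
    · exact .inl (Finset.mem_insert_of_mem h1)
    · exact .inr (.inl h1)
    · rcases eq_or_ne i r with rfl | hne
      · obtain rfl : w = y := by omega
        exact .inl (Finset.mem_insert_self _ _)
      · exact .inr (.inr ⟨i, hi, by simp [Heap.setTab, update_of_ne hne, h1]⟩)

theorem Located.link {x y : ℕ} (L : h.Located R A {x, y}) (hxy : x ≠ y) :
    (h.link x y).Located R A {x} where
  stk_mem i hi := by
    obtain ⟨h1, h2, h3⟩ := L.stk_mem i hi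
    have : h.stk i ≠ y := fun e => h3 (by simp [e])
    exact ⟨h1, by simp only [Heap.link, update_of_ne this, h2], fun h4 => h3 (by
      rw [Finset.mem_insert]; exact .inl (Finset.mem_singleton.1 h4))⟩
  stk_inj := L.stk_inj
  tab_mem r z hz := by
    obtain ⟨h1, h2, h3, h4, h5, h6⟩ := L.tab_mem r z hz
    simp only [Finset.mem_insert, Finset.mem_singleton, not_or] at h5
    exact ⟨h1, h2, by simp only [Heap.link, update_of_ne h5.2, h3],
      by simp only [Heap.link, update_of_ne h5.1, h4], by simpa using h5.1, h6⟩
  hand_mem z hz := by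
    obtain rfl := Finset.mem_singleton.1 hz
    have := L.hand_mem z (by simp)
    exact ⟨this.1, by simp only [Heap.link, update_of_ne hxy, this.2]⟩
  complete w hw hp := by
    change update h.par y (x + 1) w = 0 at hp
    rcases eq_or_ne w y with rfl | hne
    · simp at hp
    · rw [update_of_ne hne] at hp
      rcases L.complete w hw hp with h1 | h1 | h1
      · refine .inl ?_
        simp only [Finset.mem_insert, Finset.mem_singleton] at h1
        exact Finset.mem_singleton.2 (h1.resolve_right hne)
      · exact .inr (.inl h1)
      · exact .inr (.inr h1)

/-- The table has to be empty: a cut lowers the rank of the parent, and the parent could be a root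
filed under its old rank. -/
theorem Located.cut (L : h.Located R A H) (F : h.Forest n R A X) (ht : ∀ r, h.tab r = 0)
    {x p : ℕ} (hx : h.par x = p + 1) : (h.cut x).Located R A H where
  stk_mem i hi := by
    change i < h.ns + 1 at hi
    change update h.stk h.ns x i ∈ A ∧ update h.par x 0 (update h.stk h.ns x i) = 0 ∧
      update h.stk h.ns x i ∉ _
    rcases eq_or_ne i h.ns with rfl | hne
    · rw [update_self, update_self]
      exact ⟨F.mem_of_par hx, rfl, fun h1 => by have := (L.hand_mem x h1).2; omega⟩
    · rw [update_of_ne hne]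
      obtain ⟨h1, h2, h3⟩ := L.stk_mem i (by omega)
      refine ⟨h1, ?_, h3⟩
      rw [update_of_ne, h2]
      intro e
      rw [e] at h2
      omega
  stk_inj i hi j hj e := by
    change i < h.ns + 1 at hi
    change j < h.ns + 1 at hj
    change update h.stk h.ns x i = update h.stk h.ns x j at e
    rcases eq_or_ne i h.ns with rfl | hi' <;> rcases eq_or_ne j h.ns with rfl | hj'
    · rfl
    · rw [update_self, update_of_ne hj'] at e
      have := (L.stk_mem j (by omega)).2.1
      rw [← e] at this
      omega
    · rw [update_self, update_of_ne hi'] at e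
      have := (L.stk_mem i (by omega)).2.1
      rw [e] at this
      omega
    · rw [update_of_ne hi', update_of_ne hj'] at e
      exact L.stk_inj i (by omega) j (by omega) e
  tab_mem r y hy := by
    change h.tab r = y + 1 at hy
    rw [ht] at hy
    omega
  hand_mem z hz := by
    have := L.hand_mem z hz
    refine ⟨this.1, ?_⟩
    change update h.par x 0 z = 0
    rw [update_of_ne, this.2]
    rintro rfl
    omega
  complete w hw hp := by
    change update h.par x 0 w = 0 at hp
    rcases eq_or_ne w x with rfl | hne
    · exact .inr (.inl ⟨h.ns, Nat.lt_succ_self _, by simp [Heap.cut]⟩)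
    · rw [update_of_ne hne] at hp
      rcases L.complete w hw hp with h1 | ⟨i, hi, h1⟩ | h1
      · exact .inl h1
      · refine .inr (.inl ⟨i, Nat.lt_succ_of_lt hi, ?_⟩)
        simp [Heap.cut, update_of_ne hi.ne, h1]
      · exact .inr (.inr h1)

theorem Located.insert (L : h.Located R A H) {v : ℕ} (hv : v ∉ A) (hp : h.par v = 0) :
    h.Located R (insert v A) (insert v H) where
  stk_mem i hi := by
    obtain ⟨h1, h2, h3⟩ := L.stk_mem i hi
    refine ⟨Finset.mem_insert_of_mem h1, h2, fun h4 => ?_⟩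
    rcases Finset.mem_insert.1 h4 with h4 | h4
    · exact hv (h4 ▸ h1)
    · exact h3 h4
  stk_inj := L.stk_inj
  tab_mem r y hy := by
    obtain ⟨h1, h2, h3, h4, h5, h6⟩ := L.tab_mem r y hy
    refine ⟨h1, Finset.mem_insert_of_mem h2, h3, h4, fun h' => ?_, h6⟩
    rcases Finset.mem_insert.1 h' with rfl | h'
    · exact hv h2
    · exact h5 h'
  hand_mem x hx := by
    rcases Finset.mem_insert.1 hx with rfl | hx
    · exact ⟨Finset.mem_insert_self _ _, hp⟩
    · exact ⟨Finset.mem_insert_of_mem (L.hand_mem x hx).1, (L.hand_mem x hx).2⟩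
  complete w hw hp := by
    rcases Finset.mem_insert.1 hw with rfl | hw
    · exact .inl (Finset.mem_insert_self _ _)
    · rcases L.complete w hw hp with h1 | h1
      · exact .inl (Finset.mem_insert_of_mem h1)
      · exact .inr h1

theorem Located.erase {u : ℕ} (L : h.Located R A {u}) :
    h.Located R (A.erase u) ∅ where
  stk_mem i hi := by
    obtain ⟨h1, h2, h3⟩ := L.stk_mem i hi
    exact ⟨Finset.mem_erase.2 ⟨fun e => h3 (by simp [e]), h1⟩, h2, by simp⟩
  stk_inj := L.stk_inj
  tab_mem r y hy := by
    obtain ⟨h1, h2, h3, h4, h5, h6⟩ := L.tab_mem r y hy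
    exact ⟨h1, Finset.mem_erase.2 ⟨by simpa using h5, h2⟩, h3, h4, by simp, h6⟩
  hand_mem x hx := by simp at hx
  complete w hw hp := by
    obtain ⟨hw1, hw2⟩ := Finset.mem_erase.1 hw
    rcases L.complete w hw2 hp with h1 | h1
    · exact absurd (Finset.mem_singleton.1 h1) hw1
    · exact .inr h1

theorem Located.setKey (L : h.Located R A H) (k : ℕ → ℝ) : { h with key := k }.Located R A H :=
  ⟨L.1, L.2, L.3, L.4, L.5⟩

/-- The number of marked vertices that are not roots. -/
def marked (h : Heap) (n : ℕ) : ℕ :=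
  ((Finset.range n).filter fun v => h.par v ≠ 0 ∧ h.mark v = 1).card

/-- The number of roots in the table. -/
def tabCard (h : Heap) (R : ℕ) : ℕ :=
  ((Finset.range R).filter fun r => h.tab r ≠ 0).card

theorem tabCard_take {r : ℕ} (hr : r < R) (ht : h.tab r ≠ 0) :
    (h.setTab r 0).tabCard R + 1 = h.tabCard R := by
  have : (Finset.range R).filter (fun r => h.tab r ≠ 0) =
      insert r ((Finset.range R).filter fun r' => (h.setTab r 0).tab r' ≠ 0) := by
    ext i
    simp only [Finset.mem_insert, Finset.mem_filter, Finset.mem_range]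
    rcases eq_or_ne i r with rfl | hne
    · simp [hr, ht]
    · simp [Heap.setTab, hne]
  rw [tabCard, tabCard, this, Finset.card_insert_of_notMem (by
    simp only [Finset.mem_filter]; simp [Heap.setTab])]

theorem tabCard_store (r c : ℕ) : (h.setTab r c).tabCard R ≤ h.tabCard R + 1 := by
  have : (Finset.range R).filter (fun r' => (h.setTab r c).tab r' ≠ 0) ⊆
      insert r ((Finset.range R).filter fun r => h.tab r ≠ 0) := by
    intro i
    simp only [Finset.mem_insert, Finset.mem_filter, Finset.mem_range]
    rcases eq_or_ne i r with rfl | hne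
    · simp
    · simp +contextual [Heap.setTab, update_of_ne hne]
  exact (Finset.card_le_card this).trans (Finset.card_insert_le _ _)

theorem marked_link {x y : ℕ} (hy : h.par y = 0) : (h.link x y).marked n = h.marked n := by
  unfold marked
  congr 1
  ext v
  simp only [Finset.mem_filter, Finset.mem_range]
  rcases eq_or_ne v y with rfl | hne
  · simp [Heap.link, hy]
  · simp [Heap.link, update_of_ne hne]

theorem marked_cut_le {x p : ℕ} (hx : h.par x = p + 1) : (h.cut x).marked n ≤ h.marked n + 1 := by
  have : (Finset.range n).filter (fun v => (h.cut x).par v ≠ 0 ∧ (h.cut x).mark v = 1) ⊆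
      insert p ((Finset.range n).filter fun v => h.par v ≠ 0 ∧ h.mark v = 1) := by
    intro v
    simp only [Finset.mem_insert, Finset.mem_filter, Finset.mem_range]
    rcases eq_or_ne v p with rfl | hne
    · simp
    · rcases eq_or_ne v x with rfl | hvx
      · simp [Heap.cut]
      · simp [Heap.cut, hx, update_of_ne hvx, hne]
  exact (Finset.card_le_card this).trans (Finset.card_insert_le _ _)

theorem marked_cut_le_of_mark {x p : ℕ} (hx : h.par x = p + 1) (hp : h.mark p = 1 ∨ h.par p = 0) :
    (h.cut x).marked n ≤ h.marked n := by
  refine Finset.card_le_card fun v => ?_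
  simp only [Finset.mem_filter, Finset.mem_range]
  rcases eq_or_ne v x with rfl | hvx
  · simp [Heap.cut]
  · rcases eq_or_ne v p with rfl | hne
    · rcases hp with hp | hp <;> simp [Heap.cut, hx, update_of_ne hvx, hp]
    · simp [Heap.cut, hx, update_of_ne hne, update_of_ne hvx]

/-- A marked child that is cut leaves the count, and its parent, already marked or a root, does not
enter it. The unit released here pays for an intermediate cut of a cascade. -/
theorem marked_cut_lt {x p : ℕ} (hx : h.par x = p + 1) (hxn : x < n) (hm : h.mark x = 1)
    (hp : h.mark p = 1 ∨ h.par p = 0) : (h.cut x).marked n + 1 ≤ h.marked n := by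
  have : insert x ((Finset.range n).filter fun v => (h.cut x).par v ≠ 0 ∧ (h.cut x).mark v = 1) ⊆
      (Finset.range n).filter fun v => h.par v ≠ 0 ∧ h.mark v = 1 := by
    intro v
    simp only [Finset.mem_insert, Finset.mem_filter, Finset.mem_range]
    rcases eq_or_ne v x with rfl | hvx
    · simp [hx, hm, hxn]
    · rcases eq_or_ne v p with rfl | hne
      · rcases hp with hp | hp <;> simp [Heap.cut, hx, hvx, hp]
      · simp [Heap.cut, hx, update_of_ne hne, hvx]
  have h2 := Finset.card_le_card this
  rw [Finset.card_insert_of_notMem (by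
    simp only [Finset.mem_filter]; simp [Heap.cut])] at h2
  exact h2

end Heap

/-! ### Heap operations as programs -/

namespace RAM

/-! Names of the integer registers. -/
namespace Reg
abbrev n := 0
abbrev m := 1
abbrev k := 2
abbrev root := 3
abbrev zero := 4
abbrev cap := 5
abbrev size := 6
abbrev x := 10
abbrev p := 11
abbrev q := 12
abbrev t := 13
abbrev c := 14
abbrev l := 15
abbrev a := 16
abbrev r := 17
abbrev y := 18
abbrev best := 19
end Reg

/-! Names of the integer arrays. -/
namespace Arr
abbrev fst := 0
abbrev snd := 1
abbrev term := 2
abbrev out := 3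
abbrev par := 4
abbrev rank := 5
abbrev mark := 6
abbrev pos := 7
abbrev slot := 8
abbrev top := 9
abbrev stk := 10
abbrev tab := 11
end Arr

/-! Names of the real registers. -/
namespace RReg
abbrev infl := 0
abbrev d1 := 1
abbrev d2 := 2
end RReg

/-! Names of the real arrays. -/
namespace RArr
abbrev len := 0
abbrev dist := 1
end RArr

open Instr Program Test Heap Function

/-- The heap that is stored in a memory. -/
def heap (s : State) : Heap where
  par := s.natArr Arr.par
  rank := s.natArr Arr.rank
  mark := s.natArr Arr.mark
  pos := s.natArr Arr.pos
  slot := s.natArr Arr.slot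
  top := s.natArr Arr.top
  stk := s.natArr Arr.stk
  tab := s.natArr Arr.tab
  ns := s.natReg Reg.size
  key := s.realArr RArr.dist

/-- Cut the vertex in register `x` from its parent in register `p`; the old mark of the parent goes
to register `q`. -/
def detach : List Instr :=
  [natLoad Reg.q Arr.mark Reg.p, natLoad Reg.t Arr.top Reg.p, natPred Reg.t,
    natStore Arr.top Reg.p Reg.t, natLoad Reg.c Arr.rank Reg.p, natPred Reg.c,
    natStore Arr.rank Reg.p Reg.c, natLoad Reg.l Arr.slot Reg.t, natLoad Reg.a Arr.pos Reg.x,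
    natStore Arr.slot Reg.a Reg.l, natStore Arr.pos Reg.l Reg.a, natStore Arr.par Reg.x Reg.zero,
    natStore Arr.stk Reg.size Reg.x, natSucc Reg.size, natConst Reg.c 1,
    natStore Arr.mark Reg.p Reg.c]

theorem heap_detach {s : State} {v w : ℕ} (hz : s.natReg Reg.zero = 0) (hx : s.natReg Reg.x = v)
    (hp : s.natReg Reg.p = w) (hw : (heap s).par v = w + 1) :
    heap (runList detach s) = (heap s).cut v := by
  -- Symbolic execution of straight-line code is definitional unfolding. The right-hand side is
  -- `cut` with register contents in place of the vertices.
  have h1 : heap (runList detach s) = { heap s with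
      par := update (heap s).par (s.natReg Reg.x) (s.natReg Reg.zero)
      rank := update (heap s).rank (s.natReg Reg.p) ((heap s).rank (s.natReg Reg.p) - 1)
      mark := update (heap s).mark (s.natReg Reg.p) 1
      pos := update (heap s).pos ((heap s).slot ((heap s).top (s.natReg Reg.p) - 1))
        ((heap s).pos (s.natReg Reg.x))
      slot := update (heap s).slot ((heap s).pos (s.natReg Reg.x))
        ((heap s).slot ((heap s).top (s.natReg Reg.p) - 1))
      top := update (heap s).top (s.natReg Reg.p) ((heap s).top (s.natReg Reg.p) - 1)
      stk := update (heap s).stk (heap s).ns (s.natReg Reg.x)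
      ns := (heap s).ns + 1 } := rfl
  rw [h1, hz, hx, hp]
  simp only [Heap.cut, hw, Nat.add_sub_cancel]

/-- Cut the vertex in register `x` from its parent, if it has one, and then, as long as the parent
was marked, cut the parent. -/
def cascade : Program :=
  seq (block [natLoad Reg.p Arr.par Reg.x]) <|
  .while (natLT Reg.zero Reg.p) <|
    seq (block [natPred Reg.p]) <|
    seq (block detach) <|
    ite (natEq Reg.q Reg.zero) (block [natMove Reg.p Reg.zero])
      (block [natMove Reg.x Reg.p, natLoad Reg.p Arr.par Reg.x])

end RAM

namespace Heap

/-- The invariant of the heap on the vertices in `A` between operations. -/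
structure Valid (h : Heap) (n R : ℕ) (A : Finset ℕ) : Prop where
  forest : h.Forest n R A ∅
  located : h.Located R A ∅
  tab_eq : ∀ r, h.tab r = 0

/-- The potential function. -/
def potential (h : Heap) (n : ℕ) : ℕ := 100 * h.ns + 200 * h.marked n

end Heap

/-! ### Cascading cuts -/

namespace RAM

open Instr Program Test Heap Function

/-- One cut takes fewer than 30 steps and adds 100 to the potential for the new root on the stack.
An intermediate cut removes a marked child, which releases 200 and covers this. Only the first cut,
which may release nothing, and the last one, which may set a new mark, need extra money. An
allowance of 330 for each makes 660, and the rest of the 700 covers the overhead. -/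
theorem runs_cascade {s : State} {n R : ℕ} {A : Finset ℕ} (hz : s.natReg Reg.zero = 0)
    (V : (heap s).Valid n R A) :
    Runs cascade s fun t s' => (heap s').Valid n R A ∧ (heap s').par (s.natReg Reg.x) = 0 ∧
      (heap s').key = (heap s).key ∧
      t + (heap s').potential n ≤ (heap s).potential n + 700 := by
  obtain ⟨x0, hx0⟩ : ∃ x0, x0 = s.natReg Reg.x := ⟨_, rfl⟩
  rw [← hx0]
  refine Runs.blockSeq 2 ?_
  generalize hs1 : runList _ s = s1
  have e1 : heap s1 = heap s := by rw [← hs1]; rfl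
  have e2 : s1.natReg Reg.x = x0 := by rw [← hs1, hx0]; rfl
  have e3 : s1.natReg Reg.p = (heap s1).par x0 := by rw [← hs1, hx0]; rfl
  have e4 : s1.natReg Reg.zero = 0 := by rw [← hs1]; exact hz
  rw [← e1] at V
  -- The set `X` contains at most the current vertex: one that has just lost a child although it was
  -- marked, and whose rank bound is waived until it is cut in turn. The three alternatives for the
  -- clock describe the time before the first cut, between two cuts, and after the last one.
  refine Runs.while (fun t s' => (∃ X : Finset ℕ, (heap s').Forest n R A X ∧
      (s'.natReg Reg.p = 0 → X = ∅) ∧ X ⊆ {s'.natReg Reg.x}) ∧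
    (heap s').Located R A ∅ ∧ (∀ r, (heap s').tab r = 0) ∧
    (s'.natReg Reg.p = 0 ∧ (heap s').par x0 = 0 ∨
      s'.natReg Reg.p = (heap s').par (s'.natReg Reg.x) ∧
        ((heap s').par x0 = 0 ∨ s'.natReg Reg.x = x0)) ∧
    (t + (heap s').potential n ≤ (heap s1).potential n ∨
      s'.natReg Reg.p ≠ 0 ∧ (heap s').mark (s'.natReg Reg.x) = 1 ∧
        t + (heap s').potential n + 330 ≤ (heap s1).potential n + 660 ∨
      s'.natReg Reg.p = 0 ∧ t + (heap s').potential n ≤ (heap s1).potential n + 660))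
    ((heap s1).potential n + 660) ?_ ?_ ?_ ?_
  · intro t s' h
    omega
  · exact ⟨⟨∅, V.forest, fun _ => rfl, by simp⟩, V.located, V.tab_eq,
      .inr ⟨by rw [e2, e3], .inr e2⟩, .inl (by omega)⟩
  · rintro t s' ⟨⟨X, F, hX0, hX⟩, L, T, P, C⟩ hk hb
    have hz' : s'.natReg Reg.zero = 0 := (hk.natReg _ (by decide)).trans e4
    change s'.natReg Reg.zero < s'.natReg Reg.p at hb
    rw [hz'] at hb
    obtain ⟨w, hw⟩ : ∃ w, s'.natReg Reg.p = w + 1 := ⟨_, (Nat.succ_pred_eq_of_pos hb).symm⟩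
    obtain ⟨v, hv⟩ : ∃ v, s'.natReg Reg.x = v := ⟨_, rfl⟩
    rw [hv, hw] at P
    rw [hv] at hX
    have P1 : (heap s').par v = w + 1 := by omega
    have P2 : (heap s').par x0 = 0 ∨ v = x0 := by omega
    refine Runs.blockSeq 2 (Runs.blockSeq 17 ?_)
    generalize hs2 : runList [natPred Reg.p] s' = s2
    generalize hs3 : runList detach s2 = s3
    have f1 : heap s2 = heap s' := by rw [← hs2]; rfl
    have f2 : s2.natReg Reg.p = w := by
      rw [← hs2]; change s'.natReg Reg.p - 1 = w; omega
    have f3 : s2.natReg Reg.x = v := by rw [← hs2, ← hv]; rfl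
    have f4 : s2.natReg Reg.zero = 0 := by rw [← hs2]; exact hz'
    have g1 : heap s3 = (heap s').cut v := by
      rw [← hs3, ← f1]
      exact heap_detach f4 f3 f2 (f1 ▸ P1)
    have g2 : s3.natReg Reg.p = w := by rw [← hs3, ← f2]; rfl
    have g3 : s3.natReg Reg.x = v := by rw [← hs3, ← f3]; rfl
    have g4 : s3.natReg Reg.zero = 0 := by rw [← hs3]; exact f4
    have g5 : s3.natReg Reg.q = (heap s').mark w := by rw [← hs3, ← f2, ← f1]; rfl
    have hL := L.cut F T P1
    have hT : ∀ r, ((heap s').cut v).tab r = 0 := T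
    have hx0' : ((heap s').cut v).par x0 = 0 := by
      change update (heap s').par v 0 x0 = 0
      rcases eq_or_ne x0 v with rfl | hne
      · simp
      · rw [update_of_ne hne]; exact P2.resolve_right hne.symm
    have hns : ((heap s').cut v).ns = (heap s').ns + 1 := rfl
    have M1 := marked_cut_le (n := n) P1
    have hvn : v < n := F.mem_lt v (F.mem_of_par P1)
    have hmw := F.mark_le w
    refine Runs.ite (fun hq => Runs.blockEnd 2 ?_) fun hq => Runs.blockEnd 3 ?_
    · change s3.natReg Reg.q = s3.natReg Reg.zero at hq
      rw [g4, g5] at hq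
      generalize hs4 : runList _ s3 = s4
      have h1 : heap s4 = (heap s').cut v := by rw [← hs4, ← g1]; rfl
      have h2 : s4.natReg Reg.p = 0 := by rw [← hs4, ← g4]; rfl
      have h3 : s4.natReg Reg.x = v := by rw [← hs4, ← g3]; rfl
      rw [h1, h2]
      refine ⟨⟨∅, F.cut P1 hX fun _ => hq, fun _ => rfl, by simp⟩, hL, hT, .inl ⟨rfl, hx0'⟩, ?_⟩
      refine .inr (.inr ⟨rfl, ?_⟩)
      rcases C with C | ⟨-, C1, C⟩ | ⟨C, -⟩
      · simp only [potential, hns] at C ⊢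
        omega
      · simp only [potential, hns] at C ⊢
        omega
      · omega
    · change ¬ s3.natReg Reg.q = s3.natReg Reg.zero at hq
      rw [g4, g5] at hq
      generalize hs4 : runList _ s3 = s4
      have h1 : heap s4 = (heap s').cut v := by rw [← hs4, ← g1]; rfl
      have h2 : s4.natReg Reg.p = (heap s4).par w := by rw [← hs4, ← g2]; rfl
      have h3 : s4.natReg Reg.x = w := by rw [← hs4, ← g2]; rfl
      have hm : ((heap s').cut v).mark w = 1 := by simp [Heap.cut, P1]
      have hFX := F.cut P1 hX (X' := {w}) (by simp)
      have M2 := marked_cut_le_of_mark (n := n) P1 (.inl (by omega))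
      rw [h2, h3, h1]
      refine ⟨?_, hL, hT, .inr ⟨rfl, .inl hx0'⟩, ?_⟩
      -- If `w` is a root, the waiver can be dropped at once, since the rank bound concerns only
      -- children.
      · by_cases h0 : ((heap s').cut v).par w = 0
        · refine ⟨∅, ?_, fun _ => rfl, by simp⟩
          refine ⟨hFX.1, hFX.2, hFX.3, hFX.4, hFX.5, hFX.6, hFX.7, fun u p hu => ?_, hFX.9, hFX.10,
            hFX.11, hFX.12, hFX.13⟩
          obtain ⟨j, a1, a2, a3⟩ := hFX.8 u p hu
          refine ⟨j, a1, a2, fun _ => a3 ?_⟩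
          rw [Finset.mem_singleton]
          rintro rfl
          omega
        · exact ⟨{w}, hFX, fun h => absurd h h0, subset_rfl⟩
      · rcases C with C | ⟨-, C1, C⟩ | ⟨C, -⟩
        · by_cases h0 : ((heap s').cut v).par w = 0
          · refine .inr (.inr ⟨h0, ?_⟩)
            simp only [potential, hns] at C ⊢
            omega
          · refine .inr (.inl ⟨h0, hm, ?_⟩)
            simp only [potential, hns] at C ⊢
            omega
        · rw [hv] at C1
          have M3 := marked_cut_lt (n := n) P1 hvn C1 (.inl (by omega))
          by_cases h0 : ((heap s').cut v).par w = 0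
          · refine .inr (.inr ⟨h0, ?_⟩)
            simp only [potential, hns] at C ⊢
            omega
          · refine .inr (.inl ⟨h0, hm, ?_⟩)
            simp only [potential, hns] at C ⊢
            omega
        · omega
  · rintro t s' ⟨⟨X, F, hX0, hX⟩, L, T, P, C⟩ hk hb
    have hz' : s'.natReg Reg.zero = 0 := (hk.natReg _ (by decide)).trans e4
    change ¬ s'.natReg Reg.zero < s'.natReg Reg.p at hb
    have hp : s'.natReg Reg.p = 0 := by omega
    rw [hX0 hp] at F
    refine ⟨⟨F, L, T⟩, ?_, ?_, ?_⟩
    · rcases P with P | ⟨P, P' | P'⟩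
      · exact P.2
      · exact P'
      · rw [← P', ← P, hp]
    · rw [← e1]
      exact hk.realArr _ (by decide)
    · rw [← e1]
      omega

end RAM

/-! ### Consolidation and deletion of a minimum -/

namespace RAM

open Instr Program Test Heap Function

/-- Make the root in register `y` a child of the root in register `x`, whose rank is in register
`r`, and load the table at the new rank. -/
def attach : List Instr :=
  [natLoad Reg.t Arr.top Reg.x, natStore Arr.slot Reg.t Reg.y, natStore Arr.pos Reg.y Reg.t,
    natSucc Reg.t, natStore Arr.top Reg.x Reg.t, natSucc Reg.r, natStore Arr.rank Reg.x Reg.r,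
    natStore Arr.mark Reg.y Reg.zero, natMove Reg.c Reg.x, natSucc Reg.c,
    natStore Arr.par Reg.y Reg.c, natLoad Reg.y Arr.tab Reg.r]

theorem heap_attach {s : State} {v w : ℕ} (hz : s.natReg Reg.zero = 0) (hx : s.natReg Reg.x = v)
    (hy : s.natReg Reg.y = w) (hr : s.natReg Reg.r = (heap s).rank v) :
    heap (runList attach s) = (heap s).link v w := by
  have h1 : heap (runList attach s) = { heap s with
      par := update (heap s).par (s.natReg Reg.y) (s.natReg Reg.x + 1)
      rank := update (heap s).rank (s.natReg Reg.x) (s.natReg Reg.r + 1)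
      mark := update (heap s).mark (s.natReg Reg.y) (s.natReg Reg.zero)
      pos := update (heap s).pos (s.natReg Reg.y) ((heap s).top (s.natReg Reg.x))
      slot := update (heap s).slot ((heap s).top (s.natReg Reg.x)) (s.natReg Reg.y)
      top := update (heap s).top (s.natReg Reg.x) ((heap s).top (s.natReg Reg.x) + 1) } := rfl
  rw [h1, hz, hx, hy, hr]
  rfl

/-- Exchange the registers `x` and `y` if the key of `x` is larger. -/
def order : Program :=
  seq (block [realLoad RReg.d1 RArr.dist Reg.x, realLoad RReg.d2 RArr.dist Reg.y]) <|
  ite (realLE RReg.d1 RReg.d2) .skip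
    (block [natMove Reg.c Reg.x, natMove Reg.x Reg.y, natMove Reg.y Reg.c])

theorem runs_order {s : State} {v w : ℕ} (hx : s.natReg Reg.x = v) (hy : s.natReg Reg.y = w) :
    Runs order s fun t s' => t ≤ 8 ∧ heap s' = heap s ∧
      (s'.natReg Reg.x = v ∧ s'.natReg Reg.y = w ∧ (heap s).key v ≤ (heap s).key w ∨
        s'.natReg Reg.x = w ∧ s'.natReg Reg.y = v ∧ (heap s).key w ≤ (heap s).key v) := by
  subst hx hy
  refine Runs.blockSeq 3 (Runs.ite (fun h => Runs.skip ⟨by omega, rfl, .inl ⟨rfl, rfl, h⟩⟩)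
    fun h => Runs.blockEnd 4 ⟨by omega, rfl, .inr ⟨rfl, rfl, ?_⟩⟩)
  exact (not_le.1 h).le

/-- Link the root in register `x` of rank `r` with the root `y - 1` of the same rank in the table,
until there is none. -/
def linkLoop : Program :=
  .while (natLT Reg.zero Reg.y) <|
    seq (block [natPred Reg.y, natStore Arr.tab Reg.r Reg.zero]) <|
    seq order (block attach)

/-- Each link takes one root out of the table, so a credit of 40 per occupied table cell pays for
the iteration. The rank bound guarantees a free child cell for the link. -/
theorem runs_linkLoop {s : State} {n R L : ℕ} {A : Finset ℕ} (hR : R = 2 * L) (hn : n < 2 ^ L)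
    (hL : 0 < L) (hz : s.natReg Reg.zero = 0)
    (F : (heap s).Forest n R A ∅) (P : (heap s).Located R A {s.natReg Reg.x})
    (hr : s.natReg Reg.r = (heap s).rank (s.natReg Reg.x))
    (hy : s.natReg Reg.y = (heap s).tab (s.natReg Reg.r)) :
    Runs linkLoop s fun t s' =>
      (heap s').Forest n R A ∅ ∧ (heap s').Located R A {s'.natReg Reg.x} ∧
      s'.natReg Reg.r = (heap s').rank (s'.natReg Reg.x) ∧ (heap s').tab (s'.natReg Reg.r) = 0 ∧
      (heap s').marked n = (heap s).marked n ∧ (heap s').ns = (heap s).ns ∧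
      (heap s').key = (heap s).key ∧
      t + 40 * (heap s').tabCard R ≤ 40 * (heap s).tabCard R + 1 := by
  refine Runs.while (fun t s' => (heap s').Forest n R A ∅ ∧
      (heap s').Located R A {s'.natReg Reg.x} ∧
      s'.natReg Reg.r = (heap s').rank (s'.natReg Reg.x) ∧
      s'.natReg Reg.y = (heap s').tab (s'.natReg Reg.r) ∧
      (heap s').marked n = (heap s).marked n ∧
      t + 40 * (heap s').tabCard R ≤ 40 * (heap s).tabCard R) (40 * (heap s).tabCard R)
    ?_ ?_ ?_ ?_
  · intro t s' h
    omega
  · exact ⟨F, P, hr, hy, rfl, by omega⟩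
  · rintro t s' ⟨F, P, hr, hy, M, C⟩ hk hb
    have hz' : s'.natReg Reg.zero = 0 := (hk.natReg _ (by decide)).trans hz
    change s'.natReg Reg.zero < s'.natReg Reg.y at hb
    rw [hz'] at hb
    obtain ⟨w, hw⟩ : ∃ w, s'.natReg Reg.y = w + 1 := ⟨_, (Nat.succ_pred_eq_of_pos hb).symm⟩
    obtain ⟨v, hv⟩ : ∃ v, s'.natReg Reg.x = v := ⟨_, rfl⟩
    obtain ⟨r, hr0⟩ : ∃ r, s'.natReg Reg.r = r := ⟨_, rfl⟩
    rw [hr0] at hr hy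
    rw [hv] at P hr
    have hy' : (heap s').tab r = w + 1 := by rw [← hy, hw]
    obtain ⟨w1, w2, w3, w4, w5, w6⟩ := P.tab_mem r w hy'
    obtain ⟨v1, v2⟩ := P.hand_mem v (by simp)
    have hvw : w ≠ v := by simpa using w5
    have hT := tabCard_take w1 (by rw [hy']; omega)
    refine Runs.blockSeq 3 (Runs.seq ?_)
    generalize hs2 : runList [natPred Reg.y, natStore Arr.tab Reg.r Reg.zero] s' = s2
    have f1 : heap s2 = (heap s').setTab r 0 := by rw [← hs2, ← hr0, ← hz']; rfl
    have f2 : s2.natReg Reg.y = w := by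
      rw [← hs2]; change s'.natReg Reg.y - 1 = w; omega
    have f3 : s2.natReg Reg.x = v := by rw [← hs2, ← hv]; rfl
    have f4 : s2.natReg Reg.zero = 0 := by rw [← hs2]; exact hz'
    have f5 : s2.natReg Reg.r = r := by rw [← hs2, ← hr0]; rfl
    refine (runs_order f3 f2).keeps.mono ?_
    rintro t' s3 ⟨⟨ht', g1, hxy⟩, hk3⟩
    have g4 : s3.natReg Reg.zero = 0 := (hk3.natReg _ (by decide)).trans f4
    have g5 : s3.natReg Reg.r = r := (hk3.natReg _ (by decide)).trans f5
    have F2 : (heap s3).Forest n R A ∅ := by rw [g1, f1]; exact F.setTab _ _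
    have P2 : (heap s3).Located R A {w, v} := by rw [g1, f1]; exact P.take hy'
    have hrank : ∀ u, (heap s3).rank u = (heap s').rank u := by rw [g1, f1]; exact fun _ => rfl
    have hpar : ∀ u, (heap s3).par u = (heap s').par u := by rw [g1, f1]; exact fun _ => rfl
    have hkey : (heap s3).key = (heap s2).key := by rw [g1]
    have hmark : (heap s3).marked n = (heap s').marked n := by rw [g1, f1]; rfl
    have htab : (heap s3).tabCard R + 1 = (heap s').tabCard R := by rw [g1, f1]; exact hT
    -- From here on `a` is the root with the smaller key and `b` the other one, which merges the two
    -- outcomes of `order`.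
    obtain ⟨a, b, ha, hb', hab, hP, har, ha1, hb1, ha2, hb2, hk', hr'⟩ : ∃ a b, s3.natReg Reg.x = a ∧
        s3.natReg Reg.y = b ∧ a ≠ b ∧ (heap s3).Located R A {a, b} ∧ (heap s3).rank a = r ∧
        a ∈ A ∧ b ∈ A ∧ (heap s3).par a = 0 ∧ (heap s3).par b = 0 ∧
        (heap s3).key a ≤ (heap s3).key b ∧ (heap s3).rank a = (heap s3).rank b := by
      rcases hxy with ⟨h1, h2, h3⟩ | ⟨h1, h2, h3⟩
      · exact ⟨v, w, h1, h2, hvw.symm, by rwa [Finset.pair_comm] at P2, by rw [hrank, ← hr],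
          v1, w2, by rw [hpar, v2], by rw [hpar, w3], by rwa [hkey], by rw [hrank, hrank, w4, hr]⟩
      · exact ⟨w, v, h1, h2, hvw, P2, by rw [hrank, w4],
          w2, v1, by rw [hpar, w3], by rw [hpar, v2], by rwa [hkey], by rw [hrank, hrank, w4, hr]⟩
    refine Runs.blockEnd 13 ?_
    generalize hs4 : runList attach s3 = s4
    have e1 : heap s4 = (heap s3).link a b := by
      rw [← hs4]
      exact heap_attach g4 ha hb' (by rw [g5, har])
    have e2 : s4.natReg Reg.x = a := by rw [← hs4, ← ha]; rfl
    have e3 : s4.natReg Reg.r = r + 1 := by rw [← hs4, ← g5]; rfl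
    have e4 : s4.natReg Reg.y = (heap s4).tab (s4.natReg Reg.r) := by rw [← hs4]; rfl
    refine ⟨?_, ?_, ?_, e4, ?_, ?_⟩
    · rw [e1]
      exact F2.link ha1 hb1 hab ha2 hb2 hr' (F2.rank_lt hR hn hL a) hk'
    · rw [e1, e2]
      exact hP.link hab
    · rw [e1, e2, e3]
      simp [Heap.link, har]
    · rw [e1, marked_link hb2, hmark, M]
    · rw [e1]
      change _ + 40 * (heap s3).tabCard R ≤ _
      omega
  · rintro t s' ⟨F, P, hr, hy, M, C⟩ hk hb
    have hz' : s'.natReg Reg.zero = 0 := (hk.natReg _ (by decide)).trans hz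
    change ¬ s'.natReg Reg.zero < s'.natReg Reg.y at hb
    refine ⟨F, P, hr, by omega, M, ?_, ?_, by omega⟩
    · exact hk.natReg Reg.size (by decide)
    · exact hk.realArr RArr.dist (by decide)

/-- Move all roots from the stack to the table. -/
def consolidate : Program :=
  .while (natLT Reg.zero Reg.size) <|
    seq (block [natPred Reg.size, natLoad Reg.x Arr.stk Reg.size, natLoad Reg.r Arr.rank Reg.x,
      natLoad Reg.y Arr.tab Reg.r]) <|
    seq linkLoop <|
    block [natMove Reg.c Reg.x, natSucc Reg.c, natStore Arr.tab Reg.r Reg.c]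

/-- The 100 units of a stacked root pay for popping and storing it and leave the credit of 40 on the
table cell that is finally filled. -/
theorem runs_consolidate {s : State} {n R L : ℕ} {A : Finset ℕ} (hR : R = 2 * L) (hn : n < 2 ^ L)
    (hL : 0 < L) (hz : s.natReg Reg.zero = 0) (V : (heap s).Valid n R A) :
    Runs consolidate s fun t s' =>
      (heap s').Forest n R A ∅ ∧ (heap s').Located R A ∅ ∧ (heap s').ns = 0 ∧
      (heap s').marked n = (heap s).marked n ∧ (heap s').key = (heap s).key ∧
      t ≤ 100 * (heap s).ns + 1 := by
  refine Runs.while (fun t s' => (heap s').Forest n R A ∅ ∧ (heap s').Located R A ∅ ∧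
      (heap s').marked n = (heap s).marked n ∧
      t + 40 * (heap s').tabCard R + 100 * (heap s').ns ≤ 100 * (heap s).ns) (100 * (heap s).ns)
    ?_ ?_ ?_ ?_
  · intro t s' h
    omega
  · refine ⟨V.forest, V.located, rfl, ?_⟩
    have : (heap s).tabCard R = 0 := by
      rw [tabCard, Finset.card_eq_zero, Finset.filter_eq_empty_iff]
      exact fun r _ h => h (V.tab_eq r)
    omega
  · rintro t s' ⟨F, P, M, C⟩ hk hb
    have hz' : s'.natReg Reg.zero = 0 := (hk.natReg _ (by decide)).trans hz
    change s'.natReg Reg.zero < (heap s').ns at hb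
    rw [hz'] at hb
    obtain ⟨m, hm⟩ : ∃ m, (heap s').ns = m + 1 := ⟨_, (Nat.succ_pred_eq_of_pos hb).symm⟩
    refine Runs.blockSeq 5 (Runs.seq ?_)
    generalize hs2 : runList _ s' = s2
    have f1 : heap s2 = { heap s' with ns := m } := by
      rw [show m = (heap s').ns - 1 by omega, ← hs2]; rfl
    have f2 : s2.natReg Reg.x = (heap s').stk m := by
      rw [show m = (heap s').ns - 1 by omega, ← hs2]; rfl
    have f3 : s2.natReg Reg.r = (heap s2).rank (s2.natReg Reg.x) := by rw [← hs2]; rfl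
    have f4 : s2.natReg Reg.y = (heap s2).tab (s2.natReg Reg.r) := by rw [← hs2]; rfl
    have f5 : s2.natReg Reg.zero = 0 := by rw [← hs2]; exact hz'
    refine (runs_linkLoop (n := n) hR hn hL f5 (A := A) ?_ ?_ f3 f4).keeps.mono ?_
    · rw [f1]; exact F.setNs m
    · rw [f1, f2]; exact P.pop hm
    rintro t' s3 ⟨⟨F3, P3, hr3, hy3, M3, N3, K3, C3⟩, hk3⟩
    refine Runs.blockEnd 4 ?_
    generalize hs4 : runList _ s3 = s4
    have e1 : heap s4 = (heap s3).setTab (s3.natReg Reg.r) (s3.natReg Reg.x + 1) := by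
      rw [← hs4]; rfl
    rw [e1]
    refine ⟨F3.setTab _ _, P3.store hr3.symm ?_ hy3, ?_, ?_⟩
    · rw [hr3]; exact F3.rank_lt hR hn hL _
    · change (heap s3).marked n = _
      rw [M3, f1]
      exact M
    · have h1 := tabCard_store (h := heap s3) (R := R) (s3.natReg Reg.r) (s3.natReg Reg.x + 1)
      have h2 : (heap s2).ns = m := by rw [f1]
      have h3 : (heap s2).tabCard R = (heap s').tabCard R := by rw [f1]; rfl
      have h4 : ((heap s3).setTab (s3.natReg Reg.r) (s3.natReg Reg.x + 1)).ns = (heap s3).ns := rfl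
      omega
  · rintro t s' ⟨F, P, M, C⟩ hk hb
    have hz' : s'.natReg Reg.zero = 0 := (hk.natReg _ (by decide)).trans hz
    change ¬ s'.natReg Reg.zero < (heap s').ns at hb
    exact ⟨F, P, by omega, M, hk.realArr RArr.dist (by decide), by omega⟩

/-- Move all roots from the table to the stack, except for one with the smallest key; register
`best` becomes this root increased by `1`, or `0` if there are no roots. -/
def scan : Program :=
  seq (block [natConst Reg.best 0, natConst Reg.r 0]) <|
  .while (natLT Reg.r Reg.cap) <|
    seq (block [natLoad Reg.y Arr.tab Reg.r, natStore Arr.tab Reg.r Reg.zero, natSucc Reg.r]) <|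
    ite (natLT Reg.zero Reg.y)
      (ite (natLT Reg.zero Reg.best)
        (seq (block [natPred Reg.best, natPred Reg.y, natMove Reg.x Reg.best]) <|
          seq order <|
          block [natStore Arr.stk Reg.size Reg.y, natSucc Reg.size, natMove Reg.best Reg.x,
            natSucc Reg.best])
        (block [natMove Reg.best Reg.y]))
      .skip

/-- The set whose only element is `b - 1`, or the empty set if `b = 0`. -/
def handSet (b : ℕ) : Finset ℕ := if b = 0 then ∅ else {b - 1}

/-- The current minimum is kept in hand and only the loser of each comparison is stacked. Hence the
key in hand is always at most every stacked key, and this survives a change of candidate because the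
new key is not larger. -/
theorem runs_scan {s : State} {n R : ℕ} {A : Finset ℕ} (hcap : s.natReg Reg.cap = R)
    (hz : s.natReg Reg.zero = 0) (F : (heap s).Forest n R A ∅) (P : (heap s).Located R A ∅)
    (hns : (heap s).ns = 0) :
    Runs scan s fun t s' =>
      (heap s').Forest n R A ∅ ∧ (heap s').Located R A (handSet (s'.natReg Reg.best)) ∧
      (∀ r, (heap s').tab r = 0) ∧ (s'.natReg Reg.best = 0 → (heap s').ns = 0) ∧
      (∀ u, s'.natReg Reg.best = u + 1 → ∀ i < (heap s').ns,
        (heap s').key u ≤ (heap s').key ((heap s').stk i)) ∧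
      (heap s').marked n = (heap s).marked n ∧ (heap s').key = (heap s).key ∧
      (heap s').ns ≤ R ∧ t ≤ 40 * R + 10 := by
  refine Runs.blockSeq 3 ?_
  generalize hs1 : runList _ s = s1
  have e1 : heap s1 = heap s := by rw [← hs1]; rfl
  have e2 : s1.natReg Reg.best = 0 := by rw [← hs1]; rfl
  have e3 : s1.natReg Reg.r = 0 := by rw [← hs1]; rfl
  have e4 : s1.natReg Reg.zero = 0 := by rw [← hs1]; exact hz
  have e5 : s1.natReg Reg.cap = R := by rw [← hs1]; exact hcap
  refine Runs.while (fun t s' => (heap s').Forest n R A ∅ ∧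
      (heap s').Located R A (handSet (s'.natReg Reg.best)) ∧
      (∀ r < s'.natReg Reg.r, (heap s').tab r = 0) ∧
      (s'.natReg Reg.best = 0 → (heap s').ns = 0) ∧
      (∀ u, s'.natReg Reg.best = u + 1 → ∀ i < (heap s').ns,
        (heap s').key u ≤ (heap s').key ((heap s').stk i)) ∧
      (heap s').marked n = (heap s).marked n ∧ (heap s').ns ≤ s'.natReg Reg.r ∧
      s'.natReg Reg.r ≤ R ∧ t ≤ 40 * s'.natReg Reg.r) (40 * R) ?_ ?_ ?_ ?_
  · intro t s' h
    omega
  · rw [e1, e2, e3, hns]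
    exact ⟨F, P, fun r hr => absurd hr (by omega), fun _ => rfl, fun u hu => absurd hu (by omega),
      rfl, le_rfl, by omega, by omega⟩
  · rintro t s' ⟨F, P, T, B0, B, M, N, hrR, C⟩ hk hb
    have hz' : s'.natReg Reg.zero = 0 := (hk.natReg _ (by decide)).trans e4
    have hc' : s'.natReg Reg.cap = R := (hk.natReg _ (by decide)).trans e5
    change s'.natReg Reg.r < s'.natReg Reg.cap at hb
    rw [hc'] at hb
    obtain ⟨r, hr⟩ : ∃ r, s'.natReg Reg.r = r := ⟨_, rfl⟩
    obtain ⟨b, hbest⟩ : ∃ b, s'.natReg Reg.best = b := ⟨_, rfl⟩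
    rw [hr] at T N hrR C hb
    rw [hbest] at P B0 B
    refine Runs.blockSeq 4 ?_
    generalize hs2 : runList _ s' = s2
    have f1 : heap s2 = (heap s').setTab r 0 := by rw [← hs2, ← hr, ← hz']; rfl
    have f2 : s2.natReg Reg.y = (heap s').tab r := by rw [← hs2, ← hr]; rfl
    have f3 : s2.natReg Reg.r = r + 1 := by rw [← hs2, ← hr]; rfl
    have f4 : s2.natReg Reg.best = b := by rw [← hs2, ← hbest]; rfl
    have f5 : s2.natReg Reg.zero = 0 := by rw [← hs2]; exact hz'
    have T2 : ∀ i < r + 1, ((heap s').setTab r 0).tab i = 0 := by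
      intro i hi
      change update (heap s').tab r 0 i = 0
      rcases eq_or_ne i r with rfl | hne
      · simp
      · rw [update_of_ne hne]; exact T i (by omega)
    have F2 : ((heap s').setTab r 0).Forest n R A ∅ := F.setTab r 0
    refine Runs.ite (fun hy => Runs.ite (fun hbp => ?_) fun hb0 => ?_) fun hy => ?_
    · change s2.natReg Reg.zero < s2.natReg Reg.y at hy
      change s2.natReg Reg.zero < s2.natReg Reg.best at hbp
      rw [f5, f2] at hy
      rw [f5, f4] at hbp
      obtain ⟨w, hw⟩ : ∃ w, (heap s').tab r = w + 1 := ⟨_, (Nat.succ_pred_eq_of_pos hy).symm⟩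
      obtain ⟨v, rfl⟩ : ∃ v, b = v + 1 := ⟨_, (Nat.succ_pred_eq_of_pos hbp).symm⟩
      have hw5 := (P.tab_mem r w hw).2.2.2.2.1
      have P2 := P.take hw
      simp only [handSet, Nat.add_eq_zero_iff, one_ne_zero, and_false, if_false,
        Nat.add_sub_cancel] at P2 hw5
      rw [Finset.mem_singleton] at hw5
      refine Runs.blockSeq 4 (Runs.seq ?_)
      generalize hs3 : runList _ s2 = s3
      have g1 : heap s3 = heap s2 := by rw [← hs3]; rfl
      have g2 : s3.natReg Reg.x = v := by
        rw [← hs3]; change s2.natReg Reg.best - 1 = v; omega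
      have g3 : s3.natReg Reg.y = w := by
        rw [← hs3]; change s2.natReg Reg.y - 1 = w; omega
      have g4 : s3.natReg Reg.r = r + 1 := by rw [← hs3, ← f3]; rfl
      refine (runs_order g2 g3).keeps.mono ?_
      rintro t' s4 ⟨⟨ht', i1, hxy⟩, hk4⟩
      have i2 : s4.natReg Reg.r = r + 1 := (hk4.natReg _ (by decide)).trans g4
      rw [g1, f1] at i1 hxy
      refine Runs.blockEnd 5 ?_
      generalize hs5 : runList _ s4 = s5
      obtain ⟨a, c, ha, hc, hac, hP, hkey, hBa⟩ : ∃ a c, s4.natReg Reg.x = a ∧ s4.natReg Reg.y = c ∧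
          a ≠ c ∧ ((heap s').setTab r 0).Located R A {a, c} ∧
          (heap s').key a ≤ (heap s').key c ∧ (heap s').key a ≤ (heap s').key v := by
        rcases hxy with ⟨h1, h2, h3⟩ | ⟨h1, h2, h3⟩
        · exact ⟨v, w, h1, h2, fun e => hw5 e.symm, by rwa [Finset.pair_comm] at P2, h3, le_rfl⟩
        · exact ⟨w, v, h1, h2, hw5, P2, h3, h3⟩
      have j1 : heap s5 = ((heap s').setTab r 0).push c := by rw [← i1, ← hs5, ← hc]; rfl
      have j2 : s5.natReg Reg.best = a + 1 := by rw [← hs5, ← ha]; rfl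
      have j3 : s5.natReg Reg.r = r + 1 := by rw [← hs5, ← i2]; rfl
      rw [j1, j2, j3]
      have hP' := hP.push (v := c) (by simp)
      rw [Finset.pair_comm, Finset.erase_insert (by simpa using hac.symm)] at hP'
      refine ⟨F2.push c, ?_, T2, fun h => absurd h (by omega), ?_, M, ?_, by omega, by omega⟩
      · simpa [handSet] using hP'
      · rintro u hu i hi
        obtain rfl : a = u := by omega
        change i < (heap s').ns + 1 at hi
        change (heap s').key a ≤ (heap s').key (update (heap s').stk (heap s').ns c i)
        rcases eq_or_ne i (heap s').ns with rfl | hne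
        · rwa [update_self]
        · rw [update_of_ne hne]
          exact hBa.trans (B v rfl i (by omega))
      · change (heap s').ns + 1 ≤ _
        omega
    · change s2.natReg Reg.zero < s2.natReg Reg.y at hy
      change ¬ s2.natReg Reg.zero < s2.natReg Reg.best at hb0
      rw [f5, f2] at hy
      rw [f5, f4] at hb0
      obtain ⟨w, hw⟩ : ∃ w, (heap s').tab r = w + 1 := ⟨_, (Nat.succ_pred_eq_of_pos hy).symm⟩
      obtain rfl : b = 0 := by omega
      have P2 := P.take hw
      refine Runs.blockEnd 2 ?_
      generalize hs3 : runList _ s2 = s3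
      have g1 : heap s3 = (heap s').setTab r 0 := by rw [← hs3, ← f1]; rfl
      have g2 : s3.natReg Reg.best = w + 1 := by rw [← hw, ← f2, ← hs3]; rfl
      have g3 : s3.natReg Reg.r = r + 1 := by rw [← hs3, ← f3]; rfl
      have g4 : ((heap s').setTab r 0).ns = 0 := B0 rfl
      rw [g1, g2, g3, g4]
      refine ⟨F2, by simpa [handSet] using P2, T2, fun h => rfl, fun u hu i hi => absurd hi (by omega),
        M, by omega, by omega, by omega⟩
    · change ¬ s2.natReg Reg.zero < s2.natReg Reg.y at hy
      rw [f5, f2] at hy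
      refine Runs.skip ?_
      have e : (heap s').setTab r 0 = heap s' := by
        have : update (heap s').tab r 0 = (heap s').tab := by
          rw [update_eq_self_iff]
          omega
        simp only [Heap.setTab, this]
      rw [e] at f1 T2
      rw [f1, f3, f4]
      exact ⟨F, P, T2, B0, B, M, by omega, by omega, by omega⟩
  · rintro t s' ⟨F, P, T, B0, B, M, N, hrR, C⟩ hk hb
    have hc' : s'.natReg Reg.cap = R := (hk.natReg _ (by decide)).trans e5
    change ¬ s'.natReg Reg.r < s'.natReg Reg.cap at hb
    refine ⟨F, P, fun r => ?_, B0, B, M, ?_, by omega, by omega⟩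
    -- An occupied cell has index below `R`, so emptying the first `R` cells empties the table.
    · by_contra h0
      obtain ⟨y, hy⟩ := Nat.exists_eq_succ_of_ne_zero h0
      exact h0 (T r (by have := (P.tab_mem r y hy).1; omega))
    · rw [← e1]
      exact hk.realArr RArr.dist (by decide)

/-- Make all children of the root in register `p` roots. -/
def freeChildren : Program :=
  seq (block [natLoad Reg.r Arr.rank Reg.p]) <|
  .while (natLT Reg.zero Reg.r) <|
    seq (block [natLoad Reg.t Arr.top Reg.p, natPred Reg.t, natLoad Reg.x Arr.slot Reg.t]) <|
    seq (block detach) <|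
    block [natLoad Reg.r Arr.rank Reg.p]

/-- The parent `u` is a root, so the mark that a cut gives to it is not counted and the number of
marked children cannot grow. At most `R` new roots appear on the stack. Once `u` has no children it
can be dropped from the vertex set. -/
theorem runs_freeChildren {s : State} {n R u : ℕ} {A : Finset ℕ} (hz : s.natReg Reg.zero = 0)
    (hu : s.natReg Reg.p = u) (F : (heap s).Forest n R A ∅) (P : (heap s).Located R A {u})
    (T : ∀ r, (heap s).tab r = 0) :
    Runs freeChildren s fun t s' => (heap s').Valid n R (A.erase u) ∧ s'.natReg Reg.p = u ∧
      (heap s').key = (heap s).key ∧ (heap s').marked n ≤ (heap s).marked n ∧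
      (heap s').ns ≤ (heap s).ns + R ∧ t ≤ 40 * R + 10 := by
  refine Runs.blockSeq 2 ?_
  generalize hs1 : runList _ s = s1
  have e1 : heap s1 = heap s := by rw [← hs1]; rfl
  have e2 : s1.natReg Reg.p = u := by rw [← hs1]; exact hu
  have e3 : s1.natReg Reg.r = (heap s1).rank u := by rw [← hs1, ← hu]; rfl
  have e4 : s1.natReg Reg.zero = 0 := by rw [← hs1]; exact hz
  refine Runs.while (fun t s' => (heap s').Forest n R A ∅ ∧ (heap s').Located R A {u} ∧
      (∀ r, (heap s').tab r = 0) ∧ s'.natReg Reg.r = (heap s').rank u ∧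
      (heap s').marked n ≤ (heap s).marked n ∧
      (heap s').ns + (heap s').rank u ≤ (heap s).ns + R ∧
      t + 40 * (heap s').rank u ≤ 40 * R) (40 * R) ?_ ?_ ?_ ?_
  · intro t s' h
    omega
  · rw [e3, e1]
    have := F.rank_le u
    exact ⟨F, P, T, rfl, le_rfl, by omega, by omega⟩
  · rintro t s' ⟨F, P, T, hr, M, N, C⟩ hk hb
    have hz' : s'.natReg Reg.zero = 0 := (hk.natReg _ (by decide)).trans e4
    have hu' : s'.natReg Reg.p = u := (hk.natReg _ (by decide)).trans e2
    change s'.natReg Reg.zero < s'.natReg Reg.r at hb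
    rw [hz', hr] at hb
    obtain ⟨huA, hu0⟩ := P.hand_mem u (by simp)
    refine Runs.blockSeq 4 (Runs.blockSeq 17 (Runs.blockEnd 2 ?_))
    generalize hs2 : runList _ s' = s2
    obtain ⟨v, hv⟩ : ∃ v, v = (heap s').slot ((heap s').top u - 1) := ⟨_, rfl⟩
    have hvp : (heap s').par v = u + 1 := by
      rw [hv, F.top_eq u (F.mem_lt u huA), Nat.add_sub_assoc (by omega)]
      exact F.par_slot u _ (by omega)
    have f1 : heap s2 = heap s' := by rw [← hs2]; rfl
    have f2 : s2.natReg Reg.x = v := by rw [hv, ← hu', ← hs2]; rfl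
    have f3 : s2.natReg Reg.p = u := by rw [← hs2]; exact hu'
    have f4 : s2.natReg Reg.zero = 0 := by rw [← hs2]; exact hz'
    generalize hs3 : runList detach s2 = s3
    have g1 : heap s3 = (heap s').cut v := by
      rw [← hs3, ← f1]
      exact heap_detach f4 f2 f3 (f1 ▸ hvp)
    have g2 : s3.natReg Reg.p = u := by rw [← hs3, ← f3]; rfl
    generalize hs4 : runList _ s3 = s4
    have i1 : heap s4 = (heap s').cut v := by rw [← hs4, ← g1]; rfl
    have i2 : s4.natReg Reg.r = (heap s4).rank u := by rw [← hs4, ← g2]; rfl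
    have hvu := F.ne_of_par hvp
    have hrk : ((heap s').cut v).rank u = (heap s').rank u - 1 := by simp [Heap.cut, hvp]
    have hns : ((heap s').cut v).ns = (heap s').ns + 1 := rfl
    have hM := marked_cut_le_of_mark (n := n) hvp (.inr hu0)
    rw [i2, i1, hrk, hns]
    have hX : ((heap s').cut v).Forest n R A {u} := F.cut hvp (by simp) (by simp)
    refine ⟨?_, P.cut F T hvp, T, rfl, by omega, by omega, by omega⟩
    -- The waiver for `u` is not needed, because `u` is not a child of anything.
    refine ⟨hX.1, hX.2, hX.3, hX.4, hX.5, hX.6, hX.7, fun w p hw => ?_, hX.9, hX.10,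
      hX.11, hX.12, hX.13⟩
    obtain ⟨j, a1, a2, a3⟩ := hX.8 w p hw
    refine ⟨j, a1, a2, fun _ => a3 ?_⟩
    rw [Finset.mem_singleton]
    rintro rfl
    have := ((P.cut F T hvp).hand_mem w (by simp)).2
    omega
  · rintro t s' ⟨F, P, T, hr, M, N, C⟩ hk hb
    have hz' : s'.natReg Reg.zero = 0 := (hk.natReg _ (by decide)).trans e4
    have hu' : s'.natReg Reg.p = u := (hk.natReg _ (by decide)).trans e2
    change ¬ s'.natReg Reg.zero < s'.natReg Reg.r at hb
    refine ⟨⟨F.erase (P.hand_mem u (by simp)).2 (by omega), P.erase, T⟩, hu', ?_, M, by omega,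
      by omega⟩
    rw [← e1]
    exact hk.realArr RArr.dist (by decide)

/-- Remove a vertex with the smallest key from the heap; it is left in register `p`, and register
`best` is `0` if there is none. -/
def deleteMin : Program :=
  seq consolidate <| seq scan <|
  ite (natLT Reg.zero Reg.best)
    (seq (block [natMove Reg.p Reg.best, natPred Reg.p]) freeChildren)
    .skip

/-- Consolidation is paid for by the potential of the stack. Afterwards at most R roots come from
the table and at most R from the freed children, so the new stack contributes at most 200·R, and the
remaining loops are linear in R. A smallest root is a smallest vertex by heap order. -/
theorem runs_deleteMin {s : State} {n R L : ℕ} {A : Finset ℕ} (hR : R = 2 * L) (hn : n < 2 ^ L)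
    (hL : 0 < L) (hz : s.natReg Reg.zero = 0) (hcap : s.natReg Reg.cap = R)
    (V : (heap s).Valid n R A) :
    Runs deleteMin s fun t s' => (heap s').key = (heap s).key ∧
      t + (heap s').potential n ≤ (heap s).potential n + 300 * (R + 1) ∧
      (s'.natReg Reg.best = 0 ∧ A = ∅ ∧ (heap s').Valid n R ∅ ∨
        0 < s'.natReg Reg.best ∧ ∃ u ∈ A, s'.natReg Reg.p = u ∧
          (∀ v ∈ A, (heap s).key u ≤ (heap s).key v) ∧ (heap s').Valid n R (A.erase u)) := by
  refine Runs.seq ((runs_consolidate hR hn hL hz V).keeps.mono ?_)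
  rintro t1 s1 ⟨⟨F1, P1, N1, M1, K1, C1⟩, hk1⟩
  have hz1 : s1.natReg Reg.zero = 0 := (hk1.natReg _ (by decide)).trans hz
  have hc1 : s1.natReg Reg.cap = R := (hk1.natReg _ (by decide)).trans hcap
  refine Runs.seq ((runs_scan hc1 hz1 F1 P1 N1).keeps.mono ?_)
  rintro t2 s2 ⟨⟨F2, P2, T2, B0, B, M2, K2, N2, C2⟩, hk2⟩
  have hz2 : s2.natReg Reg.zero = 0 := (hk2.natReg _ (by decide)).trans hz1
  refine Runs.ite (fun hb => ?_) fun hb => ?_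
  · change s2.natReg Reg.zero < s2.natReg Reg.best at hb
    rw [hz2] at hb
    obtain ⟨u, hu⟩ : ∃ u, s2.natReg Reg.best = u + 1 := ⟨_, (Nat.succ_pred_eq_of_pos hb).symm⟩
    rw [hu] at P2
    simp only [handSet, Nat.add_eq_zero_iff, one_ne_zero, and_false, if_false,
      Nat.add_sub_cancel] at P2
    refine Runs.blockSeq 3 ?_
    generalize hs3 : runList _ s2 = s3
    have e1 : heap s3 = heap s2 := by rw [← hs3]; rfl
    have e2 : s3.natReg Reg.p = u := by
      rw [← hs3]; change s2.natReg Reg.best - 1 = u; omega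
    have e3 : s3.natReg Reg.zero = 0 := by rw [← hs3]; exact hz2
    have e4 : s3.natReg Reg.best = u + 1 := by rw [← hs3, ← hu]; rfl
    rw [← e1] at F2 P2 T2
    refine (runs_freeChildren e3 e2 F2 P2 T2).keeps.mono ?_
    rintro t4 s4 ⟨⟨V4, hp4, K4, M4, N4, C4⟩, hk4⟩
    have e5 : s4.natReg Reg.best = u + 1 := (hk4.natReg _ (by decide)).trans e4
    rw [e1] at K4 M4 N4
    refine ⟨by rw [K4, K2, K1], ?_, .inr ⟨by omega, u, (P2.hand_mem u (by simp)).1, hp4, ?_, V4⟩⟩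
    · simp only [potential]
      omega
    · intro v hv
      rw [← K1, ← K2]
      obtain ⟨w, hw, hw0, hwv⟩ := F2.exists_root hv
      rw [e1] at hwv
      refine le_trans ?_ hwv
      rcases P2.complete w hw hw0 with h | ⟨i, hi, h⟩ | ⟨r, hr, h⟩
      · rw [Finset.mem_singleton.1 h]
      · rw [e1] at hi h
        rw [← h]
        exact B u hu i hi
      · rw [T2] at h
        omega
  · change ¬ s2.natReg Reg.zero < s2.natReg Reg.best at hb
    rw [hz2] at hb
    have hb0 : s2.natReg Reg.best = 0 := by omega
    rw [hb0] at P2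
    have hA : A = ∅ := by
      rw [Finset.eq_empty_iff_forall_notMem]
      intro v hv
      obtain ⟨w, hw, hw0, -⟩ := F2.exists_root hv
      rcases P2.complete w hw hw0 with h | ⟨i, hi, h⟩ | ⟨r, hr, h⟩
      · simp [handSet] at h
      · rw [B0 hb0] at hi
        omega
      · rw [T2] at h
        omega
    refine Runs.skip ⟨by rw [K2, K1], ?_, .inl ⟨hb0, hA, ?_⟩⟩
    · simp only [potential]
      have := B0 hb0
      omega
    · rw [← hA]
      exact ⟨F2, P2, T2⟩

end RAM

/-! ### Dijkstra's algorithm -/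

/-- A list of directed arcs `h < M` on the vertices `v < n`; the arc `h` comes from the edge
`edg h`. -/
structure Net where
  n : ℕ
  M : ℕ
  src : ℕ → ℕ
  tgt : ℕ → ℕ
  edg : ℕ → ℕ
  len : ℕ → ℝ
  src_lt : ∀ h < M, src h < n
  tgt_lt : ∀ h < M, tgt h < n
  len_pos : ∀ h < M, 0 < len (edg h)

namespace Net

open Function

/-- The last arc before `j` that leaves `u`, increased by `1`, or `0` if there is none. -/
def prev (N : Net) (u : ℕ) : ℕ → ℕ
  | 0 => 0
  | j + 1 => if N.src j = u then j + 1 else N.prev u j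

/-- The number of arcs before `j` that leave `u`. -/
def deg (N : Net) (u j : ℕ) : ℕ := ((Finset.range j).filter fun h => N.src h = u).card

theorem deg_succ (N : Net) (u j : ℕ) :
    N.deg u (j + 1) = N.deg u j + if N.src j = u then 1 else 0 := by
  unfold deg
  rw [Finset.range_add_one, Finset.filter_insert]
  split_ifs with h
  · rw [Finset.card_insert_of_notMem (by simp)]
  · rfl

theorem prev_zero {N : Net} {u j : ℕ} (h : N.prev u j = 0) {i : ℕ} (hi : i < j) :
    N.src i ≠ u := by
  induction j with
  | zero => omega
  | succ j ih =>
    rw [prev] at h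
    split_ifs at h with h1
    rcases Nat.lt_succ_iff_lt_or_eq.1 hi with h2 | rfl
    · exact ih h h2
    · exact h1

theorem prev_succ {N : Net} {u j h : ℕ} (e : N.prev u j = h + 1) :
    h < j ∧ N.src h = u ∧ (∀ i, h < i → i < j → N.src i ≠ u) ∧ N.deg u j = N.deg u h + 1 := by
  induction j with
  | zero => simp [prev] at e
  | succ j ih =>
    rw [prev] at e
    split_ifs at e with h1
    · obtain rfl : j = h := by omega
      exact ⟨by omega, h1, fun i h2 h3 => by omega, by rw [deg_succ, if_pos h1]⟩
    · obtain ⟨h2, h3, h4, h5⟩ := ih e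
      refine ⟨by omega, h3, fun i h6 h7 => ?_, by rw [deg_succ, if_neg h1, h5]⟩
      rcases Nat.lt_succ_iff_lt_or_eq.1 h7 with h8 | rfl
      · exact h4 i h6 h8
      · exact h1

theorem sum_deg (N : Net) : ∑ u ∈ Finset.range N.n, N.deg u N.M = N.M := by
  have := Finset.card_eq_sum_card_fiberwise (f := N.src) (s := Finset.range N.M)
    (t := Finset.range N.n) fun h hh => by
      simp only [Finset.coe_range, Set.mem_Iio] at hh ⊢
      exact N.src_lt h hh
  rw [Finset.card_range] at this
  exact this.symm

/-- The vertices whose status is `1`. -/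
def inHeap (N : Net) (st : ℕ → ℕ) : Finset ℕ := (Finset.range N.n).filter fun v => st v = 1

/-- The invariant of Dijkstra's algorithm with sources `S`.  The status of a vertex is `0` if it has
not been reached, `1` if it is in the heap, and `2` if it is settled; only the arcs in `P` are known
to have been relaxed. -/
structure Labels (N : Net) (S P : Set ℕ) (st : ℕ → ℕ) (dist : ℕ → ℝ) (pe pv : ℕ → ℕ) : Prop where
  st_le : ∀ v < N.n, st v ≤ 2
  nonneg : ∀ v < N.n, st v ≠ 0 → 0 ≤ dist v
  source : ∀ v < N.n, v ∈ S → st v ≠ 0 ∧ dist v = 0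
  settled_le : ∀ v < N.n, ∀ w < N.n, st v = 2 → st w = 1 → dist v ≤ dist w
  relaxed : ∀ h < N.M, h ∈ P → st (N.src h) = 2 →
    st (N.tgt h) ≠ 0 ∧ dist (N.tgt h) ≤ dist (N.src h) + N.len (N.edg h)
  tree : ∀ v < N.n, st v ≠ 0 → v ∈ S ∨ ∃ h < N.M, N.tgt h = v ∧ st (N.src h) = 2 ∧
    pe v = N.edg h ∧ pv v = N.src h ∧ dist v = dist (N.src h) + N.len (N.edg h)

/-- The label of `u` is the largest settled label, so the new label, being larger still, respects
the order between settled and waiting vertices. The target is not a source, since the label 0 cannot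
be improved to a positive one. It is not settled, so no other vertex has its tree arc starting there
and the old tree arcs stay valid. -/
theorem Labels.relax {N : Net} {S P : Set ℕ} {st : ℕ → ℕ} {dist : ℕ → ℝ} {pe pv : ℕ → ℕ}
    (Λ : N.Labels S P st dist pe pv) {h u v : ℕ} (hh : h < N.M) (hu : N.src h = u)
    (hv : N.tgt h = v) (hsu : st u = 2) (hsv : st v ≠ 2)
    (hlt : st v ≠ 0 → dist u + N.len (N.edg h) < dist v)
    (hle : ∀ w < N.n, st w = 2 → dist w ≤ dist u) :
    N.Labels S (insert h P) (update st v 1) (update dist v (dist u + N.len (N.edg h)))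
      (update pe v (N.edg h)) (update pv v u) := by
  subst hu hv
  have hun := N.src_lt h hh
  have hvn := N.tgt_lt h hh
  have hpos := N.len_pos h hh
  have hne : ∀ w, st w = 2 → w ≠ N.tgt h := by
    rintro w hw rfl
    exact hsv hw
  have hu0 := Λ.nonneg _ hun (by omega)
  have hst2 : ∀ w, update st (N.tgt h) 1 w = 2 → st w = 2 ∧ w ≠ N.tgt h := by
    intro w hw
    rcases eq_or_ne w (N.tgt h) with rfl | hwv
    · simp at hw
    · rw [update_of_ne hwv] at hw
      exact ⟨hw, hwv⟩
  constructor
  · intro w hw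
    rcases eq_or_ne w (N.tgt h) with rfl | hwv
    · simp
    · rw [update_of_ne hwv]; exact Λ.st_le w hw
  · intro w hw h0
    rcases eq_or_ne w (N.tgt h) with rfl | hwv
    · rw [update_self]; positivity
    · rw [update_of_ne hwv] at h0 ⊢; exact Λ.nonneg w hw h0
  · intro w hw hwS
    rcases eq_or_ne w (N.tgt h) with rfl | hwv
    · obtain ⟨h1, h2⟩ := Λ.source _ hw hwS
      have := hlt h1
      exfalso
      linarith
    · rw [update_of_ne hwv, update_of_ne hwv]; exact Λ.source w hw hwS
  · intro x hx w hw h1 h2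
    obtain ⟨h1, hxv⟩ := hst2 x h1
    rw [update_of_ne hxv]
    rcases eq_or_ne w (N.tgt h) with rfl | hwv
    · rw [update_self]
      have := hle x hx h1
      linarith
    · rw [update_of_ne hwv] at h2 ⊢; exact Λ.settled_le x hx w hw h1 h2
  · intro i hi hiP h1
    obtain ⟨h1, h2⟩ := hst2 _ h1
    rw [update_of_ne h2]
    rcases eq_or_ne (N.tgt i) (N.tgt h) with e | hwv
    · rw [e, update_self, update_self]
      refine ⟨by omega, ?_⟩
      rcases Set.mem_insert_iff.1 hiP with rfl | hiP
      · exact le_rfl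
      · obtain ⟨h3, h4⟩ := Λ.relaxed i hi hiP h1
        rw [e] at h3 h4
        exact (hlt h3).le.trans h4
    · rw [update_of_ne hwv, update_of_ne hwv]
      rcases Set.mem_insert_iff.1 hiP with rfl | hiP
      · exact absurd rfl hwv
      · exact Λ.relaxed i hi hiP h1
  · intro w hw h0
    rcases eq_or_ne w (N.tgt h) with rfl | hwv
    · refine .inr ⟨h, hh, rfl, ?_⟩
      rw [update_of_ne (hne _ hsu), update_of_ne (hne _ hsu)]
      simp [hsu]
    · rw [update_of_ne hwv] at h0
      refine (Λ.tree w hw h0).imp id ?_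
      rintro ⟨i, h1, h2, h3, h4⟩
      refine ⟨i, h1, h2, ?_⟩
      rw [update_of_ne (hne _ h3), update_of_ne (hne _ h3), update_of_ne hwv, update_of_ne hwv,
        update_of_ne hwv]
      exact ⟨h3, h4⟩

theorem Labels.mono {N : Net} {S P P' : Set ℕ} {st : ℕ → ℕ} {dist : ℕ → ℝ} {pe pv : ℕ → ℕ}
    (Λ : N.Labels S P st dist pe pv)
    (h : ∀ h < N.M, h ∈ P' → st (N.src h) = 2 →
      st (N.tgt h) ≠ 0 ∧ dist (N.tgt h) ≤ dist (N.src h) + N.len (N.edg h)) :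
    N.Labels S P' st dist pe pv :=
  ⟨Λ.1, Λ.2, Λ.3, Λ.4, h, Λ.6⟩

/-- Settle the vertex `u`, which has the smallest label. -/
theorem Labels.settle {N : Net} {S : Set ℕ} {st : ℕ → ℕ} {dist : ℕ → ℝ} {pe pv : ℕ → ℕ}
    (Λ : N.Labels S Set.univ st dist pe pv) {u : ℕ} (hun : u < N.n) (hu : st u = 1)
    (hmin : ∀ v < N.n, st v = 1 → dist u ≤ dist v) :
    N.Labels S {h | N.src h ≠ u} (update st u 2) dist pe pv := by
  have hst0 : ∀ w, update st u 2 w ≠ 0 ↔ st w ≠ 0 := by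
    intro w
    rcases eq_or_ne w u with rfl | hwu
    · simp [hu]
    · rw [update_of_ne hwu]
  have hst2 : ∀ w, st w = 2 → update st u 2 w = 2 := by
    intro w hw
    rcases eq_or_ne w u with rfl | hwu
    · simp
    · rwa [update_of_ne hwu]
  constructor
  · intro w hw
    rcases eq_or_ne w u with rfl | hwu
    · simp
    · rw [update_of_ne hwu]; exact Λ.st_le w hw
  · intro w hw h0
    exact Λ.nonneg w hw ((hst0 w).1 h0)
  · intro w hw hwS
    rw [hst0]
    exact Λ.source w hw hwS
  · intro x hx w hw h1 h2
    rcases eq_or_ne w u with rfl | hwu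
    · simp at h2
    · rw [update_of_ne hwu] at h2
      rcases eq_or_ne x u with rfl | hxu
      · exact hmin w hw h2
      · rw [update_of_ne hxu] at h1
        exact Λ.settled_le x hx w hw h1 h2
  · intro h hh hP h1
    rw [update_of_ne hP] at h1
    rw [hst0]
    exact Λ.relaxed h hh trivial h1
  · intro w hw h0
    refine (Λ.tree w hw ((hst0 w).1 h0)).imp id ?_
    rintro ⟨i, h1, h2, h3, h4⟩
    exact ⟨i, h1, h2, hst2 _ h3, h4⟩

end Net

/-! ### Relaxing the arcs of a settled vertex -/

namespace RAM

open Instr Program Test Heap Function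

namespace Reg
abbrev u := 20
abbrev h := 21
abbrev e := 22
abbrev v := 23
abbrev sv := 24
abbrev i := 25
end Reg

namespace Arr
abbrev status := 12
abbrev pe := 13
abbrev pv := 14
abbrev head := 15
abbrev next := 16
abbrev tgt := 17
abbrev edg := 18
abbrev source := 19
end Arr

namespace RReg
abbrev du := 3
abbrev w := 4
abbrev nd := 5
abbrev dv := 6
end RReg

/-- The memory holds the arcs of `N` as linked lists. -/
structure Loaded (N : Net) (R : ℕ) (s : State) : Prop where
  n : s.natReg Reg.n = N.n
  zero : s.natReg Reg.zero = 0
  cap : s.natReg Reg.cap = R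
  tgt : ∀ h < N.M, s.natArr Arr.tgt h = N.tgt h
  edg : ∀ h < N.M, s.natArr Arr.edg h = N.edg h
  head : ∀ u < N.n, s.natArr Arr.head u = N.prev u N.M
  next : ∀ h < N.M, s.natArr Arr.next h = N.prev (N.src h) h
  len : ∀ h < N.M, s.realArr RArr.len (N.edg h) = N.len (N.edg h)

theorem Loaded.of_keeps {N : Net} {R : ℕ} {s s' : State} (Λ : Loaded N R s) {p : Program}
    (h : Keeps p s s')
    (h1 : ∀ x ∈ [Reg.n, Reg.zero, Reg.cap], x ∉ p.collect Instr.natRegs)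
    (h2 : ∀ x ∈ [Arr.tgt, Arr.edg, Arr.head, Arr.next], x ∉ p.collect Instr.natArrs)
    (h3 : RArr.len ∉ p.collect Instr.realArrs) : Loaded N R s' where
  n := (h.natReg _ (h1 _ (by simp))).trans Λ.n
  zero := (h.natReg _ (h1 _ (by simp))).trans Λ.zero
  cap := (h.natReg _ (h1 _ (by simp))).trans Λ.cap
  tgt i hi := by rw [h.natArr _ (h2 _ (by simp)), Λ.tgt i hi]
  edg i hi := by rw [h.natArr _ (h2 _ (by simp)), Λ.edg i hi]
  head i hi := by rw [h.natArr _ (h2 _ (by simp)), Λ.head i hi]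
  next i hi := by rw [h.natArr _ (h2 _ (by simp)), Λ.next i hi]
  len i hi := by rw [h.realArr _ h3, Λ.len i hi]

/-- The invariant of Dijkstra's algorithm for a memory. -/
abbrev HasLabels (N : Net) (S P : Set ℕ) (s : State) : Prop :=
  N.Labels S P (s.natArr Arr.status) (s.realArr RArr.dist) (s.natArr Arr.pe) (s.natArr Arr.pv)

/-- Relax all arcs that leave the vertex in register `u`, starting with the arc `h - 1`. -/
def relaxLoop : Program :=
  .while (natLT Reg.zero Reg.h) <|
    seq (block [natPred Reg.h, natLoad Reg.e Arr.edg Reg.h, natLoad Reg.v Arr.tgt Reg.h,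
      realLoad RReg.w RArr.len Reg.e, realAdd RReg.nd RReg.du RReg.w,
      natLoad Reg.sv Arr.status Reg.v]) <|
    seq (ite (natEq Reg.sv Reg.zero)
      (block [natConst Reg.c 1, natStore Arr.status Reg.v Reg.c, natStore Arr.stk Reg.size Reg.v,
        natSucc Reg.size, realStore RArr.dist Reg.v RReg.nd, natStore Arr.pe Reg.v Reg.e,
        natStore Arr.pv Reg.v Reg.u])
      (seq (block [realLoad RReg.dv RArr.dist Reg.v]) <|
        ite (realLE RReg.dv RReg.nd) .skip <|
          seq (block [natMove Reg.x Reg.v]) <|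
          seq cascade <|
          block [natConst Reg.c 1, natStore Arr.status Reg.v Reg.c,
            realStore RArr.dist Reg.v RReg.nd, natStore Arr.pe Reg.v Reg.e,
            natStore Arr.pv Reg.v Reg.u])) <|
    block [natLoad Reg.h Arr.next Reg.h]

theorem inHeap_update {N : Net} {st : ℕ → ℕ} {v : ℕ} (hv : v < N.n) :
    N.inHeap (update st v 1) = insert v (N.inHeap st) := by
  ext w
  simp only [Net.inHeap, Finset.mem_insert, Finset.mem_filter, Finset.mem_range]
  rcases eq_or_ne w v with rfl | hne
  · simp [hv]
  · simp [hne]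

theorem inHeap_settle {N : Net} {st : ℕ → ℕ} {v : ℕ} :
    N.inHeap (update st v 2) = (N.inHeap st).erase v := by
  ext w
  simp only [Net.inHeap, Finset.mem_erase, Finset.mem_filter, Finset.mem_range]
  rcases eq_or_ne w v with rfl | hne
  · simp
  · simp [hne]

/-- The list of `u` is traversed by decreasing arc number, so the relaxed arcs are always those that
do not leave `u` and those numbered from some `j` on. An arc costs at most 800 amortised, of which a
cascade may take 700. -/
theorem runs_relaxLoop {N : Net} {R u : ℕ} {S : Set ℕ} {s : State} (Λ : Loaded N R s)
    (hu : s.natReg Reg.u = u) (hh : s.natReg Reg.h = N.prev u N.M)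
    (hd : s.realReg RReg.du = s.realArr RArr.dist u)
    (V : (heap s).Valid N.n R (N.inHeap (s.natArr Arr.status)))
    (D : HasLabels N S {h | N.src h ≠ u} s)
    (hsu : s.natArr Arr.status u = 2)
    (hle : ∀ w < N.n, s.natArr Arr.status w = 2 → s.realArr RArr.dist w ≤ s.realArr RArr.dist u) :
    Runs relaxLoop s fun t s' =>
      (heap s').Valid N.n R (N.inHeap (s'.natArr Arr.status)) ∧ HasLabels N S Set.univ s' ∧
      (∀ w, s'.natArr Arr.status w = 2 ↔ s.natArr Arr.status w = 2) ∧
      t + (heap s').potential N.n ≤ (heap s).potential N.n + 800 * N.deg u N.M + 1 := by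
  refine Runs.while (fun t s' => ∃ j ≤ N.M, s'.natReg Reg.h = N.prev u j ∧
      (heap s').Valid N.n R (N.inHeap (s'.natArr Arr.status)) ∧
      HasLabels N S {h | N.src h ≠ u ∨ j ≤ h} s' ∧
      (∀ w, s'.natArr Arr.status w = 2 ↔ s.natArr Arr.status w = 2) ∧
      (∀ w, s'.natArr Arr.status w = 2 → s'.realArr RArr.dist w = s.realArr RArr.dist w) ∧
      t + (heap s').potential N.n + 800 * N.deg u j ≤
        (heap s).potential N.n + 800 * N.deg u N.M)
    ((heap s).potential N.n + 800 * N.deg u N.M) ?_ ?_ ?_ ?_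
  · rintro t s' ⟨j, -, h⟩
    omega
  · refine ⟨N.M, le_rfl, hh, V, D.mono fun h h1 h2 => D.relaxed h h1 ?_, fun _ => Iff.rfl,
      fun _ _ => rfl, by omega⟩
    rcases h2 with h2 | h2
    · exact h2
    · omega
  · rintro t s' ⟨j, hj, hh', V', D', st2, dist2, C⟩ hk hb
    have Λ' := Λ.of_keeps hk (by decide) (by decide) (by decide)
    have hu' : s'.natReg Reg.u = u := (hk.natReg _ (by decide)).trans hu
    have hd' : s'.realReg RReg.du = s.realArr RArr.dist u :=
      (hk.realReg _ (by decide)).trans hd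
    change s'.natReg Reg.zero < s'.natReg Reg.h at hb
    rw [Λ'.zero] at hb
    obtain ⟨h, hhe⟩ : ∃ h, s'.natReg Reg.h = h + 1 := ⟨_, (Nat.succ_pred_eq_of_pos hb).symm⟩
    obtain ⟨h1, h2, h3, h4⟩ := Net.prev_succ (hh'.symm.trans hhe)
    have hM : h < N.M := by omega
    obtain ⟨v, hv⟩ : ∃ v, N.tgt h = v := ⟨_, rfl⟩
    have vn : v < N.n := hv ▸ N.tgt_lt h hM
    have hsu' : s'.natArr Arr.status u = 2 := (st2 u).2 hsu
    have hdu : s'.realArr RArr.dist u = s.realArr RArr.dist u := dist2 u hsu'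
    refine Runs.blockSeq 7 (Runs.seq ?_)
    generalize hs2 : runList _ s' = s2
    have hpred : s'.natReg Reg.h - 1 = h := by omega
    have a1 : heap s2 = heap s' := by rw [← hs2]; rfl
    have a2 : s2.natArr = s'.natArr := by rw [← hs2]; rfl
    have a3 : s2.realArr = s'.realArr := by rw [← hs2]; rfl
    have a4 : s2.natReg Reg.h = h := by rw [← hs2]; exact hpred
    have a5 : s2.natReg Reg.v = v := by
      rw [← hv, ← Λ'.tgt h hM, ← hpred, ← hs2]; rfl
    have a6 : s2.natReg Reg.e = N.edg h := by
      rw [← Λ'.edg h hM, ← hpred, ← hs2]; rfl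
    have a7 : s2.natReg Reg.u = u := by rw [← hs2]; exact hu'
    have a8 : s2.realReg RReg.nd = s'.realArr RArr.dist u + N.len (N.edg h) := by
      rw [hdu, ← hd', ← Λ'.len h hM, ← Λ'.edg h hM, ← hpred, ← hs2]; rfl
    have a9 : s2.natReg Reg.sv = s'.natArr Arr.status v := by
      rw [← hv, ← Λ'.tgt h hM, ← hpred, ← hs2]; rfl
    have a10 : s2.natReg Reg.zero = 0 := by rw [← hs2]; exact Λ'.zero
    have a11 : s2.natReg Reg.size = s'.natReg Reg.size := by rw [← hs2]; rfl
    have hle' : ∀ w < N.n, s'.natArr Arr.status w = 2 →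
        s'.realArr RArr.dist w ≤ s'.realArr RArr.dist u := by
      intro w hw hw2
      rw [dist2 w hw2, hdu]
      exact hle w hw ((st2 w).1 hw2)
    have hlen := N.len_pos h hM
    -- No arc strictly between `h` and `j` leaves `u`, so lowering the bound from `j` to `h` adds
    -- only the arc `h` itself.
    have hPsub : ∀ i, (N.src i ≠ u ∨ h ≤ i) → i ∈ insert h {i | N.src i ≠ u ∨ j ≤ i} := by
      intro i hi
      rcases hi with hi | hi
      · exact .inr (.inl hi)
      · rcases hi.eq_or_lt with rfl | hi
        · exact .inl rfl
        · by_cases hij : j ≤ i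
          · exact .inr (.inr hij)
          · exact .inr (.inl (h3 i hi (by omega)))
    -- This is the common continuation of the three branches: a vertex reached for the first time,
    -- no improvement, and a decreased key. Allowing 780 in a branch leaves 20 of the 800 for
    -- loading the arc and advancing.
    suffices H : ∀ t' s3, s3.natReg Reg.h = h →
        s3.natArr Arr.next = s'.natArr Arr.next →
        (heap s3).Valid N.n R (N.inHeap (s3.natArr Arr.status)) →
        HasLabels N S {i | N.src i ≠ u ∨ h ≤ i} s3 →
        (∀ w, s3.natArr Arr.status w = 2 ↔ s'.natArr Arr.status w = 2) →
        (∀ w, s3.natArr Arr.status w = 2 → s3.realArr RArr.dist w = s'.realArr RArr.dist w) →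
        t' + (heap s3).potential N.n ≤ (heap s').potential N.n + 780 →
        Runs (block [natLoad Reg.h Arr.next Reg.h]) s3 fun t'' s4 =>
          ∃ j ≤ N.M, s4.natReg Reg.h = N.prev u j ∧
          (heap s4).Valid N.n R (N.inHeap (s4.natArr Arr.status)) ∧
          HasLabels N S {h | N.src h ≠ u ∨ j ≤ h} s4 ∧
          (∀ w, s4.natArr Arr.status w = 2 ↔ s.natArr Arr.status w = 2) ∧
          (∀ w, s4.natArr Arr.status w = 2 → s4.realArr RArr.dist w = s.realArr RArr.dist w) ∧
          t + (7 + (t' + t'')) + 1 + (heap s4).potential N.n + 800 * N.deg u j ≤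
            (heap s).potential N.n + 800 * N.deg u N.M by
      refine Runs.ite (fun hc => Runs.blockEnd 8 (H _ _ ?_ ?_ ?_ ?_ ?_ ?_ ?_)) fun hc =>
        Runs.blockSeq 2 (Runs.ite (fun hc2 => Runs.skip (H _ _ ?_ ?_ ?_ ?_ ?_ ?_ ?_)) fun hc2 => ?_)
      · exact a4
      · exact congrFun a2 _
      · change s2.natReg Reg.sv = s2.natReg Reg.zero at hc
        rw [a9, a10] at hc
        generalize hs3 : runList _ s2 = s3
        have b1 : heap s3 = { (heap s').push v with
            key := update (heap s').key v (s'.realArr RArr.dist u + N.len (N.edg h)) } := by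
          rw [← a1, ← a8, ← a5, ← hs3]; rfl
        have b2 : s3.natArr Arr.status = update (s'.natArr Arr.status) v 1 := by
          rw [← a2, ← a5, ← hs3]; rfl
        have hvA : v ∉ N.inHeap (s'.natArr Arr.status) := by simp [Net.inHeap, hc]
        have hp := V'.forest.par_out v hvA
        rw [b2, inHeap_update vn, b1]
        refine ⟨?_, ?_, V'.tab_eq⟩
        · exact ((V'.forest.setKey hp fun h => absurd h hvA).insert vn).push v
        · have := ((V'.located.insert hvA hp).push (v := v) (by simp)).setKey
            (update (heap s').key v (s'.realArr RArr.dist u + N.len (N.edg h)))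
          simpa using this
      · change s2.natReg Reg.sv = s2.natReg Reg.zero at hc
        rw [a9, a10] at hc
        generalize hs3 : runList _ s2 = s3
        have b2 : s3.natArr Arr.status = update (s'.natArr Arr.status) v 1 := by
          rw [← a2, ← a5, ← hs3]; rfl
        have b3 : s3.realArr RArr.dist = update (s'.realArr RArr.dist) v
            (s'.realArr RArr.dist u + N.len (N.edg h)) := by
          rw [← a3, ← a5] at *; rw [← a8, ← hs3]; rfl
        have b4 : s3.natArr Arr.pe = update (s'.natArr Arr.pe) v (N.edg h) := by
          rw [← a2, ← a5, ← a6, ← hs3]; rfl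
        have b5 : s3.natArr Arr.pv = update (s'.natArr Arr.pv) v u := by
          rw [← a2, ← a5, ← a7, ← hs3]; rfl
        have := D'.relax hM h2 hv hsu' (by omega) (fun h0 => absurd hc h0) hle'
        rw [HasLabels, b2, b3, b4, b5]
        exact this.mono fun i hi hP h0 => this.relaxed i hi (hPsub i hP) h0
      · change s2.natReg Reg.sv = s2.natReg Reg.zero at hc
        rw [a9, a10] at hc
        generalize hs3 : runList _ s2 = s3
        have b2 : s3.natArr Arr.status = update (s'.natArr Arr.status) v 1 := by
          rw [← a2, ← a5, ← hs3]; rfl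
        intro w
        rw [b2]
        rcases eq_or_ne w v with rfl | hne
        · simp [hc]
        · rw [update_of_ne hne]
      · change s2.natReg Reg.sv = s2.natReg Reg.zero at hc
        rw [a9, a10] at hc
        generalize hs3 : runList _ s2 = s3
        have b2 : s3.natArr Arr.status = update (s'.natArr Arr.status) v 1 := by
          rw [← a2, ← a5, ← hs3]; rfl
        have b3 : s3.realArr RArr.dist = update (s'.realArr RArr.dist) v (s2.realReg RReg.nd) := by
          rw [← a3, ← a5, ← hs3]; rfl
        intro w
        rw [b2, b3]
        rcases eq_or_ne w v with rfl | hne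
        · simp
        · rw [update_of_ne hne, update_of_ne hne]; exact fun _ => rfl
      · generalize hs3 : runList _ s2 = s3
        have b1 : (heap s3).potential N.n = ((heap s').push v).potential N.n := by
          rw [← a1, ← hs3]; rfl
        have b2 : ((heap s').push v).potential N.n = (heap s').potential N.n + 100 := by
          have h5 : ((heap s').push v).marked N.n = (heap s').marked N.n := rfl
          have h6 : ((heap s').push v).ns = (heap s').ns + 1 := rfl
          simp only [potential, h5, h6]
          omega
        omega
      · exact a4
      · exact congrFun a2 _
      · change (heap s2).Valid N.n R (N.inHeap (s2.natArr Arr.status))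
        rw [a1, a2]
        exact V'
      · change ¬ s2.natReg Reg.sv = s2.natReg Reg.zero at hc
        change s2.realArr RArr.dist (s2.natReg Reg.v) ≤ s2.realReg RReg.nd at hc2
        rw [a5, a8, a3] at hc2
        rw [a9, a10] at hc
        change N.Labels S _ (s2.natArr Arr.status) (s2.realArr RArr.dist) (s2.natArr Arr.pe)
          (s2.natArr Arr.pv)
        rw [a2, a3]
        refine D'.mono fun i hi hP h0 => ?_
        rcases Set.mem_insert_iff.1 (hPsub i hP) with rfl | hP
        · rw [hv, h2]
          exact ⟨hc, hc2⟩
        · exact D'.relaxed i hi hP h0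
      · change ∀ w, s2.natArr Arr.status w = 2 ↔ _
        rw [a2]
        exact fun _ => Iff.rfl
      · change ∀ w, s2.natArr Arr.status w = 2 → s2.realArr RArr.dist w = _
        rw [a2, a3]
        exact fun _ _ => rfl
      · change _ + (heap s2).potential N.n ≤ _
        rw [a1]
        omega
      · change ¬ s2.natReg Reg.sv = s2.natReg Reg.zero at hc
        change ¬ s2.realArr RArr.dist (s2.natReg Reg.v) ≤ s2.realReg RReg.nd at hc2
        rw [a5, a8, a3, not_le] at hc2
        rw [a9, a10] at hc
        -- A settled vertex has label at most that of `u`, so a positive arc from `u` cannot improve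
        -- it; the vertex must therefore be in the heap.
        have hst : s'.natArr Arr.status v = 1 := by
          have h5 := D'.st_le v vn
          have h6 : s'.natArr Arr.status v ≠ 2 := fun h6 => by
            have := hle' v vn h6
            linarith
          omega
        refine Runs.blockSeq 2 (Runs.seq ?_)
        generalize hs3 : runList _ (runList _ s2) = s3
        have b1 : heap s3 = heap s' := by rw [← a1, ← hs3]; rfl
        have b2 : s3.natArr = s'.natArr := by rw [← a2, ← hs3]; rfl
        have b3 : s3.natReg Reg.x = v := by rw [← a5, ← hs3]; rfl
        have b4 : s3.natReg Reg.zero = 0 := by rw [← hs3]; exact a10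
        have b5 : s3.natReg Reg.h = h := by rw [← hs3]; exact a4
        have b6 : s3.natReg Reg.v = v := by rw [← hs3]; exact a5
        have b7 : s3.natReg Reg.e = N.edg h := by rw [← hs3]; exact a6
        have b8 : s3.natReg Reg.u = u := by rw [← hs3]; exact a7
        have b9 : s3.realReg RReg.nd = s'.realArr RArr.dist u + N.len (N.edg h) := by
          rw [← hs3]; exact a8
        have b10 : s3.realArr = s'.realArr := by rw [← a3, ← hs3]; rfl
        refine (runs_cascade b4 (b1 ▸ V')).keeps.mono ?_
        rintro t4 s4 ⟨⟨V4, p4, k4, C4⟩, hk4⟩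
        rw [b3] at p4
        rw [b1] at k4 C4
        have c2 : s4.natArr Arr.status = s'.natArr Arr.status :=
          (hk4.natArr _ (by decide)).trans (by rw [b2])
        have c3 : s4.realArr RArr.dist = s'.realArr RArr.dist :=
          (hk4.realArr _ (by decide)).trans (by rw [b10])
        have c4 : s4.natArr Arr.pe = s'.natArr Arr.pe :=
          (hk4.natArr _ (by decide)).trans (by rw [b2])
        have c5 : s4.natArr Arr.pv = s'.natArr Arr.pv :=
          (hk4.natArr _ (by decide)).trans (by rw [b2])
        have c6 : s4.natReg Reg.v = v := (hk4.natReg _ (by decide)).trans b6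
        have c7 : s4.natReg Reg.e = N.edg h := (hk4.natReg _ (by decide)).trans b7
        have c8 : s4.natReg Reg.u = u := (hk4.natReg _ (by decide)).trans b8
        have c9 : s4.realReg RReg.nd = s'.realArr RArr.dist u + N.len (N.edg h) :=
          (hk4.realReg _ (by decide)).trans b9
        refine Runs.blockEnd 6 ?_
        generalize hs5 : runList _ s4 = s5
        have d1 : heap s5 = { heap s4 with
            key := update (heap s4).key v (s'.realArr RArr.dist u + N.len (N.edg h)) } := by
          rw [← c9, ← c6, ← hs5]; rfl
        have d2 : s5.natArr Arr.status = update (s'.natArr Arr.status) v 1 := by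
          rw [← c2, ← c6, ← hs5]; rfl
        have d3 : s5.realArr RArr.dist = update (s'.realArr RArr.dist) v
            (s'.realArr RArr.dist u + N.len (N.edg h)) := by
          rw [← c9, ← c6, ← c3, ← hs5]; rfl
        have d4 : s5.natArr Arr.pe = update (s'.natArr Arr.pe) v (N.edg h) := by
          rw [← c4, ← c6, ← c7, ← hs5]; rfl
        have d5 : s5.natArr Arr.pv = update (s'.natArr Arr.pv) v u := by
          rw [← c5, ← c6, ← c8, ← hs5]; rfl
        have d6 : update (s'.natArr Arr.status) v 1 = s'.natArr Arr.status := by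
          rw [update_eq_self_iff, hst]
        have hlab := D'.relax hM h2 hv hsu' (by omega) (fun _ => hc2) hle'
        refine H _ s5 ?_ ?_ ?_ ?_ ?_ ?_ ?_
        · rw [← hs5]
          exact (hk4.natReg Reg.h (by decide)).trans b5
        · rw [← b2, ← hk4.natArr Arr.next (by decide), ← hs5]; rfl
        · rw [d1, d2, d6]
          -- The cascade comes before the change of the key: it has made `v` a root, and lowering
          -- the key of a root preserves heap order.
          refine ⟨V4.forest.setKey p4 fun _ => ?_, V4.located.setKey _, V4.tab_eq⟩
          rw [k4]
          exact hc2.le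
        · rw [HasLabels, d2, d3, d4, d5]
          exact hlab.mono fun i hi hP h0 => hlab.relaxed i hi (hPsub i hP) h0
        · rw [d2, d6]
          exact fun _ => Iff.rfl
        · rw [d2, d6, d3]
          intro w hw
          rw [update_of_ne]
          rintro rfl
          omega
        · have : (heap s5).potential N.n = (heap s4).potential N.n := by rw [d1]; rfl
          omega
    intro t' s3 q1 q2 q3 q4 q5 q6 q7
    refine Runs.blockEnd 2 ?_
    generalize hs4 : runList _ s3 = s4
    have r1 : heap s4 = heap s3 := by rw [← hs4]; rfl
    have r2 : s4.natArr = s3.natArr := by rw [← hs4]; rfl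
    have r3 : s4.realArr = s3.realArr := by rw [← hs4]; rfl
    have r4 : s4.natReg Reg.h = N.prev u h := by
      rw [← h2, ← Λ'.next h hM, ← q2, ← q1, ← hs4]; rfl
    refine ⟨h, by omega, r4, ?_, ?_, ?_, ?_, ?_⟩
    · rw [r1, r2]; exact q3
    · rw [HasLabels, r2, r3]; exact q4
    · rw [r2]; exact fun w => (q5 w).trans (st2 w)
    · rw [r2, r3]
      exact fun w hw => (q6 w hw).trans (dist2 w ((q5 w).1 hw))
    · rw [r1]
      omega
  · rintro t s' ⟨j, hj, hh', V', D', st2, dist2, C⟩ hk hb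
    have Λ' := Λ.of_keeps hk (by decide) (by decide) (by decide)
    change ¬ s'.natReg Reg.zero < s'.natReg Reg.h at hb
    rw [Λ'.zero] at hb
    refine ⟨V', D'.mono fun h h1 _ => D'.relaxed h h1 ?_, st2, by omega⟩
    by_cases hj' : j ≤ h
    · exact .inr hj'
    · exact .inl (Net.prev_zero (hh'.symm.trans (by omega)) (by omega))

end RAM

namespace Heap

/-- Each run of Dijkstra's algorithm starts from an empty heap, so it inherits no debt and the
bounds of the runs simply add up. -/
theorem Valid.potential_empty {h : Heap} {n R : ℕ} (V : h.Valid n R ∅) : h.potential n = 0 := by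
  have h1 : h.ns = 0 := by
    by_contra h0
    have := (V.located.stk_mem 0 (by omega)).1
    simp at this
  have h2 : h.marked n = 0 := by
    rw [marked, Finset.card_eq_zero, Finset.filter_eq_empty_iff]
    exact fun v _ h => h.1 (V.forest.par_out v (by simp))
  rw [potential, h1, h2]

end Heap

/-! ### Initialisation and the main loop of Dijkstra's algorithm -/

namespace RAM

open Instr Program Test Heap Function

/-- Reset the labels and put all sources into the heap. -/
def initLabels : Program :=
  seq (block [natConst Reg.i 0, realConst RReg.d1 0]) <|
  .while (natLT Reg.i Reg.n) <|
    seq (block [natLoad Reg.c Arr.source Reg.i, natStore Arr.status Reg.i Reg.zero]) <|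
    seq (ite (natEq Reg.c Reg.zero) .skip
      (block [natConst Reg.c 1, natStore Arr.status Reg.i Reg.c, realStore RArr.dist Reg.i RReg.d1,
        natStore Arr.stk Reg.size Reg.i, natSucc Reg.size])) <|
    block [natSucc Reg.i]

/-- The vertices that are marked as sources. -/
def sources (s : State) : Set ℕ := {v | s.natArr Arr.source v ≠ 0}

theorem runs_initLabels {N : Net} {R : ℕ} {s : State} (Λ : Loaded N R s)
    (V : (heap s).Valid N.n R ∅) :
    Runs initLabels s fun t s' => (heap s').Valid N.n R (N.inHeap (s'.natArr Arr.status)) ∧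
      HasLabels N (sources s) Set.univ s' ∧ (∀ v < N.n, s'.natArr Arr.status v ≠ 2) ∧
      t + (heap s').potential N.n ≤ 120 * N.n + 10 := by
  classical
  refine Runs.blockSeq 3 ?_
  generalize hs1 : runList _ s = s1
  have e1 : heap s1 = heap s := by rw [← hs1]; rfl
  have e2 : s1.natReg Reg.i = 0 := by rw [← hs1]; rfl
  have e3 : s1.realReg RReg.d1 = 0 := by
    have : s1.realReg RReg.d1 = ((0 : ℕ) : ℝ) := by rw [← hs1]; rfl
    simpa using this
  have e4 : s1.natReg Reg.zero = 0 := by rw [← hs1]; exact Λ.zero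
  have e5 : s1.natReg Reg.n = N.n := by rw [← hs1]; exact Λ.n
  have e6 : s1.natArr Arr.source = s.natArr Arr.source := by rw [← hs1]; rfl
  let A : ℕ → Finset ℕ := fun i => (Finset.range i).filter fun v => v ∈ sources s
  have A1 : ∀ i ∈ sources s, A (i + 1) = insert i (A i) := by
    intro i hi
    simp only [A]
    rw [Finset.range_add_one, Finset.filter_insert, if_pos hi]
  have A2 : ∀ i ∉ sources s, A (i + 1) = A i := by
    intro i hi
    simp only [A]
    rw [Finset.range_add_one, Finset.filter_insert, if_neg hi]
  refine Runs.while (fun t s' => s'.natReg Reg.i ≤ N.n ∧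
      (heap s').Valid N.n R (A (s'.natReg Reg.i)) ∧
      (∀ v < s'.natReg Reg.i, s'.natArr Arr.status v = if v ∈ sources s then 1 else 0) ∧
      (∀ v < s'.natReg Reg.i, v ∈ sources s → s'.realArr RArr.dist v = 0) ∧
      t + (heap s').potential N.n ≤ 120 * s'.natReg Reg.i) (120 * N.n) ?_ ?_ ?_ ?_
  · intro t s' h
    omega
  · rw [e1, e2, V.potential_empty]
    exact ⟨by omega, by simpa [A] using V, fun v hv => absurd hv (by omega),
      fun v hv => absurd hv (by omega), by omega⟩
  · rintro t s' ⟨hi, V, st, ds, C⟩ hk hb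
    have k3 : s'.realReg RReg.d1 = 0 := (hk.realReg _ (by decide)).trans e3
    have k4 : s'.natReg Reg.zero = 0 := (hk.natReg _ (by decide)).trans e4
    have k5 : s'.natReg Reg.n = N.n := (hk.natReg _ (by decide)).trans e5
    have k6 : s'.natArr Arr.source = s.natArr Arr.source := (hk.natArr _ (by decide)).trans e6
    change s'.natReg Reg.i < s'.natReg Reg.n at hb
    rw [k5] at hb
    obtain ⟨i, hi'⟩ : ∃ i, s'.natReg Reg.i = i := ⟨_, rfl⟩
    rw [hi'] at hi V st ds C hb
    refine Runs.blockSeq 3 (Runs.seq ?_)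
    generalize hs2 : runList _ s' = s2
    have f1 : heap s2 = heap s' := by rw [← hs2]; rfl
    have f2 : s2.natReg Reg.i = i := by rw [← hs2]; exact hi'
    have f3 : s2.natReg Reg.c = s.natArr Arr.source i := by rw [← k6, ← hi', ← hs2]; rfl
    have f4 : s2.natArr Arr.status = update (s'.natArr Arr.status) i 0 := by
      rw [← hi', ← k4, ← hs2]; rfl
    have f5 : s2.realArr RArr.dist = s'.realArr RArr.dist := by rw [← hs2]; rfl
    have f6 : s2.natReg Reg.zero = 0 := by rw [← hs2]; exact k4
    have f7 : s2.realReg RReg.d1 = 0 := by rw [← hs2]; exact k3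
    have hiA : i ∉ A i := by simp [A]
    refine Runs.ite (fun hc => Runs.skip (Runs.blockEnd 2 ?_)) fun hc =>
      Runs.blockEnd 6 (Runs.blockEnd 2 ?_)
    · change s2.natReg Reg.c = s2.natReg Reg.zero at hc
      rw [f3, f6] at hc
      have hiS : i ∉ sources s := fun h => h hc
      generalize hs3 : runList _ s2 = s3
      have g1 : heap s3 = heap s' := by rw [← f1, ← hs3]; rfl
      have g2 : s3.natReg Reg.i = i + 1 := by rw [← f2, ← hs3]; rfl
      have g3 : s3.natArr Arr.status = update (s'.natArr Arr.status) i 0 := by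
        rw [← f4, ← hs3]; rfl
      have g4 : s3.realArr RArr.dist = s'.realArr RArr.dist := by rw [← f5, ← hs3]; rfl
      rw [g1, g2, g3, g4, A2 i hiS]
      refine ⟨hb, V, fun v hv => ?_, fun v hv hvS => ?_, by omega⟩
      · rcases eq_or_ne v i with rfl | hne
        · simp [hiS]
        · rw [update_of_ne hne]; exact st v (by omega)
      · have : v ≠ i := by rintro rfl; exact hiS hvS
        exact ds v (by omega) hvS
    · change ¬ s2.natReg Reg.c = s2.natReg Reg.zero at hc
      rw [f3, f6] at hc
      have hiS : i ∈ sources s := hc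
      generalize hs3 : runList _ (runList _ s2) = s3
      have g1 : heap s3 = { (heap s').push i with key := update (heap s').key i 0 } := by
        rw [← f1, ← f2, ← f7, ← hs3]; rfl
      have g2 : s3.natReg Reg.i = i + 1 := by rw [← f2, ← hs3]; rfl
      have g3 : s3.natArr Arr.status = update (s'.natArr Arr.status) i 1 := by
        have : s3.natArr Arr.status = update (s2.natArr Arr.status) (s2.natReg Reg.i) 1 := by
          rw [← hs3]; rfl
        rw [this, f4, f2, update_idem]
      have g4 : s3.realArr RArr.dist = update (s'.realArr RArr.dist) i 0 := by
        rw [← f5, ← f2, ← f7, ← hs3]; rfl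
      have hp := V.forest.par_out i hiA
      have hpot : (heap s3).potential N.n = (heap s').potential N.n + 100 := by
        have h5 : ((heap s').push i).marked N.n = (heap s').marked N.n := rfl
        have h6 : ((heap s').push i).ns = (heap s').ns + 1 := rfl
        have h7 : (heap s3).potential N.n = ((heap s').push i).potential N.n := by rw [g1]; rfl
        rw [h7]
        simp only [potential, h5, h6]
        omega
      rw [hpot, g1, g2, g3, g4, A1 i hiS]
      refine ⟨hb, ⟨((V.forest.setKey hp fun h => absurd h hiA).insert hb).push i, ?_, V.tab_eq⟩,
        fun v hv => ?_, fun v hv hvS => ?_, by omega⟩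
      · have := ((V.located.insert hiA hp).push (v := i) (by simp)).setKey
            (update (heap s').key i 0)
        simpa using this
      · rcases eq_or_ne v i with rfl | hne
        · simp [hiS]
        · rw [update_of_ne hne]; exact st v (by omega)
      · rcases eq_or_ne v i with rfl | hne
        · simp
        · rw [update_of_ne hne]; exact ds v (by omega) hvS
  · rintro t s' ⟨hi, V, st, ds, C⟩ hk hb
    have k5 : s'.natReg Reg.n = N.n := (hk.natReg _ (by decide)).trans e5
    change ¬ s'.natReg Reg.i < s'.natReg Reg.n at hb
    have hin : s'.natReg Reg.i = N.n := by omega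
    rw [hin] at V st ds C
    have hA : N.inHeap (s'.natArr Arr.status) = A N.n := by
      ext v
      simp only [Net.inHeap, A, Finset.mem_filter, Finset.mem_range]
      refine and_congr_right fun hv => ?_
      rw [st v hv]
      split_ifs <;> simp_all
    have h2 : ∀ v < N.n, s'.natArr Arr.status v ≠ 2 := by
      intro v hv
      rw [st v hv]
      split_ifs <;> omega
    have hS : ∀ v < N.n, s'.natArr Arr.status v ≠ 0 → v ∈ sources s := by
      intro v hv h0
      rw [st v hv] at h0
      by_contra h
      simp [h] at h0
    refine ⟨hA ▸ V, ⟨fun v hv => ?_, fun v hv h0 => ?_, fun v hv hvS => ⟨?_, ds v hv hvS⟩,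
      fun v hv w _ h0 => absurd h0 (h2 v hv), fun h hh _ h0 => absurd h0 (h2 _ (N.src_lt h hh)),
      fun v hv h0 => .inl (hS v hv h0)⟩, h2, by omega⟩
    · rw [st v hv]
      split_ifs <;> omega
    · exact (ds v hv (hS v hv h0)).ge
    · rw [st v hv, if_pos hvS]
      omega

/-- Dijkstra's algorithm. -/
def dijkstra : Program :=
  seq initLabels <| seq deleteMin <|
  .while (natLT Reg.zero Reg.best) <|
    seq (block [natMove Reg.u Reg.p, natConst Reg.c 2, natStore Arr.status Reg.u Reg.c,
      realLoad RReg.du RArr.dist Reg.u, natLoad Reg.h Arr.head Reg.u]) <|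
    seq relaxLoop deleteMin

/-- Every vertex is settled at most once. It is charged for its outgoing arcs and for one deletion
of a minimum, and the out-degrees sum to the number of arcs. -/
theorem runs_dijkstra {N : Net} {R L : ℕ} {s : State} (hR : R = 2 * L) (hn : N.n < 2 ^ L)
    (hL : 0 < L) (Λ : Loaded N R s) (V : (heap s).Valid N.n R ∅) :
    Runs dijkstra s fun t s' => (heap s').Valid N.n R ∅ ∧ HasLabels N (sources s) Set.univ s' ∧
      (∀ v < N.n, s'.natArr Arr.status v = 0 ∨ s'.natArr Arr.status v = 2) ∧
      t ≤ 800 * N.M + (N.n + 1) * (300 * (R + 1) + 300) := by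
  refine Runs.seq ((runs_initLabels Λ V).keeps.mono ?_)
  rintro t1 s1 ⟨⟨V1, D1, st1, C1⟩, hk1⟩
  have Λ1 := Λ.of_keeps hk1 (by decide) (by decide) (by decide)
  refine Runs.seq ((runs_deleteMin hR hn hL Λ1.zero Λ1.cap V1).keeps.mono ?_)
  rintro t2 s2 ⟨⟨K2, C2, H2⟩, hk2⟩
  have Λ2 := Λ1.of_keeps hk2 (by decide) (by decide) (by decide)
  have stat2 : s2.natArr Arr.status = s1.natArr Arr.status := hk2.natArr _ (by decide)
  have D2 : HasLabels N (sources s) Set.univ s2 := by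
    have h1 : s2.realArr RArr.dist = s1.realArr RArr.dist := K2
    have h2 : s2.natArr Arr.pe = s1.natArr Arr.pe := hk2.natArr _ (by decide)
    have h3 : s2.natArr Arr.pv = s1.natArr Arr.pv := hk2.natArr _ (by decide)
    rw [HasLabels, stat2, h1, h2, h3]
    exact D1
  let f : ℕ → ℕ := fun v => 800 * N.deg v N.M + (300 * (R + 1) + 100)
  -- The total charge of the settled vertices; it turns the number of rounds into a bound that
  -- depends only on the statuses.
  let W : (ℕ → ℕ) → ℕ := fun st => ∑ v ∈ (Finset.range N.n).filter fun v => st v = 2, f v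
  have Wle : ∀ st, W st ≤ 800 * N.M + N.n * (300 * (R + 1) + 100) := by
    intro st
    refine (Finset.sum_le_sum_of_subset (Finset.filter_subset _ _)).trans ?_
    rw [Finset.sum_add_distrib, ← Finset.mul_sum, N.sum_deg, Finset.sum_const, Finset.card_range,
      smul_eq_mul]
  have W0 : W (s1.natArr Arr.status) = 0 := by
    simp only [W]
    rw [Finset.filter_eq_empty_iff.2, Finset.sum_empty]
    exact fun v hv => st1 v (Finset.mem_range.1 hv)
  have Wstep : ∀ (st st' : ℕ → ℕ) (u : ℕ), u < N.n → st u = 1 →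
      (∀ w, st' w = 2 ↔ update st u 2 w = 2) → W st' = W st + f u := by
    intro st st' u hun hu h
    have : (Finset.range N.n).filter (fun v => st' v = 2) =
        insert u ((Finset.range N.n).filter fun v => st v = 2) := by
      ext w
      simp only [Finset.mem_insert, Finset.mem_filter, Finset.mem_range]
      rw [h]
      rcases eq_or_ne w u with rfl | hne
      · simp [hun]
      · simp [hne]
    simp only [W]
    rw [this, Finset.sum_insert (by simp [hu]), Nat.add_comm]
  -- The time `t1 + t2` already used is deducted from the budget. The truncated subtraction is
  -- harmless, because `C1` and `C2` show that the budget is at least this large.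
  refine Runs.while (fun t s' => HasLabels N (sources s) Set.univ s' ∧
      t + (heap s').potential N.n ≤ 100 * N.n + 20 * N.n + 10 + 300 * (R + 1) - (t1 + t2) +
        W (s'.natArr Arr.status) ∧
      (s'.natReg Reg.best = 0 ∧ N.inHeap (s'.natArr Arr.status) = ∅ ∧ (heap s').Valid N.n R ∅ ∨
        0 < s'.natReg Reg.best ∧ ∃ u ∈ N.inHeap (s'.natArr Arr.status), s'.natReg Reg.p = u ∧
          (∀ v ∈ N.inHeap (s'.natArr Arr.status),
            s'.realArr RArr.dist u ≤ s'.realArr RArr.dist v) ∧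
          (heap s').Valid N.n R ((N.inHeap (s'.natArr Arr.status)).erase u)))
    (100 * N.n + 20 * N.n + 10 + 300 * (R + 1) - (t1 + t2) +
      (800 * N.M + N.n * (300 * (R + 1) + 100))) ?_ ?_ ?_ ?_
  · rintro t s' ⟨-, h, -⟩
    have := Wle (s'.natArr Arr.status)
    omega
  · refine ⟨D2, ?_, ?_⟩
    · rw [stat2, W0]
      omega
    · rw [stat2]
      have h1 : s2.realArr RArr.dist = s1.realArr RArr.dist := K2
      rw [h1]
      exact H2
  · rintro t s' ⟨D, C, H⟩ hk hb
    have Λ' := Λ2.of_keeps hk (by decide) (by decide) (by decide)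
    change s'.natReg Reg.zero < s'.natReg Reg.best at hb
    rw [Λ'.zero] at hb
    obtain ⟨-, u, huA, hpu, hmin, V'⟩ := H.resolve_left fun h => by omega
    obtain ⟨hun, hu1⟩ := Finset.mem_filter.1 huA
    rw [Finset.mem_range] at hun
    refine Runs.blockSeq 6 (Runs.seq ?_)
    generalize hs3 : runList _ s' = s3
    have f1 : heap s3 = heap s' := by rw [← hs3]; rfl
    have f2 : s3.natArr Arr.status = update (s'.natArr Arr.status) u 2 := by
      rw [← hpu, ← hs3]; rfl
    have f3 : s3.natReg Reg.u = u := by rw [← hpu, ← hs3]; rfl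
    have f4 : s3.realReg RReg.du = s3.realArr RArr.dist u := by rw [← hpu, ← hs3]; rfl
    have f5 : s3.natReg Reg.h = N.prev u N.M := by
      rw [← Λ'.head u hun, ← hpu, ← hs3]; rfl
    have f6 : s3.realArr = s'.realArr := by rw [← hs3]; rfl
    have f7 : s3.natArr Arr.pe = s'.natArr Arr.pe := by rw [← hs3]; rfl
    have f8 : s3.natArr Arr.pv = s'.natArr Arr.pv := by rw [← hs3]; rfl
    have Λ3 : Loaded N R s3 := by
      refine Λ'.of_keeps (p := block [natMove Reg.u Reg.p, natConst Reg.c 2,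
        natStore Arr.status Reg.u Reg.c, realLoad RReg.du RArr.dist Reg.u,
        natLoad Reg.h Arr.head Reg.u]) (hs3 ▸ (exec_block _ _).keeps) (by decide) (by decide)
        (by decide)
    have D3 : HasLabels N (sources s) {h | N.src h ≠ u} s3 := by
      rw [HasLabels, f2, f6, f7, f8]
      exact D.settle hun hu1 fun v hv hv1 =>
        hmin v (Finset.mem_filter.2 ⟨Finset.mem_range.2 hv, hv1⟩)
    have V3 : (heap s3).Valid N.n R (N.inHeap (s3.natArr Arr.status)) := by
      rw [f1, f2, inHeap_settle]
      exact V'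
    refine (runs_relaxLoop Λ3 f3 f5 f4 V3 D3 (by rw [f2, update_self]) ?_).keeps.mono ?_
    · intro w hw hw2
      rw [f6]
      rw [f2] at hw2
      rcases eq_or_ne w u with rfl | hne
      · exact le_rfl
      · rw [update_of_ne hne] at hw2
        exact D.settled_le w hw u hun hw2 hu1
    rintro t4 s4 ⟨⟨V4, D4, st4, C4⟩, hk4⟩
    have Λ4 := Λ3.of_keeps hk4 (by decide) (by decide) (by decide)
    refine (runs_deleteMin hR hn hL Λ4.zero Λ4.cap V4).keeps.mono ?_
    rintro t5 s5 ⟨⟨K5, C5, H5⟩, hk5⟩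
    have stat5 : s5.natArr Arr.status = s4.natArr Arr.status := hk5.natArr _ (by decide)
    have h1 : s5.realArr RArr.dist = s4.realArr RArr.dist := K5
    have h2 : s5.natArr Arr.pe = s4.natArr Arr.pe := hk5.natArr _ (by decide)
    have h3 : s5.natArr Arr.pv = s4.natArr Arr.pv := hk5.natArr _ (by decide)
    refine ⟨?_, ?_, ?_⟩
    · rw [HasLabels, stat5, h1, h2, h3]
      exact D4
    · have h4 := Wstep (s'.natArr Arr.status) (s4.natArr Arr.status) u hun hu1 fun w => by
        rw [st4, f2]
      rw [stat5, h4]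
      rw [f1] at C4
      simp only [f]
      omega
    · rw [stat5, h1]
      exact H5
  · rintro t s' ⟨D, C, H⟩ hk hb
    have Λ' := Λ2.of_keeps hk (by decide) (by decide) (by decide)
    change ¬ s'.natReg Reg.zero < s'.natReg Reg.best at hb
    rw [Λ'.zero] at hb
    obtain ⟨-, hA, V'⟩ := H.resolve_right fun h => by omega
    have h3 := Wle (s'.natArr Arr.status)
    refine ⟨V', D, fun v hv => ?_, ?_⟩
    · have h1 := D.st_le v hv
      have h2 : v ∉ N.inHeap (s'.natArr Arr.status) := by rw [hA]; simp
      simp only [Net.inHeap, Finset.mem_filter, Finset.mem_range, not_and] at h2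
      have := h2 hv
      omega
    · rw [Nat.add_mul, Nat.mul_add, Nat.one_mul]
      rw [Nat.mul_add] at h3
      omega

end RAM

/-! ### Preparation of the memory -/

namespace Net

open Function

/-- The linked lists of the arcs before `j`. -/
structure Lists (N : Net) (j : ℕ) (tgt edg head next : ℕ → ℕ) : Prop where
  tgt_eq : ∀ a < j, tgt a = N.tgt a
  edg_eq : ∀ a < j, edg a = N.edg a
  next_eq : ∀ a < j, next a = N.prev (N.src a) a
  head_eq : ∀ u, head u = N.prev u j

/-- The arc `j` is prepended to the list of its source. Its successor is the old head, and pointers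
are shifted by one so that 0 can mean the end of a list. -/
theorem Lists.succ {N : Net} {j : ℕ} {tgt edg head next : ℕ → ℕ} (Λ : N.Lists j tgt edg head next) :
    N.Lists (j + 1) (update tgt j (N.tgt j)) (update edg j (N.edg j))
      (update head (N.src j) (j + 1)) (update next j (head (N.src j))) where
  tgt_eq a ha := by
    rcases eq_or_ne a j with rfl | hne
    · simp
    · rw [update_of_ne hne]; exact Λ.tgt_eq a (by omega)
  edg_eq a ha := by
    rcases eq_or_ne a j with rfl | hne
    · simp
    · rw [update_of_ne hne]; exact Λ.edg_eq a (by omega)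
  next_eq a ha := by
    rcases eq_or_ne a j with rfl | hne
    · simp [Λ.head_eq]
    · rw [update_of_ne hne]; exact Λ.next_eq a (by omega)
  head_eq u := by
    rcases eq_or_ne u (N.src j) with rfl | hne
    · simp [prev]
    · rw [update_of_ne hne, Λ.head_eq, prev, if_neg hne.symm]

end Net

namespace RobustSP

theorem toArr_of_lt {α : Type} [Zero α] {l : ℕ} (f : Fin l → α) {j : ℕ} (h : j < l) :
    toArr f j = f ⟨j, h⟩ := dif_pos h

/-- The arcs of an instance: the edge `e` gives the arcs `2 * e` and `2 * e + 1`. -/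
noncomputable def net (I : RobustSP) : Net where
  n := I.n
  M := 2 * I.m
  src h := if h % 2 = 0 then toArr (fun e => (I.fst e : ℕ)) (h / 2)
    else toArr (fun e => (I.snd e : ℕ)) (h / 2)
  tgt h := if h % 2 = 0 then toArr (fun e => (I.snd e : ℕ)) (h / 2)
    else toArr (fun e => (I.fst e : ℕ)) (h / 2)
  edg h := h / 2
  len := toArr I.len
  src_lt h hh := by
    rw [toArr_of_lt _ (by omega), toArr_of_lt _ (by omega)]
    split_ifs
    · exact (I.fst _).2
    · exact (I.snd _).2
  tgt_lt h hh := by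
    rw [toArr_of_lt _ (by omega), toArr_of_lt _ (by omega)]
    split_ifs
    · exact (I.snd _).2
    · exact (I.fst _).2
  len_pos h hh := by
    rw [toArr_of_lt _ (by omega)]
    exact I.len_pos _

theorem n_pos (I : RobustSP) : 0 < I.n := I.root.pos

end RobustSP

namespace RAM

open Instr Program Test Heap Function

namespace Reg
abbrev j := 26
abbrev lim := 27
end Reg

/-- Set `cap` to twice the number of binary digits of `n`. -/
def setCap : Program :=
  seq (block [natConst Reg.i 0, natConst Reg.j 0, natConst Reg.lim 1, natConst Reg.cap 0]) <|
  .while (natLT Reg.i Reg.n) <|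
    seq (block [natSucc Reg.i, natSucc Reg.j, natSucc Reg.j]) <|
    ite (natEq Reg.i Reg.lim) (block [natMove Reg.lim Reg.j, natSucc Reg.cap, natSucc Reg.cap]) .skip

/-- The machine cannot multiply. The value 2i is kept up to date by two increments per round, and
when i catches up with the current power 2^L, that value is the next power. The upper bound 2^L ≤ 2n
later turns L into a multiple of log n. -/
theorem runs_setCap {s : State} {n : ℕ} (hn : s.natReg Reg.n = n) (hpos : 0 < n) :
    Runs setCap s fun t s' => ∃ L, s'.natReg Reg.cap = 2 * L ∧ 0 < L ∧ n < 2 ^ L ∧ 2 ^ L ≤ 2 * n ∧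
      t ≤ 20 * n + 10 := by
  refine Runs.blockSeq 5 ?_
  generalize hs1 : runList _ s = s1
  have e1 : s1.natReg Reg.n = n := by rw [← hs1]; exact hn
  refine Runs.while (fun t s' => ∃ i L, s'.natReg Reg.i = i ∧ s'.natReg Reg.j = 2 * i ∧
      s'.natReg Reg.lim = 2 ^ L ∧ s'.natReg Reg.cap = 2 * L ∧ i < 2 ^ L ∧ i ≤ n ∧
      (i = 0 ∧ L = 0 ∨ 2 ^ L ≤ 2 * i) ∧ t ≤ 20 * i) (20 * n) ?_ ?_ ?_ ?_
  · rintro t s' ⟨i, L, h⟩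
    omega
  · refine ⟨0, 0, ?_, ?_, ?_, ?_, by simp, by omega, .inl ⟨rfl, rfl⟩, by omega⟩ <;>
    · rw [← hs1]; rfl
  · rintro t s' ⟨i, L, h1, h2, h3, h4, h5, h6, h7, h8⟩ hk hb
    have k1 : s'.natReg Reg.n = n := (hk.natReg _ (by decide)).trans e1
    change s'.natReg Reg.i < s'.natReg Reg.n at hb
    rw [h1, k1] at hb
    refine Runs.blockSeq 4 ?_
    generalize hs2 : runList _ s' = s2
    have f1 : s2.natReg Reg.i = i + 1 := by rw [← h1, ← hs2]; rfl
    have f2 : s2.natReg Reg.j = 2 * i + 1 + 1 := by rw [← h2, ← hs2]; rfl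
    have f3 : s2.natReg Reg.lim = 2 ^ L := by rw [← h3, ← hs2]; rfl
    have f4 : s2.natReg Reg.cap = 2 * L := by rw [← h4, ← hs2]; rfl
    refine Runs.ite (fun hc => Runs.blockEnd 4 ?_) fun hc => Runs.skip ?_
    · change s2.natReg Reg.i = s2.natReg Reg.lim at hc
      rw [f1, f3] at hc
      refine ⟨i + 1, L + 1, f1, f2, ?_, ?_, ?_, by omega, .inr ?_, by omega⟩
      · change s2.natReg Reg.j = _
        rw [f2, pow_succ]
        omega
      · change s2.natReg Reg.cap + 1 + 1 = _
        omega
      · rw [pow_succ]; omega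
      · rw [pow_succ]; omega
    · change ¬ s2.natReg Reg.i = s2.natReg Reg.lim at hc
      rw [f1, f3] at hc
      refine ⟨i + 1, L, f1, f2, f3, f4, by omega, by omega, .inr ?_, by omega⟩
      rcases h7 with ⟨rfl, rfl⟩ | h7
      · simp
      · omega
  · rintro t s' ⟨i, L, h1, h2, h3, h4, h5, h6, h7, h8⟩ hk hb
    have k1 : s'.natReg Reg.n = n := (hk.natReg _ (by decide)).trans e1
    change ¬ s'.natReg Reg.i < s'.natReg Reg.n at hb
    rw [h1, k1] at hb
    obtain rfl : i = n := by omega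
    refine ⟨L, h4, Nat.pos_of_ne_zero ?_, h5, by omega, by omega⟩
    rintro rfl
    simp at h5
    omega

/-- Set `top v` to `v * cap` for all `v < n`. -/
def setTop : Program :=
  seq (block [natConst Reg.i 0, natConst Reg.j 0]) <|
  .while (natLT Reg.i Reg.n) <|
    seq (block [natStore Arr.top Reg.i Reg.j, natConst Reg.c 0]) <|
    seq (.while (natLT Reg.c Reg.cap) (block [natSucc Reg.j, natSucc Reg.c])) <|
    block [natSucc Reg.i]

/-- The products v·R are produced by R increments per vertex. This takes O(nR) steps, no more than
the order of one run of Dijkstra's algorithm. -/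
theorem runs_setTop {s : State} {n R : ℕ} (hn : s.natReg Reg.n = n) (hR : s.natReg Reg.cap = R) :
    Runs setTop s fun t s' => (∀ v < n, s'.natArr Arr.top v = v * R) ∧
      t ≤ (10 * R + 10) * n + 10 := by
  refine Runs.blockSeq 3 ?_
  generalize hs1 : runList _ s = s1
  have e1 : s1.natReg Reg.n = n := by rw [← hs1]; exact hn
  have e2 : s1.natReg Reg.cap = R := by rw [← hs1]; exact hR
  refine Runs.while (fun t s' => ∃ i ≤ n, s'.natReg Reg.i = i ∧ s'.natReg Reg.j = i * R ∧
      (∀ v < i, s'.natArr Arr.top v = v * R) ∧ t ≤ (10 * R + 10) * i) ((10 * R + 10) * n) ?_ ?_ ?_ ?_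
  · rintro t s' ⟨i, hi, -, -, -, h⟩
    exact h.trans (Nat.mul_le_mul_left _ hi)
  · refine ⟨0, by omega, by rw [← hs1]; rfl, ?_, fun v hv => absurd hv (by omega), by omega⟩
    rw [Nat.zero_mul, ← hs1]
    rfl
  · rintro t s' ⟨i, hi, h1, h2, h3, h4⟩ hk hb
    have k1 : s'.natReg Reg.n = n := (hk.natReg _ (by decide)).trans e1
    have k2 : s'.natReg Reg.cap = R := (hk.natReg _ (by decide)).trans e2
    change s'.natReg Reg.i < s'.natReg Reg.n at hb
    rw [h1, k1] at hb
    refine Runs.blockSeq 3 ?_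
    generalize hs2 : runList _ s' = s2
    have f1 : s2.natReg Reg.cap = R := by rw [← hs2]; exact k2
    have f2 : s2.natReg Reg.i = i := by rw [← hs2]; exact h1
    have f3 : s2.natArr Arr.top = update (s'.natArr Arr.top) i (i * R) := by
      rw [← h2, ← h1, ← hs2]; rfl
    refine Runs.seq (Runs.mono (Q := fun t s' => s'.natReg Reg.j = i * R + R ∧
      s'.natReg Reg.i = i ∧ s'.natArr Arr.top = s2.natArr Arr.top ∧ t ≤ 4 * R + 1) ?_ ?_)
    · refine Runs.while (fun t s' => s'.natReg Reg.c ≤ R ∧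
        s'.natReg Reg.j = i * R + s'.natReg Reg.c ∧ t ≤ 4 * s'.natReg Reg.c) (4 * R) ?_ ?_ ?_ ?_
      · rintro t s' h
        omega
      · have a1 : s2.natReg Reg.c = 0 := by rw [← hs2]; rfl
        have a2 : s2.natReg Reg.j = i * R := by rw [← h2, ← hs2]; rfl
        rw [a1, a2]
        omega
      · rintro t s3 ⟨g1, g2, g3⟩ hk3 hb3
        have g4 : s3.natReg Reg.cap = R := (hk3.natReg _ (by decide)).trans f1
        change s3.natReg Reg.c < s3.natReg Reg.cap at hb3
        refine Runs.blockEnd 3 ?_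
        change s3.natReg Reg.c + 1 ≤ R ∧ s3.natReg Reg.j + 1 = i * R + (s3.natReg Reg.c + 1) ∧
          _ ≤ 4 * (s3.natReg Reg.c + 1)
        omega
      · rintro t s3 ⟨g1, g2, g3⟩ hk3 hb3
        have g4 : s3.natReg Reg.cap = R := (hk3.natReg _ (by decide)).trans f1
        change ¬ s3.natReg Reg.c < s3.natReg Reg.cap at hb3
        exact ⟨by omega, (hk3.natReg _ (by decide)).trans f2, hk3.natArr _ (by decide), by omega⟩
    · rintro t3 s3 ⟨g1, g2, g3, g4⟩
      refine Runs.blockEnd 2 ⟨i + 1, by omega, ?_, ?_, ?_, ?_⟩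
      · rw [← g2]; rfl
      · rw [Nat.add_mul, Nat.one_mul, ← g1]; rfl
      · intro v hv
        change s3.natArr Arr.top v = _
        rw [g3, f3]
        rcases eq_or_ne v i with rfl | hne
        · simp
        · rw [update_of_ne hne]; exact h3 v (by omega)
      · rw [Nat.mul_add]
        omega
  · rintro t s' ⟨i, hi, h1, h2, h3, h4⟩ hk hb
    have k1 : s'.natReg Reg.n = n := (hk.natReg _ (by decide)).trans e1
    change ¬ s'.natReg Reg.i < s'.natReg Reg.n at hb
    rw [h1, k1] at hb
    obtain rfl : i = n := by omega
    exact ⟨h3, by omega⟩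

/-- Build the linked lists of arcs. -/
def setArcs : Program :=
  seq (block [natConst Reg.i 0, natConst Reg.h 0]) <|
  .while (natLT Reg.i Reg.m) <|
    block [natLoad Reg.u Arr.fst Reg.i, natLoad Reg.v Arr.snd Reg.i,
      natStore Arr.tgt Reg.h Reg.v, natStore Arr.edg Reg.h Reg.i, natLoad Reg.c Arr.head Reg.u,
      natStore Arr.next Reg.h Reg.c, natSucc Reg.h, natStore Arr.head Reg.u Reg.h,
      natStore Arr.tgt Reg.h Reg.u, natStore Arr.edg Reg.h Reg.i, natLoad Reg.c Arr.head Reg.v,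
      natStore Arr.next Reg.h Reg.c, natSucc Reg.h, natStore Arr.head Reg.v Reg.h,
      natSucc Reg.i]

theorem runs_setArcs {I : RobustSP} {s : State} (hm : s.natReg Reg.m = I.m)
    (hf : s.natArr Arr.fst = I.input.natArr Arr.fst) (hs : s.natArr Arr.snd = I.input.natArr Arr.snd)
    (hh : ∀ u, s.natArr Arr.head u = 0) :
    Runs setArcs s fun t s' => I.net.Lists (2 * I.m) (s'.natArr Arr.tgt) (s'.natArr Arr.edg)
      (s'.natArr Arr.head) (s'.natArr Arr.next) ∧ t ≤ 20 * I.m + 10 := by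
  refine Runs.blockSeq 3 ?_
  generalize hs1 : runList _ s = s1
  have e1 : s1.natReg Reg.m = I.m := by rw [← hs1]; exact hm
  have e2 : s1.natArr Arr.fst = I.input.natArr Arr.fst := by rw [← hs1]; exact hf
  have e3 : s1.natArr Arr.snd = I.input.natArr Arr.snd := by rw [← hs1]; exact hs
  refine Runs.while (fun t s' => ∃ i ≤ I.m, s'.natReg Reg.i = i ∧ s'.natReg Reg.h = 2 * i ∧
      I.net.Lists (2 * i) (s'.natArr Arr.tgt) (s'.natArr Arr.edg)
        (s'.natArr Arr.head) (s'.natArr Arr.next) ∧ t ≤ 20 * i) (20 * I.m) ?_ ?_ ?_ ?_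
  · rintro t s' ⟨i, h⟩
    omega
  · refine ⟨0, by omega, by rw [← hs1]; rfl, by rw [← hs1]; rfl, ⟨?_, ?_, ?_, ?_⟩, by omega⟩
    · intro a ha; omega
    · intro a ha; omega
    · intro a ha; omega
    · intro u
      rw [← hs1]
      exact hh u
  · rintro t s' ⟨i, hi, h1, h2, Λ, h4⟩ hk hb
    have k1 : s'.natReg Reg.m = I.m := (hk.natReg _ (by decide)).trans e1
    have k2 : s'.natArr Arr.fst i = I.input.natArr Arr.fst i := by
      rw [← e2]; exact congrFun (hk.natArr _ (by decide)) i
    have k3 : s'.natArr Arr.snd i = I.input.natArr Arr.snd i := by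
      rw [← e3]; exact congrFun (hk.natArr _ (by decide)) i
    change s'.natReg Reg.i < s'.natReg Reg.m at hb
    rw [h1, k1] at hb
    have q1 : (2 * i) % 2 = 0 := by omega
    have q2 : (2 * i) / 2 = i := by omega
    have q3 : ¬ (2 * i + 1) % 2 = 0 := by omega
    have q4 : (2 * i + 1) / 2 = i := by omega
    have r1 : I.net.src (2 * i) = s'.natArr Arr.fst i := by
      simp only [RobustSP.net, q1, q2, if_true]; rw [k2]; rfl
    have r2 : I.net.tgt (2 * i) = s'.natArr Arr.snd i := by
      simp only [RobustSP.net, q1, q2, if_true]; rw [k3]; rfl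
    have r3 : I.net.src (2 * i + 1) = s'.natArr Arr.snd i := by
      simp only [RobustSP.net, q3, q4, if_false]; rw [k3]; rfl
    have r4 : I.net.tgt (2 * i + 1) = s'.natArr Arr.fst i := by
      simp only [RobustSP.net, q3, q4, if_false]; rw [k2]; rfl
    have r5 : I.net.edg (2 * i) = i := q2
    have r6 : I.net.edg (2 * i + 1) = i := q4
    have Λ' := Λ.succ.succ
    rw [r1, r2, r3, r4, r5, r6] at Λ'
    refine Runs.blockEnd 16 ⟨i + 1, by omega, ?_, ?_, ?_, by omega⟩
    · rw [← h1]; rfl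
    · rw [Nat.mul_add, ← h2]; rfl
    · rw [← h2, ← h1] at Λ'
      rw [show 2 * (i + 1) = s'.natReg Reg.h + 1 + 1 by omega]
      exact Λ'
  · rintro t s' ⟨i, hi, h1, h2, Λ, h4⟩ hk hb
    have k1 : s'.natReg Reg.m = I.m := (hk.natReg _ (by decide)).trans e1
    change ¬ s'.natReg Reg.i < s'.natReg Reg.m at hb
    rw [h1, k1] at hb
    obtain rfl : i = I.m := by omega
    exact ⟨Λ, by omega⟩

/-- The part of the memory that holds the instance, and the data structures between two runs of
Dijkstra's algorithm. -/
structure Ready (I : RobustSP) (R : ℕ) (s : State) : Prop where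
  loaded : Loaded I.net R s
  valid : (heap s).Valid I.n R ∅
  k : s.natReg Reg.k = I.k
  root : s.natReg Reg.root = I.root
  term : s.natArr Arr.term = I.input.natArr Arr.term
  infl : s.realReg RReg.infl = I.infl

/-- Prepare the memory. -/
def setup : Program := seq setCap <| seq setTop setArcs

/-- Apart from the cell pointers, the heap needs no initialisation: arrays that are zero represent
an empty forest, an empty table and empty arc lists. -/
theorem runs_setup (I : RobustSP) :
    Runs setup I.input fun t s' => ∃ L, 0 < L ∧ I.n < 2 ^ L ∧ 2 ^ L ≤ 2 * I.n ∧
      Ready I (2 * L) s' ∧ t ≤ (20 * L + 30) * I.n + 20 * I.m + 30 := by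
  refine Runs.seq ((runs_setCap (n := I.n) rfl I.n_pos).keeps.mono ?_)
  rintro t1 s1 ⟨⟨L, c1, c2, c3, c4, c5⟩, hk1⟩
  refine Runs.seq ((runs_setTop (n := I.n) (hk1.natReg _ (by decide)) c1).keeps.mono ?_)
  rintro t2 s2 ⟨⟨d1, d2⟩, hk2⟩
  refine (runs_setArcs (I := I) ?_ ?_ ?_ ?_).keeps.mono ?_
  · rw [hk2.natReg _ (by decide), hk1.natReg _ (by decide)]; rfl
  · rw [hk2.natArr _ (by decide), hk1.natArr _ (by decide)]
  · rw [hk2.natArr _ (by decide), hk1.natArr _ (by decide)]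
  · intro u
    rw [hk2.natArr _ (by decide), hk1.natArr _ (by decide)]
    rfl
  rintro t3 s3 ⟨⟨Λ, a2⟩, hk3⟩
  have regs : ∀ x ∈ [Reg.n, Reg.k, Reg.root, Reg.zero, Reg.size],
      s3.natReg x = I.input.natReg x := by
    intro x hx
    rw [hk3.natReg x (by revert x; decide), hk2.natReg x (by revert x; decide),
      hk1.natReg x (by revert x; decide)]
  have arrs : ∀ x ∈ [Arr.par, Arr.rank, Arr.mark, Arr.tab, Arr.term],
      s3.natArr x = I.input.natArr x := by
    intro x hx
    rw [hk3.natArr x (by revert x; decide), hk2.natArr x (by revert x; decide),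
      hk1.natArr x (by revert x; decide)]
  have hreal : ∀ x, s3.realArr x = I.input.realArr x := by
    intro x
    rw [hk3.realArr x (by simp [setArcs, Program.collect, block, Instr.realArrs]),
      hk2.realArr x (by simp [setTop, Program.collect, block, Instr.realArrs]),
      hk1.realArr x (by simp [setCap, Program.collect, block, Instr.realArrs])]
  have hcap : s3.natReg Reg.cap = 2 * L := by
    rw [hk3.natReg _ (by decide), hk2.natReg _ (by decide), c1]
  have htop : ∀ v < I.n, s3.natArr Arr.top v = v * (2 * L) := by
    intro v hv
    rw [hk3.natArr _ (by decide)]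
    exact d1 v hv
  have hpar : ∀ v, (heap s3).par v = 0 := fun v => by
    change s3.natArr Arr.par v = 0
    rw [arrs _ (by simp)]; rfl
  have hrank : ∀ v, (heap s3).rank v = 0 := fun v => by
    change s3.natArr Arr.rank v = 0
    rw [arrs _ (by simp)]; rfl
  have hmark : ∀ v, (heap s3).mark v = 0 := fun v => by
    change s3.natArr Arr.mark v = 0
    rw [arrs _ (by simp)]; rfl
  have htab : ∀ v, (heap s3).tab v = 0 := fun v => by
    change s3.natArr Arr.tab v = 0
    rw [arrs _ (by simp)]; rfl
  have hns : (heap s3).ns = 0 := by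
    change s3.natReg Reg.size = 0
    rw [regs _ (by simp)]; rfl
  refine ⟨L, c2, c3, c4, ⟨⟨?_, ?_, hcap, Λ.tgt_eq, Λ.edg_eq, fun u _ => Λ.head_eq u, Λ.next_eq, ?_⟩,
    ⟨⟨?_, ?_, ?_, ?_, ?_, ?_, ?_, ?_, ?_, ?_, ?_, ⟨fun _ => 0, ?_⟩, ?_⟩, ⟨?_, ?_, ?_, ?_, ?_⟩, htab⟩,
    ?_, ?_, ?_, ?_⟩, ?_⟩
  · rw [regs _ (by simp)]; rfl
  · rw [regs _ (by simp)]; rfl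
  · intro h hh
    rw [hreal]; rfl
  · simp
  · intro v hv
    rw [hrank]
    exact htop v hv
  · exact fun v _ => hrank v
  · exact fun v _ => hpar v
  · intro v; rw [hmark]; omega
  · intro v; rw [hrank]; omega
  · intro v p h; rw [hpar] at h; omega
  · intro v p h; rw [hpar] at h; omega
  · intro v p h; rw [hpar] at h; omega
  · intro p j h; rw [hrank] at h; omega
  · intro p j h; rw [hrank] at h; omega
  · intro v p h; rw [hpar] at h; omega
  · intro v p h; rw [hpar] at h; omega
  · intro i hi; omega
  · intro i hi; omega
  · intro r y h; rw [htab] at h; omega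
  · intro x hx; simp at hx
  · intro v hv; simp at hv
  · rw [regs _ (by simp)]; rfl
  · rw [regs _ (by simp)]; rfl
  · rw [arrs _ (by simp)]
  · rw [hk3.realReg _ (by decide), hk2.realReg _ (by decide), hk1.realReg _ (by decide)]; rfl
  · have : (10 * (2 * L) + 10) * I.n = 20 * L * I.n + 10 * I.n := by ring
    have h2 : (20 * L + 30) * I.n = 20 * L * I.n + 30 * I.n := by ring
    omega

end RAM

/-! ### Walks -/

namespace RobustSP

variable {I : RobustSP}

theorem Joins.symm {e : Fin I.m} {u v : Fin I.n} (h : I.Joins e u v) : I.Joins e v u :=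
  Or.symm h

theorem Joins.right_unique {e : Fin I.m} {u v w : Fin I.n} (h : I.Joins e u v)
    (h' : I.Joins e u w) : v = w := by
  rcases h with ⟨rfl, rfl⟩ | ⟨rfl, rfl⟩ <;> rcases h' with ⟨h1, h2⟩ | ⟨h1, h2⟩ <;> simp_all

theorem IsWalk.append {u v x : Fin I.n} {p q : List (Fin I.m)} (hp : I.IsWalk u v p)
    (hq : I.IsWalk v x q) : I.IsWalk u x (p ++ q) := by
  induction hp with
  | nil => exact hq
  | cons h _ ih => exact .cons h (ih hq)

theorem IsWalk.single {u v : Fin I.n} {e : Fin I.m} (h : I.Joins e u v) : I.IsWalk u v [e] :=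
  .cons h (.nil v)

theorem IsWalk.reverse {u v : Fin I.n} {p : List (Fin I.m)} (hp : I.IsWalk u v p) :
    I.IsWalk v u p.reverse := by
  induction hp with
  | nil => exact .nil _
  | cons h _ ih =>
    rw [List.reverse_cons]
    exact ih.append (.single h.symm)

theorem IsWalk.split {u x : Fin I.n} {p q : List (Fin I.m)} (h : I.IsWalk u x (p ++ q)) :
    ∃ v, I.IsWalk u v p ∧ I.IsWalk v x q := by
  induction p generalizing u with
  | nil => exact ⟨u, .nil u, h⟩
  | cons e p ih =>
    cases h with
    | cons h1 h2 =>
      obtain ⟨v, h3, h4⟩ := ih h2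
      exact ⟨v, .cons h1 h3, h4⟩

theorem walkLen_nil (F : Finset (Fin I.m)) : I.walkLen F [] = 0 := rfl

theorem walkLen_cons (F : Finset (Fin I.m)) (e : Fin I.m) (p : List (Fin I.m)) :
    I.walkLen F (e :: p) = (if e ∈ F then 0 else I.len e) + I.walkLen F p := by
  simp [walkLen]

theorem walkLen_append (F : Finset (Fin I.m)) (p q : List (Fin I.m)) :
    I.walkLen F (p ++ q) = I.walkLen F p + I.walkLen F q := by
  simp [walkLen]

theorem walkLen_reverse (F : Finset (Fin I.m)) (p : List (Fin I.m)) :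
    I.walkLen F p.reverse = I.walkLen F p := by
  simp [walkLen, List.sum_reverse]

theorem edgeLen_nonneg (F : Finset (Fin I.m)) (e : Fin I.m) :
    0 ≤ if e ∈ F then 0 else I.len e := by
  split_ifs
  · exact le_rfl
  · exact (I.len_pos e).le

theorem walkLen_nonneg (F : Finset (Fin I.m)) (p : List (Fin I.m)) : 0 ≤ I.walkLen F p := by
  refine List.sum_nonneg fun x hx => ?_
  obtain ⟨e, -, rfl⟩ := List.mem_map.1 hx
  exact edgeLen_nonneg F e

theorem walkLen_sublist (F : Finset (Fin I.m)) {p q : List (Fin I.m)} (h : p.Sublist q) :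
    I.walkLen F p ≤ I.walkLen F q := by
  induction h with
  | slnil => exact le_rfl
  | cons e _ ih =>
    rw [walkLen_cons]
    have := edgeLen_nonneg F e
    linarith
  | cons_cons e _ ih =>
    rw [walkLen_cons, walkLen_cons]
    linarith

theorem walkLen_le (F : Finset (Fin I.m)) (p : List (Fin I.m)) :
    I.walkLen F p ≤ I.walkLen ∅ p := by
  induction p with
  | nil => exact le_rfl
  | cons e p ih =>
    rw [walkLen_cons, walkLen_cons]
    have := (I.len_pos e).le
    simp only [Finset.notMem_empty, if_false]
    split_ifs <;> linarith

theorem walkLen_eq_zero {F : Finset (Fin I.m)} {p : List (Fin I.m)} (h : ∀ e ∈ p, e ∈ F) :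
    I.walkLen F p = 0 := by
  induction p with
  | nil => rfl
  | cons e p ih =>
    rw [walkLen_cons, if_pos (h e (by simp)), ih fun e' he' => h e' (by simp [he']), add_zero]

/-- A walk can be shortened to one that uses no edge twice. -/
theorem IsWalk.exists_nodup {u x : Fin I.n} {p : List (Fin I.m)} (hp : I.IsWalk u x p) :
    ∃ q, I.IsWalk u x q ∧ q.Nodup ∧ q.Sublist p := by
  induction hp with
  | nil u => exact ⟨[], .nil u, List.nodup_nil, List.Sublist.refl _⟩
  | @cons u v x e p h _ ih =>
    obtain ⟨q, h1, h2, h3⟩ := ih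
    by_cases he : e ∈ q
    -- If the first edge recurs, everything before the recurrence is cut out. When both passages
    -- have the same direction one copy of the edge remains; when they are opposite, or the edge is
    -- a loop, either both copies can go or one remains.
    · obtain ⟨a, b, rfl⟩ := List.append_of_mem he
      obtain ⟨y, h4, h5⟩ := h1.split
      have hb : (e :: b).Sublist (e :: p) :=
        ((List.sublist_append_right a (e :: b)).trans h3).trans (List.sublist_cons_self e p)
      have hnd : (e :: b).Nodup := h2.of_append_right
      cases h5 with
      | @cons _ z _ _ _ h6 h7 =>
        rcases h with ⟨h8, h9⟩ | ⟨h8, h9⟩ <;> rcases h6 with ⟨h10, h11⟩ | ⟨h10, h11⟩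
        · obtain rfl : y = u := h10.symm.trans h8
          exact ⟨e :: b, .cons (.inl ⟨h10, h11⟩) h7, hnd, hb⟩
        · obtain rfl : z = u := h10.symm.trans h8
          exact ⟨b, h7, (List.nodup_cons.1 hnd).2, (List.sublist_cons_self e b).trans hb⟩
        · obtain rfl : z = u := h11.symm.trans h9
          exact ⟨b, h7, (List.nodup_cons.1 hnd).2, (List.sublist_cons_self e b).trans hb⟩
        · obtain rfl : y = u := h11.symm.trans h9
          exact ⟨e :: b, .cons (.inr ⟨h10, h11⟩) h7, hnd, hb⟩
    · exact ⟨e :: q, .cons h h1, List.nodup_cons.2 ⟨he, h2⟩, h3.cons_cons e⟩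

/-- A shortest walk from a set of sources exists. -/
theorem exists_min_walk (F : Finset (Fin I.m)) {S : Set (Fin I.n)} {v : Fin I.n}
    (h : ∃ a ∈ S, ∃ p, I.IsWalk a v p) :
    ∃ a ∈ S, ∃ p, I.IsWalk a v p ∧
      ∀ b ∈ S, ∀ q, I.IsWalk b v q → I.walkLen F p ≤ I.walkLen F q := by
  -- The minimum exists because it suffices to compare walks without repeated edges, and there are
  -- only finitely many of them.
  have hfin : {q : List (Fin I.m) | q.Nodup}.Finite :=
    Set.finite_coe_iff.1 (inferInstanceAs (Finite {q : List (Fin I.m) // q.Nodup}))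
  obtain ⟨a, ha, p, hp⟩ := h
  obtain ⟨q, hq, hnd, -⟩ := hp.exists_nodup
  obtain ⟨q₀, ⟨h1, b, hb, h2⟩, h3⟩ := Set.exists_min_image
    {q : List (Fin I.m) | q.Nodup ∧ ∃ a ∈ S, I.IsWalk a v q} (I.walkLen F)
    (hfin.subset fun q hq => hq.1) ⟨q, hnd, a, ha, hq⟩
  refine ⟨b, hb, q₀, h2, fun c hc q' hq' => ?_⟩
  obtain ⟨q'', h4, h5, h6⟩ := hq'.exists_nodup
  exact (h3 q'' ⟨h5, c, hc, h4⟩).trans (walkLen_sublist F h6)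

/-! ### Distances computed by Dijkstra's algorithm -/

theorem joins_of_arc {h : ℕ} (hh : h < I.net.M) : ∃ (e : Fin I.m) (u v : Fin I.n),
    I.net.edg h = e ∧ I.net.src h = u ∧ I.net.tgt h = v ∧ I.Joins e u v ∧
      I.net.len (I.net.edg h) = I.len e := by
  have hm : h / 2 < I.m := by
    change h < 2 * I.m at hh
    omega
  have hl : I.net.len (I.net.edg h) = I.len ⟨h / 2, hm⟩ := toArr_of_lt _ hm
  by_cases h0 : h % 2 = 0
  · exact ⟨⟨h / 2, hm⟩, I.fst ⟨h / 2, hm⟩, I.snd ⟨h / 2, hm⟩, rfl,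
      by simp only [net, h0, if_true]; exact toArr_of_lt _ hm,
      by simp only [net, h0, if_true]; exact toArr_of_lt _ hm, .inl ⟨rfl, rfl⟩, hl⟩
  · exact ⟨⟨h / 2, hm⟩, I.snd ⟨h / 2, hm⟩, I.fst ⟨h / 2, hm⟩, rfl,
      by simp only [net, h0, if_false]; exact toArr_of_lt _ hm,
      by simp only [net, h0, if_false]; exact toArr_of_lt _ hm, .inr ⟨rfl, rfl⟩, hl⟩

theorem Joins.exists_arc {e : Fin I.m} {u v : Fin I.n} (h : I.Joins e u v) :
    ∃ a < I.net.M, I.net.src a = u ∧ I.net.tgt a = v ∧ I.net.len (I.net.edg a) = I.len e := by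
  have q1 : (2 * (e : ℕ)) % 2 = 0 := by omega
  have q2 : (2 * (e : ℕ)) / 2 = e := by omega
  have q3 : ¬ (2 * (e : ℕ) + 1) % 2 = 0 := by omega
  have q4 : (2 * (e : ℕ) + 1) / 2 = e := by omega
  have he := e.2
  rcases h with ⟨rfl, rfl⟩ | ⟨rfl, rfl⟩
  · refine ⟨2 * e, by change _ < 2 * I.m; omega, ?_, ?_, ?_⟩
    · simp only [net, q1, q2, if_true]; exact toArr_of_lt _ he
    · simp only [net, q1, q2, if_true]; exact toArr_of_lt _ he
    · simp only [net, q2]; exact toArr_of_lt _ he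
  · refine ⟨2 * e + 1, by change _ < 2 * I.m; omega, ?_, ?_, ?_⟩
    · simp only [net, q3, q4, if_false]; exact toArr_of_lt _ he
    · simp only [net, q3, q4, if_false]; exact toArr_of_lt _ he
    · simp only [net, q4]; exact toArr_of_lt _ he

/-- The distances from the set `S` and the edges of a forest of shortest paths. -/
structure Distances (I : RobustSP) (S : Set (Fin I.n)) (st : ℕ → ℕ) (dist : ℕ → ℝ)
    (pe pv : ℕ → ℕ) : Prop where
  reached : ∀ a ∈ S, ∀ v p, I.IsWalk a v p → st v ≠ 0 ∧ dist v ≤ I.walkLen ∅ p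
  tree : ∀ v : Fin I.n, st v ≠ 0 → v ∈ S ∨ ∃ (u : Fin I.n) (e : Fin I.m), I.Joins e u v ∧
    st u ≠ 0 ∧ pe v = e ∧ pv v = u ∧ dist v = dist u + I.len e
  walk : ∀ v : Fin I.n, st v ≠ 0 → ∃ a ∈ S, ∃ p, I.IsWalk a v p ∧ I.walkLen ∅ p = dist v

/-- When nothing is left in the heap, every reached vertex is settled and all its arcs are relaxed,
so labels are at most walk lengths by induction along the walk. Conversely, following tree arcs back
to a source produces a walk of exactly the length of the label. -/
theorem distances_of_labels {S : Set ℕ} {st : ℕ → ℕ} {dist : ℕ → ℝ} {pe pv : ℕ → ℕ}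
    (Λ : I.net.Labels S Set.univ st dist pe pv) (hst : ∀ v < I.n, st v = 0 ∨ st v = 2) :
    I.Distances {v | (v : ℕ) ∈ S} st dist pe pv := by
  have htree : ∀ v : Fin I.n, st v ≠ 0 → (v : ℕ) ∈ S ∨ ∃ (u : Fin I.n) (e : Fin I.m),
      I.Joins e u v ∧ st u ≠ 0 ∧ pe v = e ∧ pv v = u ∧ dist v = dist u + I.len e := by
    intro v hv
    refine (Λ.tree v v.2 hv).imp id ?_
    rintro ⟨a, ha, h1, h2, h3, h4, h5⟩
    obtain ⟨e, u, w, g1, g2, g3, g4, g5⟩ := joins_of_arc ha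
    obtain rfl : w = v := Fin.ext (g3.symm.trans h1)
    refine ⟨u, e, g4, ?_, h3.trans g1, h4.trans g2, ?_⟩
    · rw [← g2]; omega
    · rw [h5, g5, g2]
  refine ⟨fun a ha v p hp => ?_, htree, fun v => ?_⟩
  · suffices H : ∀ u v p, I.IsWalk u v p → st u ≠ 0 →
        st v ≠ 0 ∧ dist v ≤ dist u + I.walkLen ∅ p by
      obtain ⟨h1, h2⟩ := Λ.source a a.2 ha
      have := H a v p hp h1
      rwa [h2, zero_add] at this
    clear hp
    intro u v p hp
    induction hp with
    | nil u =>
      intro h0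
      rw [walkLen_nil, add_zero]
      exact ⟨h0, le_rfl⟩
    | @cons u v x e p h _ ih =>
      intro h0
      obtain ⟨a, ha, h1, h2, h3⟩ := h.exists_arc
      obtain ⟨h4, h5⟩ := Λ.relaxed a ha trivial (by
        rw [h1]; exact (hst u u.2).resolve_left h0)
      rw [h1, h2, h3] at h5
      rw [h2] at h4
      obtain ⟨h6, h7⟩ := ih h4
      refine ⟨h6, ?_⟩
      rw [walkLen_cons, if_neg (Finset.notMem_empty e)]
      linarith
  -- Edge lengths are positive, so labels strictly decrease along tree arcs; on a finite vertex set
  -- this is well-founded.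
  · have hwf : WellFounded fun u v : Fin I.n => dist u < dist v :=
      Finite.wellFounded_of_trans_of_irrefl (r := InvImage (· < ·) fun v : Fin I.n => dist v)
    induction v using hwf.induction with
    | _ v ih =>
      intro hv
      rcases htree v hv with h | ⟨u, e, h1, h2, h3, h4, h5⟩
      · exact ⟨v, h, [], .nil v, by rw [walkLen_nil, (Λ.source v v.2 h).2]⟩
      · obtain ⟨a, ha, p, hp, hl⟩ := ih u (by have := I.len_pos e; linarith) h2
        refine ⟨a, ha, p ++ [e], hp.append (.single h1), ?_⟩
        rw [walkLen_append, hl, walkLen_cons, walkLen_nil, if_neg (Finset.notMem_empty e), h5,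
          add_zero]

/-! ### Attaching points one after the other -/

/-- Two points that are joined by an element of `H`. -/
def Linked (H : List (Fin I.n × Fin I.n × ℝ)) (u v : Fin I.n) : Prop :=
  ∃ f ∈ H, (f.1 = u ∧ f.2.1 = v) ∨ (f.1 = v ∧ f.2.1 = u)

theorem Linked.symm {H : List (Fin I.n × Fin I.n × ℝ)} {u v : Fin I.n} (h : Linked H u v) :
    Linked H v u := by
  obtain ⟨f, hf, h⟩ := h
  exact ⟨f, hf, h.symm⟩

/-- The points in `N` can be attached to `V` by connections between points of `V ∪ N` whose total
length is at most `L`. -/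
def Attach (I : RobustSP) (V N : Set (Fin I.n)) (L : ℝ) : Prop :=
  ∃ H : List (Fin I.n × Fin I.n × ℝ),
    (∀ f ∈ H, f.1 ∈ V ∪ N ∧ f.2.1 ∈ V ∪ N ∧ ∃ p, I.IsWalk f.1 f.2.1 p ∧ I.walkLen ∅ p ≤ f.2.2) ∧
    (∀ t ∈ N, ∃ a ∈ V, Relation.ReflTransGen (Linked H) t a) ∧ (H.map fun f => f.2.2).sum ≤ L

theorem Attach.nonneg {V N : Set (Fin I.n)} {L : ℝ} (h : I.Attach V N L) : 0 ≤ L := by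
  obtain ⟨H, h1, -, h2⟩ := h
  refine le_trans (List.sum_nonneg fun x hx => ?_) h2
  obtain ⟨f, hf, rfl⟩ := List.mem_map.1 hx
  obtain ⟨p, -, hp⟩ := (h1 f hf).2.2
  exact (walkLen_nonneg ∅ p).trans hp

/-- Attach the point of `N` that is closest to `V` first. -/
theorem Attach.step {V N V' N' : Set (Fin I.n)} {L x : ℝ} {t : Fin I.n} (h : I.Attach V N L)
    (ht : t ∈ N) (hx : ∀ u ∈ N, ∀ a ∈ V, ∀ p, I.IsWalk a u p → x ≤ I.walkLen ∅ p)
    (hV : insert t V ⊆ V') (hN : N ⊆ insert t N') (hN' : N' ⊆ N) :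
    I.Attach V' N' (L - x) := by
  classical
  obtain ⟨H, h1, h2, h3⟩ := h
  have hVN : ∀ u ∈ V ∪ N, u ∈ V' ∪ N' := by
    rintro u (hu | hu)
    · exact .inl (hV (.inr hu))
    · rcases hN hu with rfl | hu
      · exact .inl (hV (.inl rfl))
      · exact .inr hu
  -- In this degenerate case the empty walk shows x ≤ 0 and nothing has to be removed.
  by_cases htV : t ∈ V
  · refine ⟨H, fun f hf => ⟨hVN _ (h1 f hf).1, hVN _ (h1 f hf).2.1, (h1 f hf).2.2⟩,
      fun u hu => ?_, ?_⟩
    · obtain ⟨a, ha, hua⟩ := h2 u (hN' hu)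
      exact ⟨a, hV (.inr ha), hua⟩
    · have := hx t ht t htV [] (.nil t)
      rw [walkLen_nil] at this
      linarith
  obtain ⟨a₀, ha₀, hta⟩ := h2 t ht
  -- Follow the links from `u` until they enter `V` for the first time, through `f` from `y` to `b`.
  -- All points up to `y` lie outside `V`, so this initial stretch does not use `f` and survives its
  -- removal.
  have key : ∀ u, Relation.ReflTransGen (Linked H) u a₀ → u ∉ V → ∃ f ∈ H, ∃ y b, b ∈ V ∧ y ∉ V ∧
      ((f.1 = y ∧ f.2.1 = b) ∨ (f.1 = b ∧ f.2.1 = y)) ∧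
      Relation.ReflTransGen (Linked (H.erase f)) u y := by
    intro u hu
    induction hu using Relation.ReflTransGen.head_induction_on with
    | refl => exact fun h => absurd ha₀ h
    | @head u w huw _ ih =>
      intro huV
      by_cases hwV : w ∈ V
      · obtain ⟨f, hf, hfuw⟩ := huw
        exact ⟨f, hf, u, w, hwV, huV, hfuw, .refl⟩
      · obtain ⟨f, hf, y, b, hb, hy, hfyb, hwy⟩ := ih hwV
        refine ⟨f, hf, y, b, hb, hy, hfyb, .head ?_ hwy⟩
        obtain ⟨g, hg, hguw⟩ := huw
        refine ⟨g, (List.mem_erase_of_ne ?_).2 hg, hguw⟩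
        rintro rfl
        rcases hfyb with ⟨h4, h5⟩ | ⟨h4, h5⟩ <;> rcases hguw with ⟨h6, h7⟩ | ⟨h6, h7⟩
        · exact hwV (h7 ▸ h5 ▸ hb)
        · exact huV (h7 ▸ h5 ▸ hb)
        · exact huV (h6 ▸ h4 ▸ hb)
        · exact hwV (h6 ▸ h4 ▸ hb)
  obtain ⟨f, hf, y, b, hb, hy, hfyb, hty⟩ := key t hta htV
  have hsymm : ∀ u v, Relation.ReflTransGen (Linked (H.erase f)) u v →
      Relation.ReflTransGen (Linked (H.erase f)) v u := by
    intro u v huv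
    induction huv with
    | refl => exact .refl
    | tail _ h ih => exact .head h.symm ih
  refine ⟨H.erase f, fun g hg => ?_, fun u hu => ?_, ?_⟩
  · have hg := List.mem_of_mem_erase hg
    exact ⟨hVN _ (h1 g hg).1, hVN _ (h1 g hg).2.1, (h1 g hg).2.2⟩
  · obtain ⟨a, ha, hua⟩ := h2 u (hN' hu)
    clear hu
    induction hua using Relation.ReflTransGen.head_induction_on with
    | refl => exact ⟨a, hV (.inr ha), .refl⟩
    | @head u w huw _ ih =>
      obtain ⟨c, hc, hwc⟩ := ih
      obtain ⟨g, hg, hguw⟩ := huw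
      -- A path that used the removed link is repaired at once: one end of the link lies in `V`, and
      -- the other is still linked to `t`, which now counts as connected.
      by_cases hgf : g = f
      · subst hgf
        have : u = b ∨ u = y := by
          rcases hfyb with ⟨h4, h5⟩ | ⟨h4, h5⟩ <;> rcases hguw with ⟨h6, h7⟩ | ⟨h6, h7⟩
          · exact .inr (h6.symm.trans h4)
          · exact .inl (h7.symm.trans h5)
          · exact .inl (h6.symm.trans h4)
          · exact .inr (h7.symm.trans h5)
        rcases this with rfl | rfl
        · exact ⟨u, hV (.inr hb), .refl⟩
        · exact ⟨t, hV (.inl rfl), hsymm _ _ hty⟩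
      · exact ⟨c, hc, .head ⟨g, (List.mem_erase_of_ne hgf).2 hg, hguw⟩ hwc⟩
  · have hsum := ((List.perm_cons_erase hf).map fun f => f.2.2).sum_eq
    rw [List.map_cons, List.sum_cons] at hsum
    obtain ⟨h4, h5, p, hp, hpl⟩ := h1 f hf
    -- The end `y` is outside `V`, hence in `N`. So the removed link joins `V` to `N` and is at
    -- least as long as the shortest such connection.
    have hxf : x ≤ f.2.2 := by
      rcases hfyb with ⟨h6, h7⟩ | ⟨h6, h7⟩
      · rw [h6] at h4 hp
        rw [h7] at hp
        have := hx y (h4.resolve_left hy) b hb _ hp.reverse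
        rw [walkLen_reverse] at this
        linarith
      · rw [h6] at hp
        rw [h7] at h5 hp
        exact (hx y (h5.resolve_left hy) b hb p hp).trans hpl
    linarith

/-- The points on a walk can be attached to its start. -/
theorem IsWalk.exists_links {V N : Set (Fin I.n)} {u x : Fin I.n} {p : List (Fin I.m)}
    (hp : I.IsWalk u x p) :
    ∀ a ∈ V ∪ N, ∀ q, I.IsWalk a u q → ∃ H : List (Fin I.n × Fin I.n × ℝ),
      (∀ f ∈ H, f.1 ∈ V ∪ N ∧ f.2.1 ∈ V ∪ N ∧ ∃ p, I.IsWalk f.1 f.2.1 p ∧ I.walkLen ∅ p ≤ f.2.2) ∧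
      (∀ p₁ p₂ v, p = p₁ ++ p₂ → I.IsWalk u v p₁ → v ∈ N →
        Relation.ReflTransGen (Linked H) v a) ∧
      (H.map fun f => f.2.2).sum ≤ I.walkLen ∅ q + I.walkLen ∅ p := by
  -- Here `a` is the starting point or the last point of `N` that was met, and `q` is the piece of
  -- the walk since then. A link of length `q` is emitted when the next point of `N` is met.
  induction hp with
  | nil u =>
    intro a ha q hq
    by_cases hu : u ∈ N
    · refine ⟨[(a, u, I.walkLen ∅ q)], ?_, ?_, ?_⟩
      · intro f hf
        obtain rfl := List.mem_singleton.1 hf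
        exact ⟨ha, .inr hu, q, hq, le_rfl⟩
      · intro p₁ p₂ v hp hv _
        obtain ⟨rfl, -⟩ := List.append_eq_nil_iff.1 hp.symm
        cases hv
        exact .single ⟨_, List.mem_singleton_self _, .inr ⟨rfl, rfl⟩⟩
      · simp [walkLen_nil]
    · refine ⟨[], by simp, ?_, ?_⟩
      · intro p₁ p₂ v hp hv hvN
        obtain ⟨rfl, -⟩ := List.append_eq_nil_iff.1 hp.symm
        cases hv
        exact absurd hvN hu
      · have := walkLen_nonneg (I := I) ∅ q
        simpa [walkLen_nil] using this
  | @cons u w x e p h hp ih =>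
    intro a ha q hq
    by_cases hu : u ∈ N
    · obtain ⟨H, h1, h2, h3⟩ := ih u (.inr hu) [e] (.single h)
      refine ⟨(a, u, I.walkLen ∅ q) :: H, ?_, ?_, ?_⟩
      · intro f hf
        rcases List.mem_cons.1 hf with rfl | hf
        · exact ⟨ha, .inr hu, q, hq, le_rfl⟩
        · exact h1 f hf
      · have hmono : ∀ v, Relation.ReflTransGen (Linked H) v u →
            Relation.ReflTransGen (Linked ((a, u, I.walkLen ∅ q) :: H)) v u := by
          intro v
          refine Relation.ReflTransGen.mono ?_ v u
          rintro y z ⟨f, hf, hfyz⟩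
          exact ⟨f, List.mem_cons_of_mem _ hf, hfyz⟩
        have hua : Linked ((a, u, I.walkLen ∅ q) :: H) u a :=
          ⟨_, List.mem_cons_self, .inr ⟨rfl, rfl⟩⟩
        intro p₁ p₂ v hp₁ hv hvN
        cases hv with
        | nil => exact .single hua
        | @cons _ w' _ e' p' h4 h5 =>
          rw [List.cons_append, List.cons.injEq] at hp₁
          obtain ⟨rfl, hp₁⟩ := hp₁
          obtain rfl := h4.right_unique h
          exact (hmono v (h2 p' p₂ v hp₁ h5 hvN)).tail hua
      · rw [List.map_cons, List.sum_cons, walkLen_cons]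
        rw [walkLen_cons, walkLen_nil] at h3
        linarith
    · obtain ⟨H, h1, h2, h3⟩ := ih a ha (q ++ [e]) (hq.append (.single h))
      refine ⟨H, h1, ?_, ?_⟩
      · intro p₁ p₂ v hp₁ hv hvN
        cases hv with
        | nil => exact absurd hvN hu
        | @cons _ w' _ e' p' h4 h5 =>
          rw [List.cons_append, List.cons.injEq] at hp₁
          obtain ⟨rfl, hp₁⟩ := hp₁
          obtain rfl := h4.right_unique h
          exact h2 p' p₂ v hp₁ h5 hvN
      · rw [walkLen_cons]
        rw [walkLen_append, walkLen_cons, walkLen_nil] at h3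
        linarith

end RobustSP

/-! ### The approximation guarantee -/

namespace RobustSP

variable {I : RobustSP}

theorem IsWalk.right_unique {u v w : Fin I.n} {p : List (Fin I.m)} (h : I.IsWalk u v p)
    (h' : I.IsWalk u w p) : v = w := by
  induction h with
  | nil => cases h'; rfl
  | cons h1 _ ih =>
    cases h' with
    | cons h2 h3 =>
      obtain rfl := h1.right_unique h2
      exact ih h3

/-- There is a closed walk through everything that can be reached from `r` by edges in `F`, and it is
at most twice as long as these edges. -/
theorem exists_tour (F : Finset (Fin I.m)) (r : Fin I.n) : ∃ p, I.IsWalk r r p ∧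
    I.walkLen ∅ p ≤ 2 * ∑ e ∈ F, I.len e ∧
    ∀ v q, I.IsWalk r v q → (∀ e ∈ q, e ∈ F) → ∃ p₁ p₂, p = p₁ ++ p₂ ∧ I.IsWalk r v p₁ := by
  classical
  -- Edge sets whose doubling carries a closed walk from `r` through all their endpoints. A largest
  -- such subset of `F` is shown to reach everything.
  let P : Finset (Fin I.m) → Prop := fun U => ∃ p, I.IsWalk r r p ∧
    I.walkLen ∅ p ≤ 2 * ∑ e ∈ U, I.len e ∧
    ∀ e ∈ U, ∀ u v, I.Joins e u v → ∃ p₁ p₂, p = p₁ ++ p₂ ∧ I.IsWalk r u p₁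
  obtain ⟨U, hU, hmax⟩ := (F.powerset.filter P).exists_max_image Finset.card
    ⟨∅, Finset.mem_filter.2 ⟨by simp, [], .nil r, by simp [walkLen_nil], by simp⟩⟩
  obtain ⟨hUF, p, hp, hpl, hpU⟩ := Finset.mem_filter.1 hU
  rw [Finset.mem_powerset] at hUF
  refine ⟨p, hp, hpl.trans ?_, ?_⟩
  · have := Finset.sum_le_sum_of_subset_of_nonneg hUF fun e _ _ => (I.len_pos e).le
    linarith
  suffices H : ∀ u v q, I.IsWalk u v q → (∀ e ∈ q, e ∈ F) →
      (∃ p₁ p₂, p = p₁ ++ p₂ ∧ I.IsWalk r u p₁) → ∃ p₁ p₂, p = p₁ ++ p₂ ∧ I.IsWalk r v p₁ from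
    fun v q hq hqF => H r v q hq hqF ⟨[], p, rfl, .nil r⟩
  intro u v q hq
  induction hq with
  | nil => exact fun _ h => h
  | @cons u w x e q h _ ih =>
    intro hqF hu
    refine ih (fun e' he' => hqF e' (List.mem_cons_of_mem _ he')) ?_
    by_contra hw
    have heU : e ∉ U := fun heU => hw (hpU e heU w u h.symm)
    obtain ⟨p₁, p₂, rfl, hp₁⟩ := hu
    obtain ⟨u', h1, h2⟩ := hp.split
    obtain rfl := h1.right_unique hp₁
    have hvis : ∀ y, (∃ a b, p₁ ++ p₂ = a ++ b ∧ I.IsWalk r y a) →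
        ∃ a b, p₁ ++ (e :: e :: p₂) = a ++ b ∧ I.IsWalk r y a := by
      rintro y ⟨a, b, hab, ha⟩
      rcases List.append_eq_append_iff.1 hab with ⟨c, rfl, rfl⟩ | ⟨c, rfl, rfl⟩
      · obtain ⟨u'', h3, h4⟩ := ha.split
        obtain rfl := h3.right_unique hp₁
        exact ⟨p₁ ++ e :: e :: c, b, by simp, hp₁.append (.cons h (.cons h.symm h4))⟩
      · exact ⟨a, c ++ e :: e :: p₂, by simp, ha⟩
    -- At a visit to `u` the detour along `e` and back is inserted. It costs twice the length of `e`
    -- and adds the other endpoint, which contradicts maximality.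
    have hP : P (insert e U) := by
      refine ⟨p₁ ++ e :: e :: p₂, hp₁.append (.cons h (.cons h.symm h2)), ?_, ?_⟩
      · rw [walkLen_append] at hpl ⊢
        rw [walkLen_cons, walkLen_cons, if_neg (Finset.notMem_empty e), Finset.sum_insert heU]
        linarith
      · intro f hf y z hyz
        rcases Finset.mem_insert.1 hf with rfl | hf
        · rcases h with ⟨h5, h6⟩ | ⟨h5, h6⟩ <;> rcases hyz with ⟨h7, h8⟩ | ⟨h7, h8⟩
          · obtain rfl := h5.symm.trans h7
            exact ⟨p₁, f :: f :: p₂, rfl, hp₁⟩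
          · obtain rfl := h6.symm.trans h8
            exact ⟨p₁ ++ [f], f :: p₂, by simp, hp₁.append (.single (.inl ⟨h5, h6⟩))⟩
          · obtain rfl := h5.symm.trans h7
            exact ⟨p₁ ++ [f], f :: p₂, by simp, hp₁.append (.single (.inr ⟨h5, h6⟩))⟩
          · obtain rfl := h6.symm.trans h8
            exact ⟨p₁, f :: f :: p₂, rfl, hp₁⟩
        · exact hvis y (hpU f hf y z hyz)
    have := hmax (insert e U) (Finset.mem_filter.2 ⟨Finset.mem_powerset.2
      (Finset.insert_subset (hqF e (by simp)) hUF), hP⟩)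
    rw [Finset.card_insert_of_notMem heU] at this
    omega

/-- Points that are reached from the root by edges in `F` can be attached to the root. -/
theorem attach_of_reached {F : Finset (Fin I.m)} {N : Set (Fin I.n)}
    (h : ∀ v ∈ N, ∃ q, I.IsWalk I.root v q ∧ ∀ e ∈ q, e ∈ F) :
    I.Attach {I.root} N (2 * ∑ e ∈ F, I.len e) := by
  obtain ⟨p, hp, hpl, hv⟩ := exists_tour F I.root
  obtain ⟨H, h1, h2, h3⟩ := hp.exists_links (V := {I.root}) (N := N) I.root (.inl rfl) []
    (.nil _)
  refine ⟨H, h1, fun t ht => ⟨I.root, rfl, ?_⟩, ?_⟩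
  · obtain ⟨q, hq, hqF⟩ := h t ht
    obtain ⟨p₁, p₂, hp', hp₁⟩ := hv t q hq hqF
    exact h2 p₁ p₂ t hp' hp₁ ht
  · rw [walkLen_nil] at h3
    linarith

/-- An edge of `F` is free in the walk length but is already contained in `F'`; any other edge is
paid at most once by the walk. -/
theorem sum_union_le {F F' : Finset (Fin I.m)} (h : F ⊆ F') (p : List (Fin I.m)) :
    ∑ e ∈ F' ∪ p.toFinset, I.len e ≤ ∑ e ∈ F', I.len e + I.walkLen F p := by
  induction p with
  | nil => simp [walkLen_nil]
  | cons e p ih =>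
    rw [List.toFinset_cons, Finset.union_insert, walkLen_cons]
    have h1 := (I.len_pos e).le
    by_cases he : e ∈ F' ∪ p.toFinset
    · rw [Finset.insert_eq_of_mem he]
      have := edgeLen_nonneg F e
      linarith
    · rw [Finset.sum_insert he, if_neg fun he' => he (Finset.mem_union_left _ (h he'))]
      linarith

/-- Buy the walks to `q` points in addition to `F`. -/
theorem exists_superset {F : Finset (Fin I.m)} {D : ℝ} (sel : ℕ → Fin I.n) (q : ℕ)
    (h : ∀ i < q, ∃ p, I.IsWalk I.root (sel i) p ∧ I.walkLen F p ≤ D) :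
    ∃ F', F ⊆ F' ∧ ∑ e ∈ F', I.len e ≤ ∑ e ∈ F, I.len e + q * D ∧
      ∀ i < q, ∃ p, I.IsWalk I.root (sel i) p ∧ ∀ e ∈ p, e ∈ F' := by
  induction q with
  | zero => exact ⟨F, subset_rfl, by simp, by simp⟩
  | succ q ih =>
    obtain ⟨F', h1, h2, h3⟩ := ih fun i hi => h i (by omega)
    obtain ⟨p, hp, hpl⟩ := h q (by omega)
    refine ⟨F' ∪ p.toFinset, h1.trans Finset.subset_union_left, ?_, fun i hi => ?_⟩
    · have := sum_union_le h1 p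
      push_cast
      linarith
    · rcases Nat.lt_succ_iff_lt_or_eq.1 hi with hi | rfl
      · obtain ⟨p', h4, h5⟩ := h3 i hi
        exact ⟨p', h4, fun e he => Finset.mem_union_left _ (h5 e he)⟩
      · exact ⟨p, hp, fun e he => Finset.mem_union_right _ (List.mem_toFinset.2 he)⟩

/-- The distance between two points, or `c` if it is larger than `c`. -/
noncomputable def trunc (I : RobustSP) (c : ℝ) (s v : Fin I.n) : ℝ :=
  sInf (insert c {x | ∃ p, I.IsWalk s v p ∧ I.walkLen ∅ p = x})

/-! ### Packing balls: truncated distances and the lower bound for a solution -/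

section trunc

variable {c : ℝ} {s : Fin I.n}

theorem trunc_bddBelow (hc : 0 ≤ c) (v : Fin I.n) :
    BddBelow (insert c {x | ∃ p, I.IsWalk s v p ∧ I.walkLen ∅ p = x}) := by
  refine ⟨0, ?_⟩
  rintro x (rfl | ⟨p, -, rfl⟩)
  · exact hc
  · exact walkLen_nonneg ∅ p

theorem trunc_le (hc : 0 ≤ c) (v : Fin I.n) : I.trunc c s v ≤ c :=
  csInf_le (trunc_bddBelow hc v) (Set.mem_insert _ _)

theorem trunc_le_walkLen (hc : 0 ≤ c) {v : Fin I.n} {p : List (Fin I.m)} (hp : I.IsWalk s v p) :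
    I.trunc c s v ≤ I.walkLen ∅ p :=
  csInf_le (trunc_bddBelow hc v) (Set.mem_insert_of_mem _ ⟨p, hp, rfl⟩)

theorem exists_walk_of_trunc_lt {v : Fin I.n} {y : ℝ} (hy : I.trunc c s v < y) (hyc : y ≤ c) :
    ∃ p, I.IsWalk s v p ∧ I.walkLen ∅ p < y := by
  obtain ⟨x, hx, hxy⟩ := exists_lt_of_csInf_lt ⟨c, Set.mem_insert _ _⟩ hy
  rcases hx with rfl | ⟨p, hp, rfl⟩
  · linarith
  · exact ⟨p, hp, hxy⟩

theorem trunc_step (hc : 0 ≤ c) {e : Fin I.m} {u v : Fin I.n} (h : I.Joins e u v) :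
    I.trunc c s v ≤ I.trunc c s u + I.len e := by
  rw [← sub_le_iff_le_add]
  refine le_csInf ⟨c, Set.mem_insert _ _⟩ ?_
  rintro x (rfl | ⟨p, hp, rfl⟩)
  · have := trunc_le (s := s) hc v
    have := (I.len_pos e).le
    linarith
  · have := trunc_le_walkLen hc (hp.append (.single h))
    rw [walkLen_append, walkLen_cons, walkLen_nil, if_neg (Finset.notMem_empty e)] at this
    linarith

theorem trunc_self (hc : 0 ≤ c) : I.trunc c s s ≤ 0 :=
  trunc_le_walkLen hc (.nil s)

theorem trunc_eq (hc : 0 ≤ c) {v : Fin I.n}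
    (h : ∀ p, I.IsWalk s v p → c ≤ I.walkLen ∅ p) : I.trunc c s v = c := by
  refine le_antisymm (trunc_le hc v) (le_csInf ⟨c, Set.mem_insert _ _⟩ ?_)
  rintro x (rfl | ⟨p, hp, rfl⟩)
  · exact le_rfl
  · exact h p hp

end trunc

/-- The part of the edge `e` that lies in the ball of radius `c` around `s`. -/
noncomputable def part (I : RobustSP) (c : ℝ) (s : Fin I.n) (e : Fin I.m) : ℝ :=
  |I.trunc c s (I.fst e) - I.trunc c s (I.snd e)|

theorem part_le {c : ℝ} (hc : 0 ≤ c) (s : Fin I.n) (e : Fin I.m) : I.part c s e ≤ I.len e := by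
  have h1 := trunc_step (s := s) hc (e := e) (u := I.fst e) (v := I.snd e) (.inl ⟨rfl, rfl⟩)
  have h2 := trunc_step (s := s) hc (e := e) (u := I.snd e) (v := I.fst e) (.inr ⟨rfl, rfl⟩)
  rw [part, abs_le]
  constructor <;> linarith

/-- Balls around points that are far from each other do not overlap. -/
theorem sum_part_le {c : ℝ} (hc : 0 ≤ c) {S : Finset (Fin I.n)}
    (hS : ∀ s ∈ S, ∀ s' ∈ S, s ≠ s' → ∀ p, I.IsWalk s s' p → 2 * c ≤ I.walkLen ∅ p)
    (e : Fin I.m) : ∑ s ∈ S, I.part c s e ≤ I.len e := by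
  classical
  have hle : ∀ s v, I.trunc c s v ≤ c := fun s v => trunc_le hc v
  -- Open balls of radius `c` around different centers have no common vertex, by the triangle
  -- inequality.
  have hone : ∀ s ∈ S, ∀ s' ∈ S, s ≠ s' → ∀ v, I.trunc c s v < c → I.trunc c s' v < c → False := by
    intro s hs s' hs' hne v h1 h2
    obtain ⟨p, hp, hpl⟩ := exists_walk_of_trunc_lt h1 le_rfl
    obtain ⟨q, hq, hql⟩ := exists_walk_of_trunc_lt h2 le_rfl
    have := hS s hs s' hs' hne _ (hp.append hq.reverse)
    rw [walkLen_append, walkLen_reverse] at this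
    linarith
  have hzero : ∀ s, I.part c s e ≠ 0 →
      I.trunc c s (I.fst e) < c ∨ I.trunc c s (I.snd e) < c := by
    intro s hs
    by_contra! h
    rw [part, le_antisymm (hle s _) h.1, le_antisymm (hle s _) h.2, sub_self, abs_zero] at hs
    exact hs rfl
  -- Either the two ends of the edge lie in different balls, and only these two balls contribute, or
  -- at most one ball contributes and its part is at most the edge length.
  by_cases hab : ∃ a ∈ S, ∃ b ∈ S, a ≠ b ∧ I.trunc c a (I.fst e) < c ∧ I.trunc c b (I.snd e) < c
  · obtain ⟨a, ha, b, hb, hne, h1, h2⟩ := hab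
    rw [Finset.sum_eq_add a b hne ?_ (fun h => absurd ha h) (fun h => absurd hb h)]
    · have h3 : I.trunc c a (I.snd e) = c := by
        refine le_antisymm (hle a _) (not_lt.1 fun h => hone a ha b hb hne _ h h2)
      have h4 : I.trunc c b (I.fst e) = c := by
        refine le_antisymm (hle b _) (not_lt.1 fun h => hone a ha b hb hne _ h1 h)
      rw [part, part, h3, h4, abs_of_nonpos (by linarith), abs_of_nonneg (by linarith)]
      by_contra hcon
      push Not at hcon
      -- The truncated distance is an infimum, so walks are taken within ε of it. With ε equal to
      -- half of the assumed excess, the two walks joined by `e` would be too short.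
      let ε := (2 * c - I.len e - I.trunc c a (I.fst e) - I.trunc c b (I.snd e)) / 2
      have hε : 0 < ε := by simp only [ε]; linarith
      obtain ⟨p, hp, hpl⟩ := exists_walk_of_trunc_lt (y := min c (I.trunc c a (I.fst e) + ε))
        (lt_min h1 (by linarith)) (min_le_left _ _)
      obtain ⟨q, hq, hql⟩ := exists_walk_of_trunc_lt (y := min c (I.trunc c b (I.snd e) + ε))
        (lt_min h2 (by linarith)) (min_le_left _ _)
      have h5 := hpl.trans_le (min_le_right _ _)
      have h6 := hql.trans_le (min_le_right _ _)
      have := hS a ha b hb hne _ ((hp.append (.single (e := e) (.inl ⟨rfl, rfl⟩))).append hq.reverse)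
      rw [walkLen_append, walkLen_append, walkLen_reverse, walkLen_cons, walkLen_nil,
        if_neg (Finset.notMem_empty e)] at this
      simp only [ε] at h5 h6
      linarith
    · rintro s hs ⟨hsa, hsb⟩
      by_contra h0
      rcases hzero s h0 with h | h
      · exact hone s hs a ha hsa _ h h1
      · exact hone s hs b hb hsb _ h h2
  · by_cases hall : ∀ s ∈ S, I.part c s e = 0
    · rw [Finset.sum_eq_zero hall]
      exact (I.len_pos e).le
    · push Not at hall
      obtain ⟨a, ha, ha0⟩ := hall
      rw [Finset.sum_eq_single a ?_ fun h => absurd ha h]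
      · exact part_le hc a e
      · intro s hs hsa
        by_contra h0
        rcases hzero s h0 with h | h <;> rcases hzero a ha0 with h' | h'
        · exact hone s hs a ha hsa _ h h'
        · exact hab ⟨s, hs, a, ha, hsa, h, h'⟩
        · exact hab ⟨a, ha, s, hs, hsa.symm, h', h⟩
        · exact hone s hs a ha hsa _ h h'

theorem IsWalk.trunc_sub_le {c : ℝ} {s u v : Fin I.n} {p : List (Fin I.m)} (hp : I.IsWalk u v p) :
    I.trunc c s u - I.trunc c s v ≤ (p.map (I.part c s)).sum := by
  induction hp with
  | nil => simp
  | @cons u v x e p h _ ih =>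
    rw [List.map_cons, List.sum_cons]
    have : I.trunc c s u - I.trunc c s v ≤ I.part c s e := by
      rcases h with ⟨rfl, rfl⟩ | ⟨rfl, rfl⟩
      · exact le_abs_self _
      · rw [part, abs_sub_comm]
        exact le_abs_self _
    linarith

/-- A solution that covers many points far from each other is expensive. -/
theorem card_mul_le {c D : ℝ} (hc : 0 ≤ c) {S : Finset (Fin I.n)} {F : Finset (Fin I.m)}
    (hS : ∀ s ∈ S, ∀ s' ∈ S, s ≠ s' → ∀ p, I.IsWalk s s' p → 2 * c ≤ I.walkLen ∅ p)
    (hr : ∀ s ∈ S, ∀ p, I.IsWalk I.root s p → c ≤ I.walkLen ∅ p)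
    (hF : ∀ s ∈ S, ∃ p, I.IsWalk I.root s p ∧ I.walkLen F p ≤ D) :
    S.card * (c - D) ≤ ∑ e ∈ F, I.len e := by
  classical
  have hs : ∀ s ∈ S, c - D ≤ ∑ e ∈ F, I.part c s e := by
    intro s hs
    obtain ⟨p, hp, hpD⟩ := hF s hs
    obtain ⟨q, hq, hnd, hqp⟩ := hp.exists_nodup
    have h1 := hq.trunc_sub_le (c := c) (s := s)
    rw [trunc_eq hc fun p hp => ?_] at h1
    swap
    · have := hr s hs _ hp.reverse
      rwa [walkLen_reverse] at this
    have h2 := trunc_self (I := I) (s := s) hc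
    have h3 := walkLen_sublist F hqp
    -- Edges outside `F` are charged to the length of the walk with `F` free, which is at most `D`.
    -- As the walk repeats no edge, the parts of edges of `F` are counted once.
    have h4 : (q.map (I.part c s)).sum ≤
        ∑ e ∈ q.toFinset, (if e ∈ F then I.part c s e else 0) + I.walkLen F q := by
      rw [List.sum_toFinset _ hnd, walkLen, ← List.sum_map_add]
      refine List.sum_le_sum fun e _ => ?_
      split_ifs
      · linarith
      · have := part_le hc s e
        linarith
    have h5 : ∑ e ∈ q.toFinset, (if e ∈ F then I.part c s e else 0) ≤ ∑ e ∈ F, I.part c s e := by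
      rw [← Finset.sum_filter]
      refine Finset.sum_le_sum_of_subset_of_nonneg (fun e he => (Finset.mem_filter.1 he).2)
        fun e _ _ => abs_nonneg _
    linarith
  calc S.card * (c - D) = ∑ s ∈ S, (c - D) := by rw [Finset.sum_const, nsmul_eq_mul]
    _ ≤ ∑ s ∈ S, ∑ e ∈ F, I.part c s e := Finset.sum_le_sum hs
    _ = ∑ e ∈ F, ∑ s ∈ S, I.part c s e := Finset.sum_comm
    _ ≤ ∑ e ∈ F, I.len e := Finset.sum_le_sum fun e _ => sum_part_le hc hS e

/-! ### Comparison with an arbitrary solution -/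

theorem dist_le {F : Finset (Fin I.m)} {v : Fin I.n} {p : List (Fin I.m)}
    (hp : I.IsWalk I.root v p) : I.dist F v ≤ ENNReal.ofReal (I.walkLen F p) :=
  iInf₂_le p hp

theorem exists_walk_of_dist_ne_top {F : Finset (Fin I.m)} {v : Fin I.n} (h : I.dist F v ≠ ⊤) :
    ∃ p, I.IsWalk I.root v p ∧ ENNReal.ofReal (I.walkLen F p) = I.dist F v := by
  have hex : ∃ a ∈ ({I.root} : Set (Fin I.n)), ∃ p, I.IsWalk a v p := by
    by_contra! hcon
    refine h ?_
    rw [dist, iInf_eq_top]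
    intro p
    rw [iInf_eq_top]
    exact fun hp => absurd hp (hcon I.root rfl p)
  obtain ⟨a, rfl, p, hp, hmin⟩ := exists_min_walk F hex
  exact ⟨p, hp, le_antisymm (le_iInf₂ fun q hq => ENNReal.ofReal_le_ofReal (hmin _ rfl q hq))
    (dist_le hp)⟩

/-- The root and the points `sel i` for `i < j`. -/
def centers (I : RobustSP) (sel : ℕ → Fin I.n) (j : ℕ) : Set (Fin I.n) :=
  {v | v = I.root ∨ ∃ i < j, sel i = v}

/-- The guarantee in real numbers, for a solution `F` with second-stage distances at most `D`. -/
theorem cost_le_aux {E F : Finset (Fin I.m)} {sel : ℕ → Fin I.n} {q : ℕ} {D : ℝ}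
    (hq : (q : ℝ) ≤ I.infl) (hqk : q = I.k ∨ I.infl < q + 1)
    (hterm : ∀ i < q, ∃ τ, I.term τ = sel i)
    (hfar : ∀ j < q, ∀ τ, ∃ x, (∀ a ∈ I.centers sel j, ∀ p, I.IsWalk a (sel j) p →
      x ≤ I.walkLen ∅ p) ∧ ∃ a ∈ I.centers sel j, ∃ p, I.IsWalk a (I.term τ) p ∧ I.walkLen ∅ p ≤ x)
    (hconn : ∀ i < q, ∃ p, I.IsWalk I.root (sel i) p ∧ ∀ e ∈ p, e ∈ E)
    (hE : ∀ L, I.Attach {I.root} {v | ∃ i < q, sel i = v} L → ∑ e ∈ E, I.len e ≤ L)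
    (hreach : ∀ τ, ∃ p, I.IsWalk I.root (I.term τ) p)
    (hD : ∀ τ, ∃ p, I.IsWalk I.root (I.term τ) p ∧ I.walkLen F p ≤ D) :
    ∃ δ, 0 ≤ δ ∧ (∀ τ, I.dist E (I.term τ) ≤ ENNReal.ofReal δ) ∧
      ∑ e ∈ E, I.len e + I.infl * δ ≤ 4 * (∑ e ∈ F, I.len e + I.infl * D) := by
  classical
  have hlam := I.one_lt_infl
  have hex : ∀ τ, ∃ a ∈ I.centers sel q, ∃ p, I.IsWalk a (I.term τ) p ∧
      ∀ b ∈ I.centers sel q, ∀ p', I.IsWalk b (I.term τ) p' → I.walkLen ∅ p ≤ I.walkLen ∅ p' := by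
    intro τ
    obtain ⟨p, hp⟩ := hreach τ
    exact exists_min_walk ∅ ⟨I.root, .inl rfl, p, hp⟩
  choose src hsrc P hP hmin using hex
  have : Nonempty (Fin I.k) := ⟨⟨0, I.k_pos⟩⟩
  -- A terminal that is worst served by the root and the picks; its distance to them is δ.
  obtain ⟨τ₀, -, hτ₀⟩ := Finset.univ.exists_max_image (fun τ => I.walkLen ∅ (P τ))
    ⟨⟨0, I.k_pos⟩, Finset.mem_univ _⟩
  obtain ⟨δ, hδ⟩ : ∃ δ, I.walkLen ∅ (P τ₀) = δ := ⟨_, rfl⟩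
  have hδ0 : 0 ≤ δ := hδ ▸ walkLen_nonneg ∅ _
  have hD0 : 0 ≤ D := by
    obtain ⟨p, -, hp⟩ := hD τ₀
    exact (walkLen_nonneg F p).trans hp
  refine ⟨δ, hδ0, fun τ => ?_, ?_⟩
  · obtain ⟨p, hp, hpE⟩ : ∃ p, I.IsWalk I.root (src τ) p ∧ ∀ e ∈ p, e ∈ E := by
      rcases hsrc τ with h | ⟨i, hi, h⟩
      · exact ⟨[], by rw [h]; exact .nil _, by simp⟩
      · rw [← h]
        exact hconn i hi
    refine (dist_le (hp.append (hP τ))).trans (ENNReal.ofReal_le_ofReal ?_)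
    rw [walkLen_append, walkLen_eq_zero hpE, zero_add]
    exact (walkLen_le E _).trans ((hτ₀ τ (Finset.mem_univ _)).trans hδ.le)
  have hW : 0 ≤ ∑ e ∈ F, I.len e := Finset.sum_nonneg fun e _ => (I.len_pos e).le
  -- the first stage
  have hfirst : ∑ e ∈ E, I.len e ≤ 2 * (∑ e ∈ F, I.len e + I.infl * D) := by
    obtain ⟨F', -, h2, h3⟩ := exists_superset (F := F) (D := D) sel q fun i hi => by
      obtain ⟨τ, hτ⟩ := hterm i hi
      rw [← hτ]
      exact hD τ
    have h4 := hE _ (attach_of_reached (F := F') fun v ⟨i, hi, hv⟩ => hv ▸ h3 i hi)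
    have h5 := mul_le_mul_of_nonneg_right hq hD0
    linarith
  -- the second stage
  have hsecond : I.infl * δ ≤ 2 * (∑ e ∈ F, I.len e + I.infl * D) := by
    rcases hδ0.eq_or_lt with h0 | hpos
    · rw [← h0, mul_zero]
      have := mul_nonneg (by linarith : (0 : ℝ) ≤ I.infl) hD0
      linarith
    -- When `sel j` was picked, `τ₀` was no farther from the earlier centers than `sel j`. As `τ₀`
    -- has distance δ from all centers, `sel j` has distance at least δ from the earlier ones.
    have hfarδ : ∀ j ≤ q, ∀ a ∈ I.centers sel j, ∀ p,
        I.IsWalk a (if j < q then sel j else I.term τ₀) p → δ ≤ I.walkLen ∅ p := by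
      intro j hj a ha p hp
      have hsub : ∀ b ∈ I.centers sel j, b ∈ I.centers sel q := by
        rintro b (hb | ⟨i, hi, hb⟩)
        · exact .inl hb
        · exact .inr ⟨i, by omega, hb⟩
      by_cases hjq : j < q
      · rw [if_pos hjq] at hp
        obtain ⟨x, h1, b, hb, p', hp', h2⟩ := hfar j hjq τ₀
        have h3 := hmin τ₀ b (hsub b hb) p' hp'
        have h4 := h1 a ha p hp
        linarith
      · rw [if_neg hjq] at hp
        have h3 := hmin τ₀ a (hsub a ha) p hp
        linarith
    -- The q + 1 ball centers: the q picks, followed by the worst-served terminal.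
    let pt : ℕ → Fin I.n := fun j => if j < q then sel j else I.term τ₀
    have hpair : ∀ i j, i < j → j ≤ q → ∀ p, I.IsWalk (pt i) (pt j) p → δ ≤ I.walkLen ∅ p := by
      intro i j hij hj p hp
      refine hfarδ j hj (pt i) (.inr ⟨i, hij, ?_⟩) p hp
      simp only [pt]
      rw [if_pos (by omega)]
    have hpair' : ∀ i ≤ q, ∀ j ≤ q, i ≠ j → ∀ p, I.IsWalk (pt i) (pt j) p → δ ≤ I.walkLen ∅ p := by
      intro i hi j hj hij p hp
      rcases lt_or_gt_of_ne hij with h | h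
      · exact hpair i j h hj p hp
      · have := hpair j i h hi _ hp.reverse
        rwa [walkLen_reverse] at this
    have hinj : Set.InjOn pt (Finset.range (q + 1)) := by
      intro i hi j hj hij
      by_contra hne
      simp only [Finset.coe_range, Set.mem_Iio] at hi hj
      have := hpair' i (by omega) j (by omega) hne [] (by rw [hij]; exact .nil _)
      rw [walkLen_nil] at this
      linarith
    have hptterm : ∀ j ≤ q, ∃ τ, I.term τ = pt j := by
      intro j hj
      simp only [pt]
      split_ifs with h
      · exact hterm j h
      · exact ⟨τ₀, rfl⟩
    let S : Finset (Fin I.n) := (Finset.range (q + 1)).image pt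
    have hcard : S.card = q + 1 := by
      rw [Finset.card_image_of_injOn hinj, Finset.card_range]
    have hmem : ∀ s ∈ S, ∃ j ≤ q, pt j = s := by
      intro s hs
      obtain ⟨j, hj, h⟩ := Finset.mem_image.1 hs
      exact ⟨j, by have := Finset.mem_range.1 hj; omega, h⟩
    -- If q were |T|, the points would be |T| + 1 distinct terminals.
    have hlt : I.infl < q + 1 := by
      refine hqk.resolve_left fun hk => ?_
      have h1 : S ⊆ Finset.univ.image I.term := by
        intro s hs
        obtain ⟨j, hj, rfl⟩ := hmem s hs
        obtain ⟨τ, hτ⟩ := hptterm j hj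
        exact Finset.mem_image.2 ⟨τ, Finset.mem_univ _, hτ⟩
      have h2 := (Finset.card_le_card h1).trans Finset.card_image_le
      rw [hcard, Finset.card_univ, Fintype.card_fin] at h2
      omega
    have hbound := card_mul_le (c := δ / 2) (D := D) (S := S) (F := F) (by linarith) ?_ ?_ ?_
    · rw [hcard] at hbound
      push_cast at hbound
      -- Replacing q + 1 by the smaller λ in the packing bound needs a nonnegative factor δ/2 − D;
      -- otherwise λδ ≤ 2λD is immediate.
      by_cases hδD : δ / 2 ≤ D
      · have := mul_le_mul_of_nonneg_left hδD (by linarith : (0 : ℝ) ≤ I.infl)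
        linarith
      · have := mul_le_mul_of_nonneg_right hlt.le (by linarith : (0 : ℝ) ≤ δ / 2 - D)
        linarith
    · intro s hs s' hs' hne p hp
      obtain ⟨i, hi, rfl⟩ := hmem s hs
      obtain ⟨j, hj, rfl⟩ := hmem s' hs'
      have := hpair' i hi j hj (fun h => hne (by rw [h])) p hp
      linarith
    · intro s hs p hp
      obtain ⟨j, hj, rfl⟩ := hmem s hs
      have := hfarδ j hj I.root (.inl rfl) p hp
      linarith
    · intro s hs
      obtain ⟨j, hj, rfl⟩ := hmem s hs
      obtain ⟨τ, hτ⟩ := hptterm j hj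
      rw [← hτ]
      exact hD τ
  linarith

theorem cost_le {E : Finset (Fin I.m)} {sel : ℕ → Fin I.n} {q : ℕ}
    (hq : (q : ℝ) ≤ I.infl) (hqk : q = I.k ∨ I.infl < q + 1)
    (hterm : ∀ i < q, ∃ τ, I.term τ = sel i)
    (hfar : ∀ j < q, ∀ τ, ∃ x, (∀ a ∈ I.centers sel j, ∀ p, I.IsWalk a (sel j) p →
      x ≤ I.walkLen ∅ p) ∧ ∃ a ∈ I.centers sel j, ∃ p, I.IsWalk a (I.term τ) p ∧ I.walkLen ∅ p ≤ x)
    (hconn : ∀ i < q, ∃ p, I.IsWalk I.root (sel i) p ∧ ∀ e ∈ p, e ∈ E)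
    (hE : ∀ L, I.Attach {I.root} {v | ∃ i < q, sel i = v} L → ∑ e ∈ E, I.len e ≤ L)
    (hreach : ∀ τ, ∃ p, I.IsWalk I.root (I.term τ) p) :
    I.cost E ≤ 4 * I.opt := by
  classical
  have hlam := I.one_lt_infl
  rw [opt, ENNReal.mul_iInf_of_ne (by simp) (by simp)]
  refine le_iInf fun F => ?_
  have hfin : ∀ τ, I.dist F (I.term τ) ≠ ⊤ := by
    intro τ
    obtain ⟨p, hp⟩ := hreach τ
    exact ne_top_of_le_ne_top ENNReal.ofReal_ne_top (dist_le hp)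
  choose P hP hPd using fun τ => exists_walk_of_dist_ne_top (hfin τ)
  obtain ⟨τ₀, -, hτ₀⟩ := Finset.univ.exists_max_image (fun τ => I.walkLen F (P τ))
    ⟨⟨0, I.k_pos⟩, Finset.mem_univ _⟩
  obtain ⟨δ, hδ0, hδ, hle⟩ := cost_le_aux (F := F) (D := I.walkLen F (P τ₀)) hq hqk hterm hfar
    hconn hE hreach fun τ => ⟨P τ, hP τ, hτ₀ τ (Finset.mem_univ _)⟩
  have hWE : 0 ≤ ∑ e ∈ E, I.len e := Finset.sum_nonneg fun e _ => (I.len_pos e).le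
  have hWF : 0 ≤ ∑ e ∈ F, I.len e := Finset.sum_nonneg fun e _ => (I.len_pos e).le
  have hD0 := walkLen_nonneg F (P τ₀)
  calc I.cost E ≤ ENNReal.ofReal (∑ e ∈ E, I.len e) + ENNReal.ofReal I.infl * ENNReal.ofReal δ := by
        unfold cost
        gcongr
        exact iSup_le hδ
    _ = ENNReal.ofReal (∑ e ∈ E, I.len e + I.infl * δ) := by
        rw [← ENNReal.ofReal_mul (by linarith), ← ENNReal.ofReal_add hWE (by positivity)]
    _ ≤ ENNReal.ofReal (4 * (∑ e ∈ F, I.len e + I.infl * I.walkLen F (P τ₀))) :=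
        ENNReal.ofReal_le_ofReal hle
    _ = 4 * (ENNReal.ofReal (∑ e ∈ F, I.len e) + ENNReal.ofReal I.infl * I.dist F (I.term τ₀)) := by
        rw [← hPd τ₀, ← ENNReal.ofReal_mul (by linarith), ← ENNReal.ofReal_add hWF (by positivity),
          ENNReal.ofReal_mul (by norm_num)]
        simp
    _ ≤ 4 * I.cost F := by
        unfold cost
        gcongr
        exact le_iSup (fun i => I.dist F (I.term i)) τ₀

/-- Making edges free creates no new walks, so an unreachable terminal makes every solution
infinitely expensive; the positive factor λ keeps the value infinite. -/
theorem opt_eq_top {τ : Fin I.k} (h : ∀ p, ¬ I.IsWalk I.root (I.term τ) p) : I.opt = ⊤ := by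
  rw [opt, iInf_eq_top]
  intro F
  have h1 : I.dist F (I.term τ) = ⊤ := by
    rw [dist, iInf_eq_top]
    intro p
    rw [iInf_eq_top]
    exact fun hp => absurd hp (h p)
  have h2 : ⨆ i, I.dist F (I.term i) = ⊤ :=
    top_le_iff.1 (h1 ▸ le_iSup (fun i => I.dist F (I.term i)) τ)
  have h3 : ENNReal.ofReal I.infl ≠ 0 := by
    have := I.one_lt_infl
    simp only [ne_eq, ENNReal.ofReal_eq_zero, not_le]
    linarith
  rw [cost, h2, ENNReal.mul_top h3, add_top]

end RobustSP

/-! ### Selecting the terminals that are to be connected -/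

namespace RAM

open Instr Program Test Heap Function

namespace Reg
abbrev done := 28
abbrev cnt := 29
abbrev far := 30
abbrev bad := 31
abbrev near := 32
abbrev idx := 33
abbrev one := 34
end Reg

namespace Arr
abbrev sel := 20
end Arr

namespace RReg
abbrev acc := 7
abbrev one := 8
abbrev far := 9
abbrev cur := 10
end RReg

theorem Ready.of_keeps {I : RobustSP} {R : ℕ} {s s' : State} (h : Ready I R s) {p : Program}
    (hk : Keeps p s s') (hv : (heap s').Valid I.n R ∅)
    (h1 : ∀ x ∈ [Reg.n, Reg.zero, Reg.cap], x ∉ p.collect Instr.natRegs)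
    (h2 : ∀ x ∈ [Arr.tgt, Arr.edg, Arr.head, Arr.next], x ∉ p.collect Instr.natArrs)
    (h3 : RArr.len ∉ p.collect Instr.realArrs)
    (h4 : ∀ x ∈ [Reg.k, Reg.root], x ∉ p.collect Instr.natRegs)
    (h5 : Arr.term ∉ p.collect Instr.natArrs) (h6 : RReg.infl ∉ p.collect Instr.realRegs) :
    Ready I R s' where
  loaded := h.loaded.of_keeps hk h1 h2 h3
  valid := hv
  k := (hk.natReg _ (h4 _ (by simp))).trans h.k
  root := (hk.natReg _ (h4 _ (by simp))).trans h.root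
  term := (hk.natArr _ h5).trans h.term
  infl := (hk.realReg _ h6).trans h.infl

theorem heap_congr {p : Program} {s s' : State} (hk : Keeps p s s')
    (h1 : ∀ x ∈ [Arr.par, Arr.rank, Arr.mark, Arr.pos, Arr.slot, Arr.top, Arr.stk, Arr.tab],
      x ∉ p.collect Instr.natArrs) (h2 : Reg.size ∉ p.collect Instr.natRegs)
    (h3 : RArr.dist ∉ p.collect Instr.realArrs) : heap s' = heap s := by
  unfold heap
  rw [hk.natArr _ (h1 _ (by simp)), hk.natArr _ (h1 _ (by simp)), hk.natArr _ (h1 _ (by simp)),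
    hk.natArr _ (h1 _ (by simp)), hk.natArr _ (h1 _ (by simp)), hk.natArr _ (h1 _ (by simp)),
    hk.natArr _ (h1 _ (by simp)), hk.natArr _ (h1 _ (by simp)), hk.natReg _ h2, hk.realArr _ h3]

/-- The number of terminals that are selected: the minimum of the number of all terminals and the
integer part of the inflation factor. -/
def count : Program :=
  seq (block [natConst Reg.i 0, natConst Reg.cnt 0, realConst RReg.one 1, realConst RReg.acc 1]) <|
  .while (natLT Reg.i Reg.k) <|
    seq (ite (realLE RReg.acc RReg.infl)
      (block [natSucc Reg.cnt, realAdd RReg.acc RReg.acc RReg.one]) .skip) <|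
    block [natSucc Reg.i]

/-- Integers and reals cannot be converted into each other, so the real number q + 1 is maintained
beside the integer q and compared with λ. Limiting the loop to k rounds keeps the cost independent
of the size of λ. -/
theorem runs_count {s : State} {k : ℕ} {x : ℝ} (hk : s.natReg Reg.k = k)
    (hx : s.realReg RReg.infl = x) (h0 : 0 ≤ x) :
    Runs count s fun t s' => ∃ q, s'.natReg Reg.cnt = q ∧ q ≤ k ∧ (q : ℝ) ≤ x ∧
      (q = k ∨ x < q + 1) ∧ t ≤ 10 * k + 10 := by
  refine Runs.blockSeq 5 ?_
  generalize hs1 : runList _ s = s1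
  have e1 : s1.natReg Reg.k = k := by rw [← hs1]; exact hk
  have e2 : s1.realReg RReg.infl = x := by rw [← hs1]; exact hx
  have e3 : s1.realReg RReg.one = 1 := by rw [← Nat.cast_one, ← hs1]; rfl
  refine Runs.while (fun t s' => ∃ i q, s'.natReg Reg.i = i ∧ s'.natReg Reg.cnt = q ∧
      s'.realReg RReg.acc = q + 1 ∧ i ≤ k ∧ q ≤ i ∧ (q : ℝ) ≤ x ∧ (q = i ∨ x < q + 1) ∧ t ≤ 8 * i)
    (8 * k) ?_ ?_ ?_ ?_
  · rintro t s' ⟨i, q, h⟩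
    omega
  · refine ⟨0, 0, by rw [← hs1]; rfl, by rw [← hs1]; rfl, ?_, by omega, le_rfl, by simpa using h0,
      .inl rfl, by omega⟩
    rw [Nat.cast_zero, zero_add, ← Nat.cast_one, ← hs1]; rfl
  · rintro t s' ⟨i, q, h1, h2, h3, h4, h5, h6, h7, h8⟩ hk' hb
    have k1 : s'.natReg Reg.k = k := (hk'.natReg _ (by decide)).trans e1
    have k2 : s'.realReg RReg.infl = x := (hk'.realReg _ (by decide)).trans e2
    have k3 : s'.realReg RReg.one = 1 := (hk'.realReg _ (by decide)).trans e3
    change s'.natReg Reg.i < s'.natReg Reg.k at hb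
    rw [h1, k1] at hb
    refine Runs.seq (Runs.ite (fun hc => Runs.blockEnd 3 (Runs.blockEnd 2 ?_))
      fun hc => Runs.skip (Runs.blockEnd 2 ?_))
    · change s'.realReg RReg.acc ≤ s'.realReg RReg.infl at hc
      rw [h3, k2] at hc
      refine ⟨i + 1, q + 1, by rw [← h1]; rfl, by rw [← h2]; rfl, ?_, by omega, by omega, ?_, ?_,
        by omega⟩
      · change s'.realReg RReg.acc + s'.realReg RReg.one = _
        rw [h3, k3]
        push_cast
        ring
      · push_cast
        exact hc
      · refine .inl ?_
        rcases h7 with h7 | h7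
        · omega
        · exact absurd hc (not_le.2 h7)
    · change ¬ s'.realReg RReg.acc ≤ s'.realReg RReg.infl at hc
      rw [h3, k2, not_le] at hc
      exact ⟨i + 1, q, by rw [← h1]; rfl, h2, h3, by omega, by omega, h6, .inr hc, by omega⟩
  · rintro t s' ⟨i, q, h1, h2, h3, h4, h5, h6, h7, h8⟩ hk' hb
    have k1 : s'.natReg Reg.k = k := (hk'.natReg _ (by decide)).trans e1
    change ¬ s'.natReg Reg.i < s'.natReg Reg.k at hb
    rw [h1, k1] at hb
    obtain rfl : i = k := by omega
    exact ⟨q, h2, h5, h6, h7, by omega⟩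

/-- Find the terminal that is farthest from the sources, and report terminals that have not been
reached. -/
def farthest : Program :=
  seq (block [natConst Reg.i 0, natConst Reg.one 1, natLoad Reg.far Arr.term Reg.i,
    realLoad RReg.far RArr.dist Reg.far]) <|
  .while (natLT Reg.i Reg.k) <|
    seq (block [natLoad Reg.v Arr.term Reg.i, natLoad Reg.sv Arr.status Reg.v,
      realLoad RReg.cur RArr.dist Reg.v, natSucc Reg.i]) <|
    seq (ite (natEq Reg.sv Reg.zero) (block [natMove Reg.bad Reg.one]) .skip) <|
    ite (realLE RReg.cur RReg.far) .skip
      (block [natMove Reg.far Reg.v, realMove RReg.far RReg.cur])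

/-- Labels of vertices that were not reached are leftovers without meaning, so the maximum is useful
only when no terminal has status 0. The register `bad` records the other case. -/
theorem runs_farthest {s : State} {k : ℕ} (hk : s.natReg Reg.k = k) (hz : s.natReg Reg.zero = 0)
    (hpos : 0 < k) :
    Runs farthest s fun t s' => (∃ i < k, s'.natReg Reg.far = s.natArr Arr.term i ∧
      ∀ j < k, s.realArr RArr.dist (s.natArr Arr.term j) ≤
        s.realArr RArr.dist (s.natArr Arr.term i)) ∧
      (s'.natReg Reg.bad ≠ 0 ↔ s.natReg Reg.bad ≠ 0 ∨
        ∃ j < k, s.natArr Arr.status (s.natArr Arr.term j) = 0) ∧ t ≤ 20 * k + 10 := by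
  refine Runs.blockSeq 5 ?_
  generalize hs1 : runList _ s = s1
  have e1 : s1.natReg Reg.k = k := by rw [← hs1]; exact hk
  have e2 : s1.natReg Reg.zero = 0 := by rw [← hs1]; exact hz
  have e3 : s1.natReg Reg.one = 1 := by rw [← hs1]; rfl
  have e4 : s1.natArr = s.natArr := by rw [← hs1]; rfl
  have e5 : s1.realArr = s.realArr := by rw [← hs1]; rfl
  refine Runs.while (fun t s' => ∃ i ≤ k, s'.natReg Reg.i = i ∧
      s'.realReg RReg.far = s.realArr RArr.dist (s'.natReg Reg.far) ∧
      (∃ j < k, s'.natReg Reg.far = s.natArr Arr.term j) ∧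
      (∀ j < i, s.realArr RArr.dist (s.natArr Arr.term j) ≤ s'.realReg RReg.far) ∧
      (s'.natReg Reg.bad ≠ 0 ↔ s.natReg Reg.bad ≠ 0 ∨
        ∃ j < i, s.natArr Arr.status (s.natArr Arr.term j) = 0) ∧ t ≤ 15 * i) (15 * k) ?_ ?_ ?_ ?_
  · rintro t s' ⟨i, h⟩
    omega
  · refine ⟨0, by omega, by rw [← hs1]; rfl, by rw [← hs1]; rfl, ⟨0, hpos, by rw [← hs1]; rfl⟩,
      fun j hj => by omega, ?_, by omega⟩
    rw [← hs1]
    constructor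
    · exact .inl
    · rintro (h | ⟨j, hj, -⟩)
      · exact h
      · omega
  · rintro t s' ⟨i, h1, h2, h3, h4, h5, h6, h7⟩ hk' hb
    have k1 : s'.natReg Reg.k = k := (hk'.natReg _ (by decide)).trans e1
    have k2 : s'.natReg Reg.zero = 0 := (hk'.natReg _ (by decide)).trans e2
    have k3 : s'.natReg Reg.one = 1 := (hk'.natReg _ (by decide)).trans e3
    have k4 : s'.natArr Arr.term = s.natArr Arr.term := by rw [hk'.natArr _ (by decide), e4]
    have k5 : s'.natArr Arr.status = s.natArr Arr.status := by rw [hk'.natArr _ (by decide), e4]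
    have k6 : s'.realArr RArr.dist = s.realArr RArr.dist := by rw [hk'.realArr _ (by decide), e5]
    change s'.natReg Reg.i < s'.natReg Reg.k at hb
    rw [h2, k1] at hb
    refine Runs.blockSeq 5 (Runs.seq ?_)
    generalize hs2 : runList _ s' = s2
    have f1 : s2.natReg Reg.i = i + 1 := by rw [← h2, ← hs2]; rfl
    have f2 : s2.natReg Reg.v = s.natArr Arr.term i := by rw [← k4, ← h2, ← hs2]; rfl
    have f3 : s2.natReg Reg.sv = s.natArr Arr.status (s.natArr Arr.term i) := by
      rw [← k5, ← k4, ← h2, ← hs2]; rfl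
    have f4 : s2.realReg RReg.cur = s.realArr RArr.dist (s.natArr Arr.term i) := by
      rw [← k6, ← k4, ← h2, ← hs2]; rfl
    have f5 : s2.natReg Reg.far = s'.natReg Reg.far := by rw [← hs2]; rfl
    have f6 : s2.realReg RReg.far = s'.realReg RReg.far := by rw [← hs2]; rfl
    have f7 : s2.natReg Reg.bad = s'.natReg Reg.bad := by rw [← hs2]; rfl
    have f8 : s2.natReg Reg.zero = 0 := by rw [← k2, ← hs2]; rfl
    have f9 : s2.natReg Reg.one = 1 := by rw [← k3, ← hs2]; rfl
    have tail : ∀ t' s3, t' ≤ 3 → s3.natReg Reg.i = i + 1 →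
        s3.natReg Reg.v = s.natArr Arr.term i →
        s3.realReg RReg.cur = s.realArr RArr.dist (s.natArr Arr.term i) →
        s3.natReg Reg.far = s'.natReg Reg.far → s3.realReg RReg.far = s'.realReg RReg.far →
        (s3.natReg Reg.bad ≠ 0 ↔ s.natReg Reg.bad ≠ 0 ∨
          ∃ j < i + 1, s.natArr Arr.status (s.natArr Arr.term j) = 0) →
        Runs (ite (realLE RReg.cur RReg.far) .skip
          (block [natMove Reg.far Reg.v, realMove RReg.far RReg.cur])) s3 fun t'' s4 =>
          ∃ i ≤ k, s4.natReg Reg.i = i ∧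
            s4.realReg RReg.far = s.realArr RArr.dist (s4.natReg Reg.far) ∧
            (∃ j < k, s4.natReg Reg.far = s.natArr Arr.term j) ∧
            (∀ j < i, s.realArr RArr.dist (s.natArr Arr.term j) ≤ s4.realReg RReg.far) ∧
            (s4.natReg Reg.bad ≠ 0 ↔ s.natReg Reg.bad ≠ 0 ∨
              ∃ j < i, s.natArr Arr.status (s.natArr Arr.term j) = 0) ∧
            t + (5 + (t' + t'')) + 1 ≤ 15 * i := by
      intro t' s3 ht g1 g2 g3 g4 g5 g6
      refine Runs.ite (fun hc => Runs.skip ?_) fun hc => Runs.blockEnd 3 ?_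
      · change s3.realReg RReg.cur ≤ s3.realReg RReg.far at hc
        rw [g3, g5] at hc
        refine ⟨i + 1, by omega, g1, by rw [g5, g4, h3], ?_, fun j hj => ?_, g6, by omega⟩
        · rw [g4]; exact h4
        · rw [g5]
          rcases Nat.lt_succ_iff_lt_or_eq.1 hj with hj | rfl
          · exact h5 j hj
          · exact hc
      · change ¬ s3.realReg RReg.cur ≤ s3.realReg RReg.far at hc
        rw [g3, g5, not_le] at hc
        refine ⟨i + 1, by omega, g1, ?_, ⟨i, hb, ?_⟩, fun j hj => ?_, g6, by omega⟩
        · change s3.realReg RReg.cur = s.realArr RArr.dist (s3.natReg Reg.v)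
          rw [g2, g3]
        · change s3.natReg Reg.v = _
          exact g2
        · change _ ≤ s3.realReg RReg.cur
          rw [g3]
          rcases Nat.lt_succ_iff_lt_or_eq.1 hj with hj | rfl
          · exact (h5 j hj).trans hc.le
          · exact le_rfl
    refine Runs.ite (fun hc => Runs.blockEnd 2 ?_) fun hc => Runs.skip ?_
    · change s2.natReg Reg.sv = s2.natReg Reg.zero at hc
      rw [f3, f8] at hc
      refine tail 3 _ le_rfl f1 f2 f4 f5 f6 ?_
      refine iff_of_true ?_ (.inr ⟨i, by omega, hc⟩)
      change s2.natReg Reg.one ≠ 0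
      omega
    · change ¬ s2.natReg Reg.sv = s2.natReg Reg.zero at hc
      rw [f3, f8] at hc
      refine tail 2 _ (by omega) f1 f2 f4 f5 f6 ?_
      rw [f7, h6]
      refine or_congr_right ⟨fun ⟨j, hj, h⟩ => ⟨j, by omega, h⟩, fun ⟨j, hj, h⟩ => ?_⟩
      rcases Nat.lt_succ_iff_lt_or_eq.1 hj with hj | rfl
      · exact ⟨j, hj, h⟩
      · exact absurd h hc
  · rintro t s' ⟨i, h1, h2, h3, ⟨j, h4, h4'⟩, h5, h6, h7⟩ hk' hb
    have k1 : s'.natReg Reg.k = k := (hk'.natReg _ (by decide)).trans e1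
    change ¬ s'.natReg Reg.i < s'.natReg Reg.k at hb
    rw [h2, k1] at hb
    obtain rfl : i = k := by omega
    rw [h3, h4'] at h5
    exact ⟨⟨j, h4, h4', h5⟩, h6, by omega⟩

end RAM

/-! ### Farthest-point sequences and the selection phase -/

namespace RobustSP

open Function

variable {I : RobustSP}

theorem centers_update (σ : ℕ → Fin I.n) {i j : ℕ} (h : i ≤ j) (t : Fin I.n) :
    I.centers (update σ j t) i = I.centers σ i := by
  ext v
  refine or_congr_right (exists_congr fun l => and_congr_right fun hl => ?_)
  rw [update_of_ne (by omega)]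

theorem mem_centers_succ (σ : ℕ → Fin I.n) (j : ℕ) (v : Fin I.n) :
    v ∈ I.centers σ (j + 1) ↔ v = σ j ∨ v ∈ I.centers σ j := by
  constructor
  · rintro (h | ⟨i, hi, h⟩)
    · exact .inr (.inl h)
    · rcases Nat.lt_succ_iff_lt_or_eq.1 hi with hi | rfl
      · exact .inr (.inr ⟨i, hi, h⟩)
      · exact .inl h.symm
  · rintro (h | h | ⟨i, hi, h⟩)
    · exact .inr ⟨j, by omega, h.symm⟩
    · exact .inl h
    · exact .inr ⟨i, by omega, h⟩

/-- Each of the first `q` points is at least as far from the root and the points before it as any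
terminal. -/
def Farthest (I : RobustSP) (σ : ℕ → Fin I.n) (q : ℕ) : Prop :=
  ∀ j < q, ∀ τ, ∃ x, (∀ a ∈ I.centers σ j, ∀ p, I.IsWalk a (σ j) p → x ≤ I.walkLen ∅ p) ∧
    ∃ a ∈ I.centers σ j, ∃ p, I.IsWalk a (I.term τ) p ∧ I.walkLen ∅ p ≤ x

theorem Farthest.update {σ : ℕ → Fin I.n} {q : ℕ} (h : I.Farthest σ q) {t : Fin I.n} {x : ℝ}
    (h1 : ∀ a ∈ I.centers σ q, ∀ p, I.IsWalk a t p → x ≤ I.walkLen ∅ p)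
    (h2 : ∀ τ, ∃ a ∈ I.centers σ q, ∃ p, I.IsWalk a (I.term τ) p ∧ I.walkLen ∅ p ≤ x) :
    I.Farthest (update σ q t) (q + 1) := by
  intro j hj τ
  rw [centers_update σ (by omega)]
  rcases Nat.lt_succ_iff_lt_or_eq.1 hj with hj | rfl
  · rw [update_of_ne (by omega)]
    exact h j hj τ
  · rw [update_self]
    exact ⟨x, h1, h2 τ⟩

/-- All terminals can be reached from the root. -/
def Reachable (I : RobustSP) : Prop := ∀ τ, ∃ p, I.IsWalk I.root (I.term τ) p

end RobustSP

namespace RAM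

open Instr Program Test Heap Function

variable {I : RobustSP}

theorem Ready.term_eq {R : ℕ} {s : State} (h : Ready I R s) (τ : Fin I.k) :
    s.natArr Arr.term τ = I.term τ := by
  rw [h.term]
  exact RobustSP.toArr_of_lt (fun i => (I.term i : ℕ)) τ.2

theorem Ready.runs_dijkstra {L : ℕ} {s : State} (h : Ready I (2 * L) s) (hL : 0 < L)
    (hn : I.n < 2 ^ L) : Runs dijkstra s fun t s' => (Ready I (2 * L) s' ∧
      I.Distances {v | s.natArr Arr.source v ≠ 0} (s'.natArr Arr.status) (s'.realArr RArr.dist)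
        (s'.natArr Arr.pe) (s'.natArr Arr.pv) ∧
      t ≤ 1600 * I.m + (I.n + 1) * (600 * L + 600)) ∧ Keeps dijkstra s s' := by
  refine (RAM.runs_dijkstra rfl hn hL h.loaded h.valid).keeps.mono ?_
  rintro t s' ⟨⟨V, D, hst, ht⟩, hk⟩
  refine ⟨⟨h.of_keeps hk V (by decide) (by decide) (by decide) (by decide) (by decide) (by decide),
    RobustSP.distances_of_labels D hst, ht.trans (le_of_eq ?_)⟩, hk⟩
  change 800 * (2 * I.m) + (I.n + 1) * (300 * (2 * L + 1) + 300) = _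
  ring

/-- Select terminals, each as far as possible from the root and the terminals before it. -/
def selection : Program :=
  seq (block [natConst Reg.one 1, natStore Arr.source Reg.root Reg.one, natConst Reg.done 0,
    natConst Reg.bad 0]) <|
  .while (natLT Reg.done Reg.cnt) <|
    seq dijkstra <| seq farthest <|
    block [natStore Arr.sel Reg.done Reg.far, natConst Reg.one 1,
      natStore Arr.source Reg.far Reg.one, natSucc Reg.done]

/-- Any unreached terminal refutes reachability, since the root is always a source. Conversely, in
the first round the root is the only source, so every unreachable terminal is detected then. The
farthest-point property is claimed only when all terminals are reachable. -/
theorem runs_selection {L q : ℕ} {s : State} (h : Ready I (2 * L) s) (hL : 0 < L)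
    (hn : I.n < 2 ^ L) (hq : s.natReg Reg.cnt = q) (hs : ∀ v, s.natArr Arr.source v = 0) :
    Runs selection s fun t s' => Ready I (2 * L) s' ∧
      (∃ σ : ℕ → Fin I.n, (∀ i < q, s'.natArr Arr.sel i = σ i ∧ ∃ τ, I.term τ = σ i) ∧
        (I.Reachable → I.Farthest σ q)) ∧ (s'.natReg Reg.bad ≠ 0 → ¬ I.Reachable) ∧
      (¬ I.Reachable → 0 < q → s'.natReg Reg.bad ≠ 0) ∧
      t ≤ (1600 * I.m + (I.n + 1) * (600 * L + 600) + 20 * I.k + 20) * q + 10 := by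
  refine Runs.blockSeq 5 ?_
  generalize hs1 : runList _ s = s1
  have e1 : s1.natReg Reg.cnt = q := by rw [← hs1]; exact hq
  have e2 : Ready I (2 * L) s1 := h.of_keeps (p := block [natConst Reg.one 1,
    natStore Arr.source Reg.root Reg.one, natConst Reg.done 0, natConst Reg.bad 0])
    (hs1 ▸ (exec_block _ _).keeps) (by rw [← hs1]; exact h.valid) (by decide) (by decide)
    (by decide) (by decide) (by decide) (by decide)
  have e3 : s1.natArr Arr.source = update (s.natArr Arr.source) I.root 1 := by
    rw [← h.root, ← hs1]; rfl
  obtain ⟨D, hD⟩ : ∃ D, 1600 * I.m + (I.n + 1) * (600 * L + 600) = D := ⟨_, rfl⟩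
  rw [hD]
  refine Runs.while (fun t s' => ∃ j ≤ q, ∃ σ : ℕ → Fin I.n, s'.natReg Reg.done = j ∧
      Ready I (2 * L) s' ∧ (∀ i < j, s'.natArr Arr.sel i = σ i ∧ ∃ τ, I.term τ = σ i) ∧
      {v : Fin I.n | s'.natArr Arr.source v ≠ 0} = I.centers σ j ∧
      (I.Reachable → I.Farthest σ j) ∧ (s'.natReg Reg.bad ≠ 0 → ¬ I.Reachable) ∧
      (¬ I.Reachable → 0 < j → s'.natReg Reg.bad ≠ 0) ∧ t ≤ (D + 20 * I.k + 20) * j)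
    ((D + 20 * I.k + 20) * q) ?_ ?_ ?_ ?_
  · rintro t s' ⟨j, hj, σ, -, -, -, -, -, -, -, ht⟩
    exact ht.trans (Nat.mul_le_mul_left _ hj)
  · refine ⟨0, by omega, fun _ => I.root, by rw [← hs1]; rfl, e2, fun i hi => by omega, ?_,
      fun _ j hj => by omega, fun h0 => absurd ?_ h0, fun _ hj => by omega, by omega⟩
    · ext v
      rw [Set.mem_ofPred_eq, e3]
      rcases eq_or_ne v I.root with rfl | hne
      · rw [update_self]
        exact iff_of_true one_ne_zero (.inl rfl)
      · rw [update_of_ne fun h => hne (Fin.ext h), hs]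
        refine iff_of_false (fun h => h rfl) ?_
        rintro (h | ⟨i, hi, -⟩)
        · exact hne h
        · omega
    · rw [← hs1]; rfl
  · rintro t s' ⟨j, hj, σ, h1, h2, h3, h4, h5, h6, h7, h8⟩ hk hb
    have k1 : s'.natReg Reg.cnt = q := (hk.natReg _ (by decide)).trans e1
    change s'.natReg Reg.done < s'.natReg Reg.cnt at hb
    rw [h1, k1] at hb
    refine Runs.seq ((h2.runs_dijkstra hL hn).mono ?_)
    rintro t2 s2 ⟨⟨r2, D2, c2⟩, hk2⟩
    refine Runs.seq ((runs_farthest r2.k r2.loaded.zero I.k_pos).keeps.mono ?_)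
    rintro t3 s3 ⟨⟨⟨i, hi, f1, f2⟩, f3, c3⟩, hk3⟩
    have r3 : Ready I (2 * L) s3 := r2.of_keeps hk3
      (by rw [heap_congr hk3 (by decide) (by decide) (by decide)]; exact r2.valid) (by decide)
      (by decide) (by decide) (by decide) (by decide) (by decide)
    rw [r2.term_eq ⟨i, hi⟩] at f1
    have f2' : ∀ τ, s2.realArr RArr.dist (I.term τ) ≤ s2.realArr RArr.dist (I.term ⟨i, hi⟩) := by
      intro τ
      have := f2 τ τ.2
      rwa [r2.term_eq τ, r2.term_eq ⟨i, hi⟩] at this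
    have f3' : s3.natReg Reg.bad ≠ 0 ↔ s'.natReg Reg.bad ≠ 0 ∨
        ∃ τ, s2.natArr Arr.status (I.term τ) = 0 := by
      rw [f3, hk2.natReg _ (by decide)]
      refine or_congr_right ⟨fun ⟨j, hj, h⟩ => ⟨⟨j, hj⟩, ?_⟩, fun ⟨τ, h⟩ => ⟨τ, τ.2, ?_⟩⟩
      · rwa [← r2.term_eq ⟨j, hj⟩]
      · rwa [r2.term_eq τ]
    have hroot : I.root ∈ {v : Fin I.n | s'.natArr Arr.source v ≠ 0} := by
      rw [h4]
      exact .inl rfl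
    have hreach : I.Reachable → ∀ τ, s2.natArr Arr.status (I.term τ) ≠ 0 := by
      intro hr τ
      obtain ⟨p, hp⟩ := hr τ
      exact (D2.reached _ hroot _ p hp).1
    refine Runs.blockEnd 5 ?_
    generalize hs4 : runList _ s3 = s4
    have g1 : s4.natArr Arr.source = update (s'.natArr Arr.source) (I.term ⟨i, hi⟩) 1 := by
      rw [← hk2.natArr Arr.source (by decide), ← hk3.natArr Arr.source (by decide), ← f1, ← hs4]
      rfl
    have g2 : s4.natArr Arr.sel = update (s'.natArr Arr.sel) j (I.term ⟨i, hi⟩) := by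
      rw [← h1, ← hk2.natReg Reg.done (by decide), ← hk3.natReg Reg.done (by decide),
        ← hk2.natArr Arr.sel (by decide), ← hk3.natArr Arr.sel (by decide), ← f1, ← hs4]
      rfl
    have g3 : s4.natReg Reg.done = j + 1 := by
      rw [← h1, ← hk2.natReg Reg.done (by decide), ← hk3.natReg Reg.done (by decide), ← hs4]
      rfl
    have g4 : s4.natReg Reg.bad = s3.natReg Reg.bad := by rw [← hs4]; rfl
    refine ⟨j + 1, by omega, update σ j (I.term ⟨i, hi⟩), g3, ?_, fun l hl => ?_, ?_, fun hr => ?_,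
      ?_, fun hr _ => ?_, ?_⟩
    · exact r3.of_keeps (p := block [natStore Arr.sel Reg.done Reg.far, natConst Reg.one 1,
        natStore Arr.source Reg.far Reg.one, natSucc Reg.done])
        (hs4 ▸ (exec_block _ _).keeps) (by rw [← hs4]; exact r3.valid) (by decide) (by decide)
        (by decide) (by decide) (by decide) (by decide)
    · rw [g2]
      rcases Nat.lt_succ_iff_lt_or_eq.1 hl with hl | rfl
      · rw [update_of_ne (by omega), update_of_ne (by omega)]
        exact h3 l hl
      · rw [update_self, update_self]
        exact ⟨rfl, _, rfl⟩
    · ext v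
      rw [RobustSP.mem_centers_succ, update_self, RobustSP.centers_update _ le_rfl, ← h4,
        Set.mem_ofPred_eq, Set.mem_ofPred_eq, g1]
      rcases eq_or_ne v (I.term ⟨i, hi⟩) with rfl | hne
      · rw [update_self]
        exact iff_of_true one_ne_zero (.inl rfl)
      · rw [update_of_ne fun h => hne (Fin.ext h)]
        exact (or_iff_right hne).symm
    · refine (h5 hr).update (x := s2.realArr RArr.dist (I.term ⟨i, hi⟩)) (fun a ha p hp => ?_)
        fun τ => ?_
      · rw [← h4] at ha
        exact (D2.reached a ha _ p hp).2
      · obtain ⟨a, ha, p, hp, hl⟩ := D2.walk _ (hreach hr τ)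
        rw [h4] at ha
        exact ⟨a, ha, p, hp, hl.trans_le (f2' τ)⟩
    · rw [g4, f3']
      rintro (h | ⟨τ, h⟩)
      · exact h6 h
      · exact fun hr => hreach hr τ h
    · rw [g4, f3']
      by_cases hj0 : 0 < j
      · exact .inl (h7 hr hj0)
      · obtain rfl : j = 0 := by omega
        right
        by_contra! hcon
        refine hr fun τ => ?_
        obtain ⟨a, ha, p, hp, -⟩ := D2.walk _ (hcon τ)
        rw [h4] at ha
        rcases ha with ha | ⟨l, hl, -⟩
        · exact ⟨p, ha ▸ hp⟩
        · omega
    · rw [Nat.mul_add]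
      omega
  · rintro t s' ⟨j, hj, σ, h1, h2, h3, h4, h5, h6, h7, h8⟩ hk hb
    have k1 : s'.natReg Reg.cnt = q := (hk.natReg _ (by decide)).trans e1
    change ¬ s'.natReg Reg.done < s'.natReg Reg.cnt at hb
    rw [h1, k1] at hb
    obtain rfl : j = q := by omega
    exact ⟨h2, ⟨σ, h3, h5⟩, h6, h7, by omega⟩

end RAM

/-! ### Connecting the selected terminals -/

namespace RAM

open Instr Program Test Heap Function

variable {I : RobustSP}

/-- Find the selected terminal that is closest to the sources, among those not yet connected. -/
def nearest : Program :=
  seq (block [natLoad Reg.near Arr.sel Reg.done, natMove Reg.idx Reg.done, natMove Reg.i Reg.done,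
    realLoad RReg.far RArr.dist Reg.near]) <|
  .while (natLT Reg.i Reg.cnt) <|
    seq (block [natLoad Reg.v Arr.sel Reg.i, realLoad RReg.cur RArr.dist Reg.v]) <|
    seq (ite (realLE RReg.far RReg.cur) .skip
      (block [natMove Reg.near Reg.v, natMove Reg.idx Reg.i, realMove RReg.far RReg.cur])) <|
    block [natSucc Reg.i]

theorem runs_nearest {s : State} {j q : ℕ} (hq : s.natReg Reg.cnt = q) (hj : s.natReg Reg.done = j)
    (hjq : j < q) :
    Runs nearest s fun t s' => ∃ b, j ≤ b ∧ b < q ∧ s'.natReg Reg.idx = b ∧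
      s'.natReg Reg.near = s.natArr Arr.sel b ∧
      (∀ i, j ≤ i → i < q →
        s.realArr RArr.dist (s.natArr Arr.sel b) ≤ s.realArr RArr.dist (s.natArr Arr.sel i)) ∧
      t ≤ 15 * q + 10 := by
  refine Runs.blockSeq 5 ?_
  generalize hs1 : runList _ s = s1
  have e1 : s1.natReg Reg.cnt = q := by rw [← hs1]; exact hq
  have e4 : s1.natArr = s.natArr := by rw [← hs1]; rfl
  have e5 : s1.realArr = s.realArr := by rw [← hs1]; rfl
  refine Runs.while (fun t s' => ∃ i ≤ q, j ≤ i ∧ s'.natReg Reg.i = i ∧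
      ∃ b, j ≤ b ∧ b < q ∧ s'.natReg Reg.idx = b ∧
      s'.natReg Reg.near = s.natArr Arr.sel b ∧
      s'.realReg RReg.far = s.realArr RArr.dist (s.natArr Arr.sel b) ∧
      (∀ l, j ≤ l → l < i →
        s.realArr RArr.dist (s.natArr Arr.sel b) ≤ s.realArr RArr.dist (s.natArr Arr.sel l)) ∧
      t ≤ 15 * i) (15 * q) ?_ ?_ ?_ ?_
  · rintro t s' ⟨i, h1, -, -, b, -, -, -, -, -, -, h⟩
    omega
  · exact ⟨j, by omega, le_rfl, by rw [← hj, ← hs1]; rfl, j, le_rfl, hjq, by rw [← hj, ← hs1]; rfl,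
      by rw [← hj, ← hs1]; rfl, by rw [← hj, ← hs1]; rfl, fun l h1 h2 => by omega, by omega⟩
  · rintro t s' ⟨i, h1, h2, h3, b, h4, h5, h6, h7, h8, h9, h10⟩ hk hb
    have k1 : s'.natReg Reg.cnt = q := (hk.natReg _ (by decide)).trans e1
    have k2 : s'.natArr Arr.sel = s.natArr Arr.sel := by rw [hk.natArr _ (by decide), e4]
    have k3 : s'.realArr RArr.dist = s.realArr RArr.dist := by rw [hk.realArr _ (by decide), e5]
    change s'.natReg Reg.i < s'.natReg Reg.cnt at hb
    rw [h3, k1] at hb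
    refine Runs.blockSeq 3 (Runs.seq ?_)
    generalize hs2 : runList _ s' = s2
    have f1 : s2.natReg Reg.i = i := by rw [← h3, ← hs2]; rfl
    have f2 : s2.natReg Reg.v = s.natArr Arr.sel i := by rw [← k2, ← h3, ← hs2]; rfl
    have f3 : s2.realReg RReg.cur = s.realArr RArr.dist (s.natArr Arr.sel i) := by
      rw [← k3, ← k2, ← h3, ← hs2]; rfl
    have f4 : s2.natReg Reg.idx = b := by rw [← h6, ← hs2]; rfl
    have f5 : s2.natReg Reg.near = s.natArr Arr.sel b := by rw [← h7, ← hs2]; rfl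
    have f6 : s2.realReg RReg.far = s.realArr RArr.dist (s.natArr Arr.sel b) := by
      rw [← h8, ← hs2]; rfl
    refine Runs.ite (fun hc => Runs.skip (Runs.blockEnd 2 ?_))
      fun hc => Runs.blockEnd 4 (Runs.blockEnd 2 ?_)
    · change s2.realReg RReg.far ≤ s2.realReg RReg.cur at hc
      rw [f3, f6] at hc
      refine ⟨i + 1, by omega, by omega, by rw [← f1]; rfl, b, h4, h5, f4, f5, f6, fun l hl hli => ?_,
        by omega⟩
      rcases Nat.lt_succ_iff_lt_or_eq.1 hli with hli | rfl
      · exact h9 l hl hli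
      · exact hc
    · change ¬ s2.realReg RReg.far ≤ s2.realReg RReg.cur at hc
      rw [f3, f6, not_le] at hc
      refine ⟨i + 1, by omega, by omega, by rw [← f1]; rfl, i, h2, hb, f1, f2, f3, fun l hl hli => ?_,
        by omega⟩
      rcases Nat.lt_succ_iff_lt_or_eq.1 hli with hli | rfl
      · exact hc.le.trans (h9 l hl hli)
      · exact le_rfl
  · rintro t s' ⟨i, h1, h2, h3, b, h4, h5, h6, h7, h8, h9, h10⟩ hk hb
    have k1 : s'.natReg Reg.cnt = q := (hk.natReg _ (by decide)).trans e1
    change ¬ s'.natReg Reg.i < s'.natReg Reg.cnt at hb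
    rw [h3, k1] at hb
    obtain rfl : i = q := by omega
    exact ⟨b, h4, h5, h6, h7, h9, by omega⟩

/-- Remove all sources. -/
def clearSources : Program :=
  seq (block [natConst Reg.i 0, natConst Reg.c 0]) <|
  .while (natLT Reg.i Reg.n) <| block [natStore Arr.source Reg.i Reg.c, natSucc Reg.i]

theorem runs_clearSources {s : State} {n : ℕ} (hn : s.natReg Reg.n = n) :
    Runs clearSources s fun t s' => (∀ v < n, s'.natArr Arr.source v = 0) ∧ t ≤ 5 * n + 10 := by
  refine Runs.blockSeq 3 ?_
  generalize hs1 : runList _ s = s1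
  have e1 : s1.natReg Reg.n = n := by rw [← hs1]; exact hn
  have e2 : s1.natReg Reg.c = 0 := by rw [← hs1]; rfl
  refine Runs.while (fun t s' => ∃ i ≤ n, s'.natReg Reg.i = i ∧
    (∀ v < i, s'.natArr Arr.source v = 0) ∧ t ≤ 5 * i) (5 * n) ?_ ?_ ?_ ?_
  · rintro t s' ⟨i, h⟩
    omega
  · exact ⟨0, by omega, by rw [← hs1]; rfl, fun v hv => by omega, by omega⟩
  · rintro t s' ⟨i, h1, h2, h3, h4⟩ hk hb
    have k1 : s'.natReg Reg.n = n := (hk.natReg _ (by decide)).trans e1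
    have k2 : s'.natReg Reg.c = 0 := (hk.natReg _ (by decide)).trans e2
    change s'.natReg Reg.i < s'.natReg Reg.n at hb
    rw [h2, k1] at hb
    refine Runs.blockEnd 3 ⟨i + 1, by omega, by rw [← h2]; rfl, fun v hv => ?_, by omega⟩
    change update (s'.natArr Arr.source) (s'.natReg Reg.i) (s'.natReg Reg.c) v = 0
    rw [h2, k2]
    rcases eq_or_ne v i with rfl | hne
    · rw [update_self]
    · rw [update_of_ne hne]
      exact h3 v (by omega)
  · rintro t s' ⟨i, h1, h2, h3, h4⟩ hk hb
    have k1 : s'.natReg Reg.n = n := (hk.natReg _ (by decide)).trans e1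
    change ¬ s'.natReg Reg.i < s'.natReg Reg.n at hb
    rw [h2, k1] at hb
    obtain rfl : i = n := by omega
    exact ⟨h3, by omega⟩

/-- Buy the edges on the path from the vertex in register `near` to the closest source, and make all
vertices on it sources. -/
def trace : Program :=
  seq (block [natConst Reg.one 1, natLoad Reg.c Arr.source Reg.near]) <|
  .while (natEq Reg.c Reg.zero) <|
    block [natStore Arr.source Reg.near Reg.one, natLoad Reg.e Arr.pe Reg.near,
      natStore Arr.out Reg.e Reg.one, natLoad Reg.near Arr.pv Reg.near,
      natLoad Reg.c Arr.source Reg.near]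

theorem output_insert {s s' : State} {e : Fin I.m}
    (h : s'.natArr Arr.out = update (s.natArr Arr.out) e 1) :
    I.output s' = insert e (I.output s) := by
  ext x
  simp only [RobustSP.output, Finset.mem_filter, Finset.mem_univ, true_and, Finset.mem_insert]
  change s'.natArr Arr.out x = 1 ↔ x = e ∨ s.natArr Arr.out x = 1
  rw [h]
  rcases eq_or_ne x e with rfl | hne
  · simp
  · rw [update_of_ne fun h => hne (Fin.ext h)]
    exact (or_iff_right hne).symm

/-- Along the tree arcs the length bought plus the label of the current vertex does not increase, so
the purchase costs at most the label of the start. Each iteration turns one more vertex into a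
source, which bounds the time. -/
theorem runs_trace {s : State} {S : Set (Fin I.n)} {t₀ : Fin I.n} (hz : s.natReg Reg.zero = 0)
    (D : I.Distances S (s.natArr Arr.status) (s.realArr RArr.dist) (s.natArr Arr.pe)
      (s.natArr Arr.pv))
    (hS : {v : Fin I.n | s.natArr Arr.source v ≠ 0} = S) (h₀ : s.natReg Reg.near = t₀)
    (hst : s.natArr Arr.status t₀ ≠ 0) :
    Runs trace s fun t s' => (∀ v ∈ S, s'.natArr Arr.source v ≠ 0) ∧ s'.natArr Arr.source t₀ ≠ 0 ∧
      (∀ v : Fin I.n, s'.natArr Arr.source v ≠ 0 → ∃ a ∈ S, ∃ p, I.IsWalk a v p ∧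
        ∀ e ∈ p, e ∈ I.output s') ∧ I.output s ⊆ I.output s' ∧
      ∑ e ∈ I.output s', I.len e ≤ ∑ e ∈ I.output s, I.len e + s.realArr RArr.dist t₀ ∧
      t ≤ 10 * I.n + 10 := by
  refine Runs.blockSeq 3 ?_
  generalize hs1 : runList _ s = s1
  have e1 : s1.natReg Reg.zero = 0 := by rw [← hs1]; exact hz
  have e2 : s1.natReg Reg.one = 1 := by rw [← hs1]; rfl
  have e3 : s1.natArr = s.natArr := by rw [← hs1]; rfl
  let card (s' : State) : ℕ := (Finset.univ.filter fun v : Fin I.n => s'.natArr Arr.source v ≠ 0).card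
  have hcard : ∀ s', card s' ≤ I.n := fun s' =>
    (Finset.card_filter_le _ _).trans (by rw [Finset.card_univ, Fintype.card_fin])
  refine Runs.while (fun t s' => ∃ x : Fin I.n, s'.natReg Reg.near = x ∧
      s'.natReg Reg.c = s'.natArr Arr.source x ∧ s.natArr Arr.status x ≠ 0 ∧
      (∀ v ∈ S, s'.natArr Arr.source v ≠ 0) ∧ (x = t₀ ∨ s'.natArr Arr.source t₀ ≠ 0) ∧
      (∀ v : Fin I.n, s'.natArr Arr.source v ≠ 0 → v ∈ S ∨
        s.realArr RArr.dist x < s.realArr RArr.dist v ∧ ∃ p, I.IsWalk x v p ∧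
          ∀ e ∈ p, e ∈ I.output s') ∧ I.output s ⊆ I.output s' ∧
      ∑ e ∈ I.output s', I.len e + s.realArr RArr.dist x ≤
        ∑ e ∈ I.output s, I.len e + s.realArr RArr.dist t₀ ∧ t ≤ 10 * card s') (10 * I.n) ?_ ?_ ?_ ?_
  · rintro t s' ⟨x, -, -, -, -, -, -, -, -, ht⟩
    exact ht.trans (Nat.mul_le_mul_left _ (hcard s'))
  · have hout : I.output s1 = I.output s := by unfold RobustSP.output; rw [e3]
    refine ⟨t₀, by rw [← hs1]; exact h₀, by rw [← h₀, ← hs1]; rfl, hst, ?_, .inl rfl, ?_, ?_, ?_,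
      by omega⟩
    · rw [e3, ← hS]
      exact fun v hv => hv
    · rw [e3, ← hS]
      exact fun v hv => .inl hv
    · rw [hout]
    · rw [hout]
  · rintro t s' ⟨x, h1, h2, h3, h4, h5, h6, h7, h8, h9⟩ hk hb
    have k1 : s'.natReg Reg.zero = 0 := (hk.natReg _ (by decide)).trans e1
    have k2 : s'.natReg Reg.one = 1 := (hk.natReg _ (by decide)).trans e2
    have k3 : s'.natArr Arr.pe = s.natArr Arr.pe := by rw [hk.natArr _ (by decide), e3]
    have k4 : s'.natArr Arr.pv = s.natArr Arr.pv := by rw [hk.natArr _ (by decide), e3]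
    change s'.natReg Reg.c = s'.natReg Reg.zero at hb
    rw [h2, k1] at hb
    have hxS : x ∉ S := fun h => h4 x h hb
    obtain ⟨u, e, g1, g2, g3, g4, g5⟩ := (D.tree x h3).resolve_left hxS
    have hpos := I.len_pos e
    refine Runs.blockEnd 6 ?_
    generalize hs2 : runList _ s' = s2
    have f1 : s2.natReg Reg.near = u := by rw [← g4, ← k4, ← h1, ← hs2]; rfl
    have f2 : s2.natReg Reg.c = s2.natArr Arr.source u := by rw [← g4, ← k4, ← h1, ← hs2]; rfl
    have f3 : s2.natArr Arr.source = update (s'.natArr Arr.source) x 1 := by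
      rw [← k2, ← h1, ← hs2]; rfl
    have f4 : I.output s2 = insert e (I.output s') := by
      refine output_insert ?_
      rw [← g3, ← k3, ← h1]
      conv_rhs => rw [← k2]
      rw [← hs2]
      rfl
    refine ⟨u, f1, f2, g2, ?_, ?_, ?_, ?_, ?_, ?_⟩
    · intro v hv
      rw [f3, update_of_ne fun h => hxS ((Fin.ext h : v = x) ▸ hv)]
      exact h4 v hv
    · right
      rw [f3]
      rcases h5 with rfl | h5
      · rw [update_self]
        exact one_ne_zero
      · rw [update_of_ne fun h => h5 (by rw [h]; exact hb)]
        exact h5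
    · intro v hv
      rcases eq_or_ne v x with rfl | hne
      · refine .inr ⟨by linarith, [e], .single g1, ?_⟩
        simp [f4]
      · rw [f3, update_of_ne fun h => hne (Fin.ext h)] at hv
        refine (h6 v hv).imp id fun ⟨g6, p, g7, g8⟩ => ⟨by linarith, e :: p, .cons g1 g7, ?_⟩
        intro e' he'
        rw [f4, Finset.mem_insert]
        exact (List.mem_cons.1 he').imp id (g8 e')
    · rw [f4]
      exact h7.trans (Finset.subset_insert _ _)
    · rw [f4]
      have : ∑ e ∈ insert e (I.output s'), I.len e ≤ I.len e + ∑ e ∈ I.output s', I.len e := by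
        by_cases he : e ∈ I.output s'
        · rw [Finset.insert_eq_of_mem he]
          linarith
        · rw [Finset.sum_insert he]
      linarith
    · have : card s2 = card s' + 1 := by
        have hx : (Finset.univ.filter fun v : Fin I.n => s2.natArr Arr.source v ≠ 0) =
            insert x (Finset.univ.filter fun v : Fin I.n => s'.natArr Arr.source v ≠ 0) := by
          ext v
          simp only [Finset.mem_filter, Finset.mem_univ, true_and, Finset.mem_insert]
          rw [f3]
          rcases eq_or_ne v x with rfl | hne
          · simp
          · rw [update_of_ne fun h => hne (Fin.ext h)]
            exact (or_iff_right hne).symm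
        simp only [card]
        rw [hx, Finset.card_insert_of_notMem (by simp [hb])]
      omega
  · rintro t s' ⟨x, h1, h2, h3, h4, h5, h6, h7, h8, h9⟩ hk hb
    have k1 : s'.natReg Reg.zero = 0 := (hk.natReg _ (by decide)).trans e1
    change ¬ s'.natReg Reg.c = s'.natReg Reg.zero at hb
    rw [h2, k1] at hb
    -- All vertices marked during this walk have labels larger than that of `x`, so the source that
    -- stops the walk is an old one.
    have hxS : x ∈ S := (h6 x hb).resolve_right fun h => lt_irrefl _ h.1
    have hx0 : 0 ≤ s.realArr RArr.dist x := by
      obtain ⟨a, -, p, -, hp⟩ := D.walk x h3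
      rw [← hp]
      exact RobustSP.walkLen_nonneg ∅ p
    refine ⟨h4, ?_, fun v hv => ?_, h7, by linarith, ?_⟩
    · rcases h5 with rfl | h5
      · exact hb
      · exact h5
    · rcases h6 v hv with h | ⟨-, p, hp, hpe⟩
      · exact ⟨v, h, [], .nil v, by simp⟩
      · exact ⟨x, hxS, p, hp, hpe⟩
    · have := hcard s'
      omega

end RAM

namespace RAM

open Instr Program Test Heap Function

variable {I : RobustSP}

/-- Connect the selected terminals to the root: always the one that is closest to the root and the
vertices that are already connected. -/
def connection : Program :=
  seq clearSources <|
  seq (block [natConst Reg.one 1, natStore Arr.source Reg.root Reg.one, natConst Reg.done 0]) <|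
  .while (natLT Reg.done Reg.cnt) <|
    seq dijkstra <| seq nearest <|
    seq (block [natLoad Reg.v Arr.sel Reg.done, natStore Arr.sel Reg.idx Reg.v,
      natSucc Reg.done]) trace

/-- What is left to do after `j` of `q` terminals have been connected. -/
structure Pending (I : RobustSP) (σ : ℕ → Fin I.n) (q j : ℕ) (s : State) (N : Set (Fin I.n)) :
    Prop where
  sel : ∀ i < q, j ≤ i → ∃ v ∈ N, s.natArr Arr.sel i = v
  mem : ∀ v ∈ N, (∃ i < q, j ≤ i ∧ s.natArr Arr.sel i = v) ∧ ∃ p, I.IsWalk I.root v p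
  root : s.natArr Arr.source I.root ≠ 0
  cover : ∀ i < q, σ i ∈ N ∨ s.natArr Arr.source (σ i) ≠ 0
  walk : ∀ v : Fin I.n, s.natArr Arr.source v ≠ 0 → ∃ p, I.IsWalk I.root v p ∧
    ∀ e ∈ p, e ∈ I.output s
  attach : ∀ L, I.Attach {I.root} {v | ∃ i < q, σ i = v} L →
    ∃ L', I.Attach {v | s.natArr Arr.source v ≠ 0} N L' ∧ ∑ e ∈ I.output s, I.len e + L' ≤ L

/-- This is Prim's algorithm with shortest paths as links. Each round spends at most the distance of
the nearest pending point and, by `Attach.step`, lowers the length still needed by the same amount.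
The money spent plus the length still needed therefore never exceeds the length of any initial
system of connections. -/
theorem runs_connection {L q : ℕ} {s : State} (h : Ready I (2 * L) s) (hL : 0 < L)
    (hn : I.n < 2 ^ L) (hq : s.natReg Reg.cnt = q) (hout : I.output s = ∅) {σ : ℕ → Fin I.n}
    (hσ : ∀ i < q, s.natArr Arr.sel i = σ i) (hr : ∀ i < q, ∃ p, I.IsWalk I.root (σ i) p) :
    Runs connection s fun t s' => (∀ i < q, ∃ p, I.IsWalk I.root (σ i) p ∧
        ∀ e ∈ p, e ∈ I.output s') ∧
      (∀ L, I.Attach {I.root} {v | ∃ i < q, σ i = v} L → ∑ e ∈ I.output s', I.len e ≤ L) ∧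
      t ≤ (1600 * I.m + (I.n + 1) * (600 * L + 600) + 15 * q + 10 * I.n + 30) * q +
        5 * I.n + 20 := by
  refine Runs.seq ((runs_clearSources (n := I.n) h.loaded.n).keeps.mono ?_)
  rintro t0 s0 ⟨⟨a0, c0⟩, hk0⟩
  have r0 : Ready I (2 * L) s0 := h.of_keeps hk0
    (by rw [heap_congr hk0 (by decide) (by decide) (by decide)]; exact h.valid) (by decide)
    (by decide) (by decide) (by decide) (by decide) (by decide)
  refine Runs.blockSeq 4 ?_
  generalize hs1 : runList _ s0 = s1
  have hk1 : Keeps (block [natConst Reg.one 1, natStore Arr.source Reg.root Reg.one,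
      natConst Reg.done 0]) s0 s1 := hs1 ▸ (exec_block _ _).keeps
  have r1 : Ready I (2 * L) s1 := r0.of_keeps hk1
    (by rw [heap_congr hk1 (by decide) (by decide) (by decide)]; exact r0.valid) (by decide)
    (by decide) (by decide) (by decide) (by decide) (by decide)
  have e1 : s1.natReg Reg.cnt = q := by
    rw [hk1.natReg _ (by decide), hk0.natReg _ (by decide)]; exact hq
  have e2 : s1.natArr Arr.sel = s.natArr Arr.sel := by
    rw [hk1.natArr _ (by decide), hk0.natArr _ (by decide)]
  have e3 : s1.natArr Arr.source = update (s0.natArr Arr.source) I.root 1 := by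
    rw [← r0.root, ← hs1]; rfl
  have e4 : I.output s1 = ∅ := by
    rw [← hout]
    have : s1.natArr Arr.out = s.natArr Arr.out := by
      rw [hk1.natArr _ (by decide), hk0.natArr _ (by decide)]
    unfold RobustSP.output
    change (Finset.univ.filter fun e : Fin I.m => s1.natArr Arr.out e = 1) = _
    rw [this]
  have e5 : ∀ v : Fin I.n, s1.natArr Arr.source v ≠ 0 ↔ v = I.root := by
    intro v
    rw [e3]
    rcases eq_or_ne v I.root with rfl | hne
    · simp
    · rw [update_of_ne fun h => hne (Fin.ext h), a0 v v.2]
      exact iff_of_false (fun h => h rfl) hne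
  obtain ⟨D, hD⟩ : ∃ D, 1600 * I.m + (I.n + 1) * (600 * L + 600) = D := ⟨_, rfl⟩
  rw [hD]
  refine Runs.while (fun t s' => ∃ j ≤ q, ∃ N : Set (Fin I.n), s'.natReg Reg.done = j ∧
      Ready I (2 * L) s' ∧ Pending I σ q j s' N ∧ t ≤ (D + 15 * q + 10 * I.n + 30) * j)
    ((D + 15 * q + 10 * I.n + 30) * q) ?_ ?_ ?_ ?_
  · rintro t s' ⟨j, hj, N, -, -, -, ht⟩
    exact ht.trans (Nat.mul_le_mul_left _ hj)
  · refine ⟨0, by omega, {v | ∃ i < q, σ i = v}, by rw [← hs1]; rfl, r1,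
      ⟨fun i hi _ => ⟨σ i, ⟨i, hi, rfl⟩, ?_⟩, ?_, ?_, fun i hi => .inl ⟨i, hi, rfl⟩, ?_, ?_⟩,
      by omega⟩
    · rw [e2, hσ i hi]
    · rintro v ⟨i, hi, rfl⟩
      exact ⟨⟨i, hi, by omega, by rw [e2, hσ i hi]⟩, hr i hi⟩
    · exact (e5 _).2 rfl
    · intro v hv
      rw [(e5 v).1 hv]
      exact ⟨[], .nil _, by simp⟩
    · intro L' hL'
      refine ⟨L', ?_, by rw [e4]; simp⟩
      have : {v : Fin I.n | s1.natArr Arr.source v ≠ 0} = {I.root} := by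
        ext v
        exact e5 v
      rw [this]
      exact hL'
  · rintro t s' ⟨j, hj, N, h1, h2, P, h4⟩ hk hb
    have k1 : s'.natReg Reg.cnt = q := (hk.natReg _ (by decide)).trans e1
    change s'.natReg Reg.done < s'.natReg Reg.cnt at hb
    rw [h1, k1] at hb
    refine Runs.seq ((h2.runs_dijkstra hL hn).mono ?_)
    rintro t2 s2 ⟨⟨r2, D2, c2⟩, hk2⟩
    refine Runs.seq ((runs_nearest (q := q) (j := j) (by rw [hk2.natReg _ (by decide), k1])
      (by rw [hk2.natReg _ (by decide), h1]) hb).keeps.mono ?_)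
    rintro t3 s3 ⟨⟨b, f1, f2, f3, f4, f5, c3⟩, hk3⟩
    have r3 : Ready I (2 * L) s3 := r2.of_keeps hk3
      (by rw [heap_congr hk3 (by decide) (by decide) (by decide)]; exact r2.valid) (by decide)
      (by decide) (by decide) (by decide) (by decide) (by decide)
    refine Runs.blockSeq 4 ?_
    generalize hs4 : runList _ s3 = s4
    have hk4 : Keeps (block [natLoad Reg.v Arr.sel Reg.done, natStore Arr.sel Reg.idx Reg.v,
        natSucc Reg.done]) s3 s4 := hs4 ▸ (exec_block _ _).keeps
    have r4 : Ready I (2 * L) s4 := r3.of_keeps hk4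
      (by rw [heap_congr hk4 (by decide) (by decide) (by decide)]; exact r3.valid) (by decide)
      (by decide) (by decide) (by decide) (by decide) (by decide)
    have sel2 : s2.natArr Arr.sel = s'.natArr Arr.sel := hk2.natArr _ (by decide)
    have g1 : s4.natReg Reg.done = j + 1 := by
      rw [← h1, ← hk2.natReg Reg.done (by decide), ← hk3.natReg Reg.done (by decide), ← hs4]
      rfl
    have g2 : s4.natArr Arr.sel = update (s'.natArr Arr.sel) b (s'.natArr Arr.sel j) := by
      rw [← sel2, ← hk3.natArr Arr.sel (by decide), ← f3, ← h1,
        ← hk2.natReg Reg.done (by decide), ← hk3.natReg Reg.done (by decide), ← hs4]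
      rfl
    have g3 : s4.natArr Arr.source = s'.natArr Arr.source := by
      rw [hk4.natArr _ (by decide), hk3.natArr _ (by decide), hk2.natArr _ (by decide)]
    have g4 : s4.natArr Arr.status = s2.natArr Arr.status := by
      rw [hk4.natArr _ (by decide), hk3.natArr _ (by decide)]
    have g5 : s4.realArr RArr.dist = s2.realArr RArr.dist := by
      rw [hk4.realArr _ (by decide), hk3.realArr _ (by decide)]
    have g6 : s4.natArr Arr.pe = s2.natArr Arr.pe := by
      rw [hk4.natArr _ (by decide), hk3.natArr _ (by decide)]
    have g7 : s4.natArr Arr.pv = s2.natArr Arr.pv := by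
      rw [hk4.natArr _ (by decide), hk3.natArr _ (by decide)]
    have g8 : I.output s4 = I.output s' := by
      have : s4.natArr Arr.out = s'.natArr Arr.out := by
        rw [hk4.natArr _ (by decide), hk3.natArr _ (by decide), hk2.natArr _ (by decide)]
      unfold RobustSP.output
      change (Finset.univ.filter fun e : Fin I.m => s4.natArr Arr.out e = 1) = _
      rw [this]
    obtain ⟨t₀, ht₀, htb⟩ := P.sel b f2 f1
    have g9 : s4.natReg Reg.near = t₀ := by
      rw [hk4.natReg _ (by decide), f4, sel2, htb]
    have hst : ∀ v ∈ N, s2.natArr Arr.status v ≠ 0 := by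
      intro v hv
      obtain ⟨-, p, hp⟩ := P.mem v hv
      exact (D2.reached _ P.root _ p hp).1
    refine (runs_trace (S := {v | s'.natArr Arr.source v ≠ 0}) r4.loaded.zero
      (by rw [g4, g5, g6, g7]; exact D2) (by rw [g3]) g9 (by rw [g4]; exact hst _ ht₀)).keeps.mono ?_
    rintro t5 s5 ⟨⟨b1, b2, b3, b4, b5, c5⟩, hk5⟩
    have r5 : Ready I (2 * L) s5 := r4.of_keeps hk5
      (by rw [heap_congr hk5 (by decide) (by decide) (by decide)]; exact r4.valid) (by decide)
      (by decide) (by decide) (by decide) (by decide) (by decide)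
    have sel5 : s5.natArr Arr.sel = update (s'.natArr Arr.sel) b (s'.natArr Arr.sel j) := by
      rw [hk5.natArr _ (by decide), g2]
    rw [g8] at b4 b5
    rw [g5] at b5
    -- The pending points occupy the cells from `done` on. The connected point in cell `b` is
    -- overwritten by the content of cell `j`, and cell `j` is then given up.
    let N' : Set (Fin I.n) := {v | ∃ i < q, j + 1 ≤ i ∧ s5.natArr Arr.sel i = v}
    have hN' : N' ⊆ N := by
      rintro v ⟨i, hi, hji, hv⟩
      rw [sel5] at hv
      rcases eq_or_ne i b with rfl | hne
      · rw [update_self] at hv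
        obtain ⟨w, hw, hw'⟩ := P.sel j hb le_rfl
        rwa [← Fin.ext (hw'.symm.trans hv)]
      · rw [update_of_ne hne] at hv
        obtain ⟨w, hw, hw'⟩ := P.sel i hi (by omega)
        rwa [← Fin.ext (hw'.symm.trans hv)]
    have hN : N ⊆ insert t₀ N' := by
      intro v hv
      obtain ⟨⟨i, hi, hji, hvi⟩, -⟩ := P.mem v hv
      rcases eq_or_ne i b with rfl | hib
      · exact .inl (Fin.ext (hvi.symm.trans htb))
      · rcases eq_or_ne i j with rfl | hij
        · exact .inr ⟨b, f2, by omega, by rw [sel5, update_self, hvi]⟩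
        · exact .inr ⟨i, hi, by omega, by rw [sel5, update_of_ne hib, hvi]⟩
    refine ⟨j + 1, by omega, N', by rw [hk5.natReg _ (by decide), g1], r5,
      ⟨fun i hi hji => ?_, fun v hv => ⟨hv, (P.mem v (hN' hv)).2⟩, b1 _ P.root, fun i hi => ?_,
        fun v hv => ?_, fun L' hL' => ?_⟩, ?_⟩
    · suffices H : ∃ v : Fin I.n, s5.natArr Arr.sel i = v by
        obtain ⟨v, hv⟩ := H
        exact ⟨v, ⟨i, hi, hji, hv⟩, hv⟩
      rw [sel5]
      rcases eq_or_ne i b with rfl | hne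
      · rw [update_self]
        obtain ⟨w, -, hw⟩ := P.sel j hb le_rfl
        exact ⟨w, hw⟩
      · rw [update_of_ne hne]
        obtain ⟨w, -, hw⟩ := P.sel i hi (by omega)
        exact ⟨w, hw⟩
    · rcases P.cover i hi with hc | hc
      · rcases hN hc with hc | hc
        · rw [hc]
          exact .inr b2
        · exact .inl hc
      · exact .inr (b1 _ hc)
    · obtain ⟨a, ha, p, hp, hpe⟩ := b3 v hv
      obtain ⟨p', hp', hpe'⟩ := P.walk a ha
      refine ⟨p' ++ p, hp'.append hp, fun e he => ?_⟩
      rcases List.mem_append.1 he with he | he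
      · exact b4 (hpe' e he)
      · exact hpe e he
    · obtain ⟨L₁, hL₁, hle⟩ := P.attach L' hL'
      -- The label of `t₀` bounds from below all distances between sources and pending points,
      -- because `nearest` minimised over the pending cells.
      refine ⟨L₁ - s2.realArr RArr.dist t₀, hL₁.step ht₀ (fun u hu a ha p hp => ?_) ?_ hN hN',
        by linarith⟩
      · obtain ⟨⟨i, hi, hji, hui⟩, -⟩ := P.mem u hu
        have := f5 i hji hi
        rw [sel2, htb, hui] at this
        exact this.trans (D2.reached a ha u p hp).2
      · rintro v (rfl | hv)
        · exact b2
        · exact b1 v hv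
    · rw [Nat.mul_add]
      omega
  · rintro t s' ⟨j, hj, N, h1, h2, P, h4⟩ hk hb
    have k1 : s'.natReg Reg.cnt = q := (hk.natReg _ (by decide)).trans e1
    change ¬ s'.natReg Reg.done < s'.natReg Reg.cnt at hb
    rw [h1, k1] at hb
    obtain rfl : j = q := by omega
    have hN : ∀ v, v ∉ N := by
      intro v hv
      obtain ⟨⟨i, hi, hji, -⟩, -⟩ := P.mem v hv
      omega
    refine ⟨fun i hi => P.walk _ ((P.cover i hi).resolve_left (hN _)), fun L' hL' => ?_, by omega⟩
    obtain ⟨L₁, hL₁, hle⟩ := P.attach L' hL'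
    have := hL₁.nonneg
    linarith

end RAM

/-! ### The algorithm -/

namespace RAM

open Instr Program Test Heap Function

variable {I : RobustSP}

/-- The algorithm. -/
def robustPath : Program :=
  seq setup <| seq count <| seq selection <| ite (natEq Reg.bad Reg.zero) connection .skip

/-- With q, L and n positive and q ≤ k ≤ n, every term is dominated by a multiple of q·m or of
q·n·L. -/
theorem time_le {n m k q L : ℕ} (hL : 0 < L) (hq : 0 < q) (hqk : q ≤ k) (hkn : k ≤ n) :
    (20 * L + 30) * n + 20 * m + 30 + (10 * k + 10) +
      ((1600 * m + (n + 1) * (600 * L + 600) + 20 * k + 20) * q + 10) +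
      ((1600 * m + (n + 1) * (600 * L + 600) + 15 * q + 10 * n + 30) * q + 5 * n + 20) + 2 ≤
      q * (4000 * m + 6000 * (n * L)) := by
  obtain ⟨X, hX⟩ : ∃ X, n * L = X := ⟨_, rfl⟩
  have h1 : n ≤ X := hX ▸ Nat.le_mul_of_pos_right n hL
  have h2 : L ≤ X := hX ▸ Nat.le_mul_of_pos_left L (by omega)
  have h3 : (20 * L + 30) * n ≤ 50 * X := by
    have : (20 * L + 30) * n = 20 * X + 30 * n := by rw [← hX]; ring
    omega
  have h4 : (n + 1) * (600 * L + 600) ≤ 2400 * X := by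
    have : (n + 1) * (600 * L + 600) = 600 * X + 600 * n + 600 * L + 600 := by rw [← hX]; ring
    omega
  have h5 : (1600 * m + (n + 1) * (600 * L + 600) + 20 * k + 20) * q ≤
      (1600 * m + 2440 * X) * q := Nat.mul_le_mul_right _ (by omega)
  have h6 : (1600 * m + (n + 1) * (600 * L + 600) + 15 * q + 10 * n + 30) * q ≤
      (1600 * m + 2455 * X) * q := Nat.mul_le_mul_right _ (by omega)
  have h7 : (1600 * m + 2440 * X) * q + (1600 * m + 2455 * X) * q =
      3200 * (q * m) + 4895 * (q * X) := by ring
  have h8 : m ≤ q * m := Nat.le_mul_of_pos_left m hq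
  have h9 : X ≤ q * X := Nat.le_mul_of_pos_left X hq
  have h10 : q * (4000 * m + 6000 * X) = 4000 * (q * m) + 6000 * (q * X) := by ring
  rw [hX, h10]
  omega

theorem runs_robustPath (I : RobustSP) : Runs robustPath I.input fun t s' =>
    I.cost (I.output s') ≤ 4 * I.opt ∧ ∃ q L : ℕ, q ≤ I.k ∧ (q : ℝ) ≤ I.infl ∧ 2 ^ L ≤ 2 * I.n ∧
      t ≤ q * (4000 * I.m + 6000 * (I.n * L)) := by
  have hlam := I.one_lt_infl
  have hkn : I.k ≤ I.n := by
    simpa using Fintype.card_le_of_injective _ I.term_injective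
  refine Runs.seq ((runs_setup I).keeps.mono ?_)
  rintro t1 s1 ⟨⟨L, hL, hn, hLn, r1, c1⟩, hk1⟩
  refine Runs.seq ((runs_count r1.k r1.infl (by linarith)).keeps.mono ?_)
  rintro t2 s2 ⟨⟨q, a1, a2, a3, a4, c2⟩, hk2⟩
  have r2 : Ready I (2 * L) s2 := r1.of_keeps hk2
    (by rw [heap_congr hk2 (by decide) (by decide) (by decide)]; exact r1.valid) (by decide)
    (by decide) (by decide) (by decide) (by decide) (by decide)
  -- Since λ > 1 and there is a terminal, at least one round takes place; the first round is the one
  -- that detects unreachable terminals.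
  have hq : 0 < q := by
    refine Nat.pos_of_ne_zero ?_
    rintro rfl
    have := I.k_pos
    rcases a4 with h | h
    · omega
    · rw [Nat.cast_zero] at h
      linarith
  refine Runs.seq ((runs_selection r2 hL hn a1 fun v => ?_).keeps.mono ?_)
  · rw [hk2.natArr _ (by decide), hk1.natArr _ (by decide)]
    rfl
  rintro t3 s3 ⟨⟨r3, ⟨σ, b1, b2⟩, b3, b4, c3⟩, hk3⟩
  have hT := time_le (m := I.m) hL hq a2 hkn
  refine Runs.ite (fun hb => ?_) fun hb => Runs.skip ⟨?_, q, L, a2, a3, hLn, by omega⟩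
  · change s3.natReg Reg.bad = s3.natReg Reg.zero at hb
    rw [r3.loaded.zero] at hb
    have hreach : I.Reachable := by
      by_contra h
      exact b4 h hq hb
    have hout : I.output s3 = ∅ := by
      unfold RobustSP.output
      refine Finset.filter_eq_empty_iff.2 fun e _ he => ?_
      change s3.natArr Arr.out e = 1 at he
      rw [hk3.natArr _ (by decide), hk2.natArr _ (by decide), hk1.natArr _ (by decide)] at he
      exact zero_ne_one he
    refine (runs_connection r3 hL hn (by rw [hk3.natReg _ (by decide), a1]) hout
      (fun i hi => (b1 i hi).1) fun i hi => ?_).mono ?_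
    · obtain ⟨τ, hτ⟩ := (b1 i hi).2
      rw [← hτ]
      exact hreach τ
    rintro t4 s4 ⟨d1, d2, c4⟩
    exact ⟨I.cost_le a3 a4 (fun i hi => (b1 i hi).2) (b2 hreach) d1 d2 hreach, q, L, a2, a3, hLn,
      by omega⟩
  · change ¬ s3.natReg Reg.bad = s3.natReg Reg.zero at hb
    rw [r3.loaded.zero] at hb
    have := b3 hb
    unfold RobustSP.Reachable at this
    push Not at this
    obtain ⟨τ, hτ⟩ := this
    rw [I.opt_eq_top hτ, ENNReal.mul_top (by norm_num)]
    exact le_top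

end RAM

/-- From 2^L ≤ 2n ≤ n² and log 2 > 2/3. -/
theorem Real.nat_le_three_mul_log {n L : ℕ} (hn : 2 ≤ n) (h : 2 ^ L ≤ 2 * n) :
    (L : ℝ) ≤ 3 * Real.log n := by
  have hn' : (2 : ℝ) ≤ n := by exact_mod_cast hn
  have h1 : (2 : ℝ) ^ L ≤ 2 * n := by exact_mod_cast h
  have h2 := Real.log_le_log (by positivity) h1
  rw [Real.log_pow, Real.log_mul (by norm_num) (by linarith)] at h2
  have h3 := Real.log_le_log (by norm_num) hn'
  have h4 := Real.log_two_gt_d9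
  have h5 : (L : ℝ) * (2 / 3) ≤ L * Real.log 2 :=
    mul_le_mul_of_nonneg_left (by linarith) (Nat.cast_nonneg L)
  linarith

theorem mainTheorem4 :
    ∃ (P : RAM.Program) (C : ℝ), ∀ I : RobustSP,
      ∃ (t : ℕ) (s : RAM.State), RAM.Exec P I.input t s ∧
        (t : ℝ) ≤ C * (min I.infl (I.k : ℝ) * ((I.m : ℝ) + (I.n : ℝ) * Real.log (I.n : ℝ))) ∧
        I.cost (I.output s) ≤ 4 * I.opt := by
  -- The constant is 6000 times the factor 3 lost in replacing L by log n.
  refine ⟨RAM.robustPath, 18000, fun I => ?_⟩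
  obtain ⟨t, s, h, h1, q, L, h2, h3, h4, h5⟩ := RAM.runs_robustPath I
  refine ⟨t, s, h, ?_, h1⟩
  -- The root and a terminal are different vertices; with a single vertex log n would vanish and
  -- could not absorb L.
  have hn : 2 ≤ I.n := by
    have h6 := (I.term ⟨0, I.k_pos⟩).2
    have h7 := I.root.2
    have h8 : (I.term ⟨0, I.k_pos⟩ : ℕ) ≠ I.root := fun h => I.term_ne_root _ (Fin.ext h)
    omega
  have hL := Real.nat_le_three_mul_log hn h4
  have hq : (q : ℝ) ≤ min I.infl I.k := le_min h3 (by exact_mod_cast h2)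
  have h5' : (t : ℝ) ≤ q * (4000 * I.m + 6000 * (I.n * L)) := by exact_mod_cast h5
  have hmin : 0 ≤ min I.infl (I.k : ℝ) := (Nat.cast_nonneg q).trans hq
  calc (t : ℝ) ≤ q * (4000 * I.m + 6000 * (I.n * L)) := h5'
    _ ≤ min I.infl I.k * (4000 * I.m + 6000 * (I.n * (3 * Real.log I.n))) := by gcongr
    _ ≤ min I.infl I.k * (18000 * (I.m + I.n * Real.log I.n)) := by
        refine mul_le_mul_of_nonneg_left ?_ hmin
        have : (0 : ℝ) ≤ I.m := Nat.cast_nonneg _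
        linarith
    _ = 18000 * (min I.infl I.k * (I.m + I.n * Real.log I.n)) := by ring
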